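/- Let $\omega=e^{\pi i/3}$, $\rho=2$, $\Delta=\{0,1,\omega,\overline\omega\}$, and consider the recursion $$2R \;=\; R\,\cup\,(\omega+\overline\omega^{2}R)\,\cup\,(\overline\omega+\omega^{2}\overline R)\,\cup\,(1+\omega^{3}\overline R),\qquad (\ast)$$ with the four maps $w_0(z)=z$, $w_1(z)=\omega+\overline\omega^2z$, $w_2(z)=\overline\omega+\omega^2\overline z$, $w_3(z)=1+\omega^3\overline z$. **Notation.** Let $v_k=\frac{i}{\sqrt3}\omega^k$ $(0\le k\le 5)$, let $H$ be the regular hexagon with vertices $v_0,\dots,v_5$, and let $R_0$ be its right half, the trapezoid with vertices $v_0,v_3,v_4,v_5$. A placed tile is recorded by the isometry $g$ of $\mathbb C$ that carries the prototile onto it. Put $P_0=\{\mathrm{id}\}$ and $P_{n+1}=\{\,z\mapsto 2\,g(w_i(z)/2) : g\in P_n,\ 0\le i\le3\,\}$; these are the tiles obtained by $n$ iterations of $(\ast)$. A set $T$ of isometries *tessellates* $A\subseteq\mathbb C$ if the sets $g(R_0)$, $g\in T$, have union $A$ and pairwise intersections of measure $0$. $T$ is *produced by the recursion* if it tessellates $\mathbb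 C$ and every finite subset of $T$ is contained in $\varphi\circ P_n$ for some $n$ and some isometry $\varphi$. **The Taylor–Socolar monotile** is the hexagon $H$ with the following markings. With $s(a,b)=\frac14(v_a+3v_b)$, there are three black stripes: the segments from $s(5,4)$ to $s(1,2)$ (the long one), from $s(5,0)$ to $s(1,0)$, and from $s(2,3)$ to $s(4,3)$. Each vertex $v_k$ carries a flag, the vector $\epsilon_k\, i v_k$ with $(\epsilon_0,\dots,\epsilon_5)=(-1,-1,1,1,-1,1)$. A *Taylor–Socolar tiling* is a set $\mathcal T$ of isometries such that the hexagons $h(H)$, $h\in\mathcal T$, are the cells of a regular honeycomb tiling (the image under an isometry of $\{c+H:c\in\mathbb Z+\mathbb Z\omega\}$), each cell occurring exactly once, and such that (R1) the black stripes are continuous across all tile edges; (R2) if a vertex of one tile and a vertex of another tile are the two ends of a tile edge that separates these two tiles, then the flags of the two tiles at these vertices point in the same direction. Cutting each hexagon of $\mathcal T$ along its diagonal perpendicular to the long stripe gives the set of trapezoids $\mathrm{halves}(\mathcal T)=\{h,\ h\circ m: h\in\mathcal T\}$, where $m(z)=-\overline z$. **Theorem.** 1. $R_0$ is the unique non-empty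 compact set that satisfies $(\ast)$. For each $n$, $P_n$ has $4^n$ elements and tessellates $2^nR_0$. 2. The set of digits $\{w_i(0)\}$ is $\Delta$, and $R_0$ is the set of all $z=\sum_{k\ge1}\frac{z_k}{2^k}u_k$ with $z_k\in\Delta$ and $u_k^6=1$ whose partial sums come from the recursion, i.e. for which there are $g_0=\mathrm{id}$, $g_{n+1}(z)=2\,g_n(w_{i_n}(z)/2)$ with $g_n(0)/2^n=\sum_{k=1}^{n}\frac{z_k}{2^k}u_k$ for all $n$. 3. There are isometries $\varphi_n$ such that the sets $\varphi_n\circ P_n$ increase with $n$ and their union is a tessellation of the plane produced by the recursion. 4. The tessellations produced by the recursion are the Taylor–Socolar tilings: a set $T$ of isometries is produced by the recursion if and only if $T=\mathrm{halves}(\mathcal T)$ for some Taylor–Socolar tiling $\mathcal T$. 5. No tessellation produced by the recursion is invariant under a non-zero translation, even as a family of unmarked trapezoids $g(R_0)$. 6. The Taylor–Socolar monotile is aperiodic: Taylor–Socolar tilings exist, and none of them is invariant under a non-zero translation. -/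

import Mathlib

open MeasureTheory Filter Topology
open scoped ComplexConjugate

namespace TaylorSocolar

/-- The primitive sixth root of unity `exp (π i / 3)`. -/
noncomputable def ω : ℂ := Complex.exp (Real.pi * Complex.I / 3)

/-- The digits of the positional representation. -/
noncomputable def digits : Set ℂ := {0, 1, ω, conj ω}

/-- The four maps on the right-hand side of the recursion; the radix is `2`. -/
noncomputable def child : Fin 4 → ℂ → ℂ :=
  ![fun z => z,
    fun z => ω + (conj ω) ^ 2 * z,
    fun z => conj ω + ω ^ 2 * conj z,
    fun z => 1 + ω ^ 3 * conj z]

/-- The recursion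
`2 R = R ∪ (ω + conj ω ^ 2 R) ∪ (conj ω + ω ^ 2 conj R) ∪ (1 + ω ^ 3 conj R)`. -/
def Recursion (R : Set ℂ) : Prop :=
  (fun z => 2 * z) '' R =
    R ∪ (fun z => ω + (conj ω) ^ 2 * z) '' R ∪ (fun z => conj ω + ω ^ 2 * conj z) '' R ∪
      (fun z => 1 + ω ^ 3 * conj z) '' R

/-- The six vertices `i ω ^ k / √3` of the regular hexagon with centre `0` whose opposite sides
are at distance `1`. Vertex `0` is the top one, and they are numbered counterclockwise. -/
noncomputable def vertex (k : Fin 6) : ℂ := Complex.I / (Real.sqrt 3 : ℂ) * ω ^ (k : ℕ)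

/-- The regular hexagon (closed, solid). -/
noncomputable def hexagon : Set ℂ := convexHull ℝ (Set.range vertex)

/-- The trapezoid: the right half of the hexagon, with long side from `-i/√3` to `i/√3`, and
with the short parallel side on the line `Re z = 1/2`. -/
noncomputable def trapezoid : Set ℂ :=
  convexHull ℝ {vertex 0, vertex 3, vertex 4, vertex 5}

/-!
A placed tile is recorded by the isometry `g` that carries the prototile onto it (the tile
itself is the image of the prototile under `g`). The trapezoid is symmetric in the real axis but
the recursion distinguishes a trapezoid from its mirror image, which is why the isometry, and not
only the image, is recorded.
-/

/-- One inflation step: the trapezoid `g R` is magnified by the factor `2` about the origin, and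
this is the `i`-th piece of its subdivision. -/
noncomputable def subdivide (g : ℂ → ℂ) (i : Fin 4) : ℂ → ℂ := fun z => 2 * g (child i z / 2)

/-- The tiles of `2 ^ n R` that result from `n` iterations of the recursion. -/
noncomputable def iterates : ℕ → Set (ℂ → ℂ)
  | 0 => {id}
  | n + 1 => {h | ∃ g ∈ iterates n, ∃ i, h = subdivide g i}

/-- The trapezoids `g R`, for `g ∈ T`, cover exactly `A` and are essentially disjoint. -/
def Tessellates (T : Set (ℂ → ℂ)) (A : Set ℂ) : Prop :=
  (⋃ g ∈ T, g '' trapezoid) = A ∧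
    T.Pairwise fun g h => volume (g '' trapezoid ∩ h '' trapezoid) = 0

/-- A tessellation of the plane by trapezoids that is produced by the recursion: each finite
part of it occurs, up to an isometry of the plane, in some iterate of the recursion. -/
def Produced (T : Set (ℂ → ℂ)) : Prop :=
  Tessellates T Set.univ ∧
    ∀ F ⊆ T, F.Finite → ∃ (n : ℕ) (φ : ℂ → ℂ), Isometry φ ∧ F ⊆ (fun g => φ ∘ g) '' iterates n

/-! ### The Socolar-Taylor hexagonal prototile -/

/-- The point of the hexagon side from `a` to `b` at which a stripe ends: it is nearer to `b`. -/
noncomputable def stripeEnd (a b : Fin 6) : ℂ := (vertex a + 3 * vertex b) / 4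

/-- The black stripes of the prototile: a long one that joins two opposite sides and is shifted
off the centre, and two short ones that cut off the two opposite corners `0` and `3`. -/
noncomputable def stripes : Set ℂ :=
  segment ℝ (stripeEnd 5 4) (stripeEnd 1 2) ∪
    segment ℝ (stripeEnd 5 0) (stripeEnd 1 0) ∪
    segment ℝ (stripeEnd 2 3) (stripeEnd 4 3)

/-- The flag at each vertex of the prototile, as a vector perpendicular to the diagonal through
that vertex; the sign is `1` if the flag points counterclockwise. -/
noncomputable def flag (k : Fin 6) : ℂ :=
  (![-1, -1, 1, 1, -1, 1] : Fin 6 → ℂ) k * (Complex.I * vertex k)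

/-- The vector that the flag at vertex `k` becomes in the tile placed by the isometry `h`. -/
noncomputable def placedFlag (h : ℂ → ℂ) (k : Fin 6) : ℂ := h (vertex k + flag k) - h (vertex k)

/-- The triangular lattice `ℤ + ℤ ω`, the centres of the standard honeycomb. -/
def lattice : Set ℂ := {z | ∃ m n : ℤ, z = m + n * ω}

/-- The cells of the standard hexagonal tiling of the plane. -/
def honeycomb : Set (Set ℂ) := {A | ∃ c ∈ lattice, A = (fun z => c + z) '' hexagon}

/-- The tilings of the plane by the Socolar-Taylor prototile (rotated and reflected copies are
allowed). -/
structure IsTaylorSocolarTiling (𝒯 : Set (ℂ → ℂ)) : Prop where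
  isometry : ∀ h ∈ 𝒯, Isometry h
  /-- The tiles are the cells of a regular honeycomb, each being used once. -/
  cells : ∃ φ : ℂ → ℂ, Isometry φ ∧
    Set.BijOn (fun h => h '' hexagon) 𝒯 ((fun A => φ '' A) '' honeycomb)
  /-- First matching rule: the black stripes are continuous across the tile boundaries. -/
  stripes_match : ∀ h ∈ 𝒯, ∀ k ∈ 𝒯, h ≠ k → h '' stripes ∩ k '' hexagon = k '' stripes ∩ h '' hexagon
  /-- Second matching rule: if a vertex of one tile and a vertex of another tile are the two
  ends of a tile edge that separates these two tiles (so that centre, vertex, vertex, centre are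
  equally spaced on a line), then the flags at the two vertices point in the same direction. -/
  flags_match : ∀ h ∈ 𝒯, ∀ k ∈ 𝒯, ∀ a b : Fin 6,
    h (vertex a) - h 0 = k (vertex b) - h (vertex a) →
    k (vertex b) - h (vertex a) = k 0 - k (vertex b) →
    placedFlag h a = placedFlag k b

/-- Cut each hexagonal tile along the diagonal perpendicular to its long stripe. The two halves
are the trapezoid and its mirror image in that diagonal, so that the long stripe of the hexagon
consists of a line perpendicular to the parallel sides in each half. -/
def halves (𝒯 : Set (ℂ → ℂ)) : Set (ℂ → ℂ) :=
  𝒯 ∪ (fun h z => h (-conj z)) '' 𝒯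

end TaylorSocolar

open TaylorSocolar

namespace TaylorSocolar

/-! Every tile in sight has the form `Tile.map (x, d)` in a suitable frame, with `x` in the
triangular lattice L and `d` one of the twelve symmetries of the hexagon; for the iterates this is
`iterates_eq`. A hexagonal tiling is then a configuration assigning a symmetry to each lattice
point, and the matching rules become the sign equations `LegalOn` (`legalOn_univ_iff`). Local
statements about configurations are finite checks, and the geometry is linear arithmetic.

The rules force a hierarchy. Call the direction of the long stripe of a tile its axis. Around either
end of the cutting diagonal the stripes make the three axes distinct, and the flags couple the two
ends. It follows that off some sublattice coset a + 2L every axis points at the two adjacent points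
of a + 2L (`LegalOn.exists_proper`). Such a tile only relays the stripe and the flag of the larger
hexagons, so the configuration restricted to a + 2L is legal again (`Proper.legalOn_deflate`), and
the half hexagons of the original configuration are exactly the children of the half hexagons of the
restricted one (`Proper.halfTiles_eq`). Conversely, a legal partial configuration can be inflated
(`LegalOn.inflate`).

Produced implies Taylor–Socolar: by inflation every iterate consists of halves of a legal partial
configuration (`exists_legalOn_patch`), and a compactness argument merges the local configurations
into a global one (`LocallyPatch.exists_legal`).

Taylor–Socolar implies produced: pass up the hierarchy until the ancestors of a finite set of halves
are pairwise neighbours. They then lie in three hexagons around one vertex, and every legal star of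
this kind occurs in the fourth iterate (`LegalOn.starInPatch`, `LegalOn.locallyPatch`).

Aperiodicity is infinite descent: a period lies in 2L, and half of it is a period one level higher
(`LegalOn.period_eq_zero`).

The remaining claims are self-similarity arguments: contraction for uniqueness, area for essential
disjointness and counting, and an interior fixed point of one piece of the subdivision for growth to
the whole plane (`growth_map`). -/

/-! ### The combinatorial model -/

/-- The symmetries of the hexagon: `(k, b)` stands for `z ↦ ω ^ k * z` (if `b = false`) or
`z ↦ ω ^ k * conj z` (if `b = true`). -/
abbrev Sym := Fin 6 × Bool

/-- A tile of the lattice: the position of its centre and its orientation. -/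
abbrev Tile := (ℤ × ℤ) × Sym

/-- The six shortest vectors of the triangular lattice, in the basis `1`, `ω`. -/
def unit : Fin 6 → ℤ × ℤ := ![(1, 0), (0, 1), (-1, 1), (-1, 0), (0, -1), (1, -1)]

/-- The action of a symmetry on the directions of the sides of the hexagon. -/
def Sym.dir (d : Sym) (k : Fin 6) : Fin 6 := if d.2 then d.1 - k else d.1 + k

/-- The action of a symmetry on the vertices of the hexagon. -/
def Sym.vert (d : Sym) (k : Fin 6) : Fin 6 := if d.2 then d.1 + 3 - k else d.1 + k

/-- The composition of two symmetries. -/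
def Sym.comp (d f : Sym) : Sym := (d.dir f.1, xor d.2 f.2)

/-- The inverse of a symmetry. -/
def Sym.inv (d : Sym) : Sym := if d.2 then d else (-d.1, false)

/-- The action of a symmetry on the lattice. -/
def Sym.act (d : Sym) (x : ℤ × ℤ) : ℤ × ℤ := x.1 • unit d.1 + x.2 • unit (d.dir 1)

/-- Composition of a symmetry with the reflection `z ↦ -conj z`. -/
def Sym.flip (d : Sym) : Sym := (d.1 + 3, !d.2)

/-- Symmetries up to `Sym.flip`; the value is the vertex to which vertex `0` is carried. -/
def Sym.cls (d : Sym) : Fin 6 := if d.2 then d.1 + 3 else d.1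

/-- A direction up to sign. -/
def axis (k : Fin 6) : Fin 3 := ![0, 1, 2, 0, 1, 2] k

/-- Whether the stripe that crosses the side in direction `k` does so near its
counterclockwise end. -/
def Sym.edgeSign (d : Sym) (k : Fin 6) : Bool :=
  if d.2 then !(![false, true, false, true, true, false] : Fin 6 → Bool) (d.1 - k)
  else (![false, true, false, true, true, false] : Fin 6 → Bool) (k - d.1)

/-- Whether the flag at vertex `k` points counterclockwise. -/
def Sym.flagSign (d : Sym) (k : Fin 6) : Bool :=
  if d.2 then !(![false, false, true, true, false, true] : Fin 6 → Bool) (d.1 + 3 - k)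
  else (![false, false, true, true, false, true] : Fin 6 → Bool) (k - d.1)

/-- The composition of the placements of two tiles. -/
def Tile.comp (s t : Tile) : Tile := (s.1 + s.2.act t.1, s.2.comp t.2)

/-- The inverse of the placement of a tile. -/
def Tile.inv (s : Tile) : Tile := (-(s.2.inv.act s.1), s.2.inv)

/-- The tile whose placement is the identity. -/
def Tile.one : Tile := (0, (0, false))

/-- The directions of the three outer children. -/
def childDir : Fin 4 → Fin 6 := ![0, 1, 5, 0]

/-- The centres of the children. -/
def childPos : Fin 4 → ℤ × ℤ := ![0, unit 1, unit 5, unit 0]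

/-- The orientations of the children. -/
def childSym : Fin 4 → Sym := ![(0, false), (4, false), (2, true), (3, true)]

/-- The children of a tile after magnification. -/
def Tile.sub (t : Tile) (i : Fin 4) : Tile :=
  (2 • t.1 + t.2.act (childPos i), t.2.comp (childSym i))

/-- The set of all children of the tiles in `S`. -/
def subdiv (S : Set Tile) : Set Tile := {t | ∃ g ∈ S, ∃ i, t = g.sub i}

/-- The iterates of the recursion, starting with a single tile. -/
def patch (n : ℕ) : Set Tile := subdiv^[n] {Tile.one}

/-- The matching rules for the tiles whose centres are in `Z`. -/
structure LegalOn (Z : Set (ℤ × ℤ)) (δ : ℤ × ℤ → Sym) : Prop where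
  edge : ∀ x ∈ Z, ∀ k, x + unit k ∈ Z →
    (δ x).edgeSign k = !(δ (x + unit k)).edgeSign (k + 3)
  flag : ∀ x ∈ Z, ∀ k, x + unit (k + 1) + unit (k + 2) ∈ Z →
    (δ x).flagSign k = !(δ (x + unit (k + 1) + unit (k + 2))).flagSign (k + 3)

/-- The half hexagons of a configuration. -/
def halfTiles (δ : ℤ × ℤ → Sym) : Set Tile := {t | t.2.cls = (δ t.1).cls}

/-! ### Symmetries -/

lemma Sym.comp_assoc : ∀ a b c : Sym, (a.comp b).comp c = a.comp (b.comp c) := by decide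

lemma Sym.inv_comp : ∀ a : Sym, a.inv.comp a = (0, false) := by decide

lemma Sym.comp_inv : ∀ a : Sym, a.comp a.inv = (0, false) := by decide

lemma Sym.one_comp : ∀ a : Sym, Sym.comp (0, false) a = a := by decide

lemma Sym.comp_one : ∀ a : Sym, a.comp (0, false) = a := by decide

lemma Sym.cls_eq_iff : ∀ a b : Sym, a.cls = b.cls ↔ a = b ∨ a = b.flip := by decide

lemma Sym.comp_cls : ∀ a b c : Sym, b.cls = c.cls → (a.comp b).cls = (a.comp c).cls := by decide

lemma Sym.cls_flip : ∀ a : Sym, a.flip.cls = a.cls := by decide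

lemma axis_of_cls_eq : ∀ a b : Sym, a.cls = b.cls → axis a.1 = axis b.1 := by decide

lemma Sym.edgeSign_of_cls_eq : ∀ (a b : Sym) (k), a.cls = b.cls → a.edgeSign k = b.edgeSign k := by
  decide

lemma Sym.edgeSign_comp : ∀ (a b : Sym) (k),
    (a.comp b).edgeSign (a.dir k) = xor a.2 (b.edgeSign k) := by decide

lemma Sym.flagSign_comp : ∀ (a b : Sym) (k),
    (a.comp b).flagSign (a.vert k) = xor a.2 (b.flagSign k) := by decide

lemma Sym.dir_add_three : ∀ (a : Sym) (k), a.dir (k + 3) = a.dir k + 3 := by decide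

lemma Sym.vert_add_three : ∀ (a : Sym) (k), a.vert (k + 3) = a.vert k + 3 := by decide

/-- The long stripe is parallel to the axis and off the centre, so it leaves at the counterclockwise
end of one side and at the clockwise end of the opposite one. -/
lemma Sym.edgeSign_axis : ∀ (a : Sym) (k), axis a.1 = axis k →
    a.edgeSign (k + 3) = !a.edgeSign k := by decide

/-- The flags at the two ends of the cutting diagonal are equal as vectors; the counterclockwise
sense is reversed at the opposite end. -/
lemma Sym.flagSign_axis : ∀ (a : Sym) (k), axis a.1 = axis k →
    a.flagSign (k + 3) = !a.flagSign k := by decide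

/-- Away from its axis, the signs of a tile depend on the axis alone. Hence the rule between two
tiles holds automatically when their axes are the two directions other than `k`; the same is true of
flags. -/
lemma edgeSign_oblique : ∀ (a b : Sym) (k), axis a.1 ≠ axis k → axis b.1 ≠ axis k →
    axis a.1 ≠ axis b.1 → a.edgeSign k = !b.edgeSign (k + 3) := by decide

lemma flagSign_oblique : ∀ (a b : Sym) (k), axis a.1 ≠ axis k → axis b.1 ≠ axis k →
    axis a.1 ≠ axis b.1 → a.flagSign k = !b.flagSign (k + 3) := by decide

/-- A converse of `flagSign_oblique`; this is how flags constrain axes. -/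
lemma axis_ne_of_flagSign : ∀ (a b : Sym) (k), axis a.1 ≠ axis k → axis b.1 ≠ axis k →
    a.flagSign (k + 3) = (!b.flagSign k) → axis a.1 ≠ axis b.1 := by decide

lemma unit_add_three : ∀ k, unit (k + 3) = -unit k := by decide

lemma unit_add_unit : ∀ k, unit k + unit (k + 2) = unit (k + 1) := by decide

lemma Sym.act_unit : ∀ (d : Sym) (k), d.act (unit k) = unit (d.dir k) := by decide

lemma Sym.act_unit_add_unit : ∀ (d : Sym) (k), d.act (unit (k + 1)) + d.act (unit (k + 2)) =
    unit (d.vert k + 1) + unit (d.vert k + 2) := by decide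

lemma Sym.act_add (d : Sym) (x y : ℤ × ℤ) : d.act (x + y) = d.act x + d.act y := by
  simp only [Sym.act, Prod.fst_add, Prod.snd_add]; module

lemma Sym.act_zero (d : Sym) : d.act 0 = 0 := by simp [Sym.act]

lemma Sym.act_neg (d : Sym) (x : ℤ × ℤ) : d.act (-x) = -d.act x := by
  simp only [Sym.act, Prod.fst_neg, Prod.snd_neg]; module

lemma Sym.act_smul (d : Sym) (n : ℤ) (x : ℤ × ℤ) : d.act (n • x) = n • d.act x := by
  simp only [Sym.act, Prod.smul_fst, Prod.smul_snd, smul_eq_mul]; module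

lemma Sym.dir_comp : ∀ (a b : Sym) (k), (a.comp b).dir k = a.dir (b.dir k) := by decide

lemma Sym.act_comp (a b : Sym) (x : ℤ × ℤ) : (a.comp b).act x = a.act (b.act x) := by
  conv_rhs => rw [Sym.act.eq_def b]
  rw [Sym.act_add, Sym.act_smul, Sym.act_smul, Sym.act_unit, Sym.act_unit, ← Sym.dir_comp]
  rfl

lemma Sym.act_one (x : ℤ × ℤ) : Sym.act (0, false) x = x := by
  ext <;> simp [Sym.act, unit, Sym.dir]

/-! ### Tiles -/

lemma Tile.comp_assoc (a b c : Tile) : (a.comp b).comp c = a.comp (b.comp c) := by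
  simp [Tile.comp, Sym.comp_assoc, Sym.act_comp, Sym.act_add, add_assoc]

lemma Tile.inv_comp (a : Tile) : a.inv.comp a = Tile.one := by
  simp [Tile.comp, Tile.inv, Sym.inv_comp, Tile.one]

lemma Tile.comp_inv (a : Tile) : a.comp a.inv = Tile.one := by
  simp [Tile.comp, Tile.inv, Sym.comp_inv, Tile.one, Sym.act_neg, ← Sym.act_comp, Sym.act_one]

lemma Tile.one_comp (a : Tile) : Tile.one.comp a = a := by
  simp [Tile.comp, Tile.one, Sym.one_comp, Sym.act_one]

lemma Tile.inv_comp_cancel (a b : Tile) : a.inv.comp (a.comp b) = b := by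
  rw [← Tile.comp_assoc, Tile.inv_comp, Tile.one_comp]

lemma Tile.comp_inv_cancel (a b : Tile) : a.comp (a.inv.comp b) = b := by
  rw [← Tile.comp_assoc, Tile.comp_inv, Tile.one_comp]

/-- Magnification of the placement of a tile. -/
def Tile.double (s : Tile) : Tile := (2 • s.1, s.2)

lemma Tile.sub_comp (s t : Tile) (i : Fin 4) : (s.comp t).sub i = s.double.comp (t.sub i) := by
  simp only [Tile.comp, Tile.sub, Tile.double, Sym.comp_assoc, Sym.act_comp, Sym.act_add, two_smul]
  congr 1
  abel

lemma subdiv_image (s : Tile) (S : Set Tile) :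
    subdiv (s.comp '' S) = s.double.comp '' subdiv S := by
  ext t
  constructor
  · rintro ⟨_, ⟨g, hg, rfl⟩, i, rfl⟩
    exact ⟨_, ⟨g, hg, i, rfl⟩, (Tile.sub_comp ..).symm⟩
  · rintro ⟨_, ⟨g, hg, i, rfl⟩, rfl⟩
    exact ⟨_, ⟨g, hg, rfl⟩, i, (Tile.sub_comp ..).symm⟩

lemma subdiv_iterate_image (n : ℕ) (s : Tile) (S : Set Tile) :
    subdiv^[n] (s.comp '' S) = (Tile.double^[n] s).comp '' subdiv^[n] S := by
  induction n generalizing s S with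
  | zero => rfl
  | succ n ih => rw [Function.iterate_succ_apply, subdiv_image, ih]; rfl

lemma subdiv_mono {S T : Set Tile} (h : S ⊆ T) : subdiv S ⊆ subdiv T := by
  rintro _ ⟨g, hg, i, rfl⟩
  exact ⟨g, h hg, i, rfl⟩

lemma subdiv_iterate_mono (n : ℕ) {S T : Set Tile} (h : S ⊆ T) : subdiv^[n] S ⊆ subdiv^[n] T := by
  induction n generalizing S T with
  | zero => exact h
  | succ n ih => exact ih (subdiv_mono h)

lemma mem_subdiv_iterate_iff (n : ℕ) (S : Set Tile) (t : Tile) :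
    t ∈ subdiv^[n] S ↔ ∃ g ∈ S, t ∈ subdiv^[n] {g} := by
  induction n generalizing t with
  | zero => simp
  | succ n ih =>
    simp only [Function.iterate_succ_apply']
    constructor
    · rintro ⟨g, hg, i, rfl⟩
      obtain ⟨s, hs, h⟩ := (ih g).1 hg
      exact ⟨s, hs, g, h, i, rfl⟩
    · rintro ⟨s, hs, g, hg, i, rfl⟩
      exact ⟨g, (ih g).2 ⟨s, hs, hg⟩, i, rfl⟩

lemma patch_add (m n : ℕ) : subdiv^[n] (patch m) = patch (n + m) := by
  rw [patch, patch, Function.iterate_add_apply]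

/-! ### The first level of the hierarchy -/

lemma fin_add_three_add_three : ∀ k : Fin 6, k + 3 + 3 = k := by decide

/-- The three tiles meet at an end of the cutting diagonal of `c`, and the hypotheses are the stripe
rule on their three common sides. The three axes must be distinct, which leaves two arrangements. -/
lemma axis_of_triangle : ∀ (c d f : Sym) (k), axis c.1 = axis k →
    c.edgeSign (k + 1) = (!d.edgeSign (k + 4)) → c.edgeSign (k + 2) = (!f.edgeSign (k + 5)) →
    d.edgeSign (k + 3) = (!f.edgeSign k) →
    (axis d.1 = axis (k + 2) ∧ axis f.1 = axis (k + 1)) ∨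
      (axis d.1 = axis (k + 1) ∧ axis f.1 = axis (k + 2)) := by decide +kernel

/-- The axes of the four tiles that meet the ends of the diagonal of the tile at `x` are those of
a tile that is cut by the sides of the hexagons of the next level. -/
def Cut (δ : ℤ × ℤ → Sym) (x : ℤ × ℤ) (k : Fin 6) : Prop :=
  axis (δ x).1 = axis k ∧ axis (δ (x + unit (k + 1))).1 = axis (k + 2) ∧
    axis (δ (x + unit (k + 2))).1 = axis (k + 1) ∧ axis (δ (x + unit (k + 4))).1 = axis (k + 2) ∧
    axis (δ (x + unit (k + 5))).1 = axis (k + 1)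

lemma LegalOn.triangle {δ : ℤ × ℤ → Sym} (h : LegalOn Set.univ δ) (x : ℤ × ℤ) (k : Fin 6)
    (hk : axis (δ x).1 = axis k) :
    (axis (δ (x + unit (k + 1))).1 = axis (k + 2) ∧ axis (δ (x + unit (k + 2))).1 = axis (k + 1)) ∨
    (axis (δ (x + unit (k + 1))).1 = axis (k + 1) ∧
      axis (δ (x + unit (k + 2))).1 = axis (k + 2)) := by
  refine axis_of_triangle (δ x) _ _ k hk ?_ ?_ ?_
  · have := h.edge x trivial (k + 1) trivial
    rwa [show k + 1 + 3 = k + 4 from add_assoc k 1 3] at this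
  · have := h.edge x trivial (k + 2) trivial
    rwa [show k + 2 + 3 = k + 5 from add_assoc k 2 3] at this
  · have := h.edge (x + unit (k + 1)) trivial (k + 3) trivial
    have e : unit (k + 1) + unit (k + 3) = unit (k + 2) := by
      have := unit_add_unit (k + 1)
      rwa [show k + 1 + 2 = k + 3 from add_assoc k 1 2, show k + 1 + 1 = k + 2 from add_assoc k 1 1] at this
    rwa [add_assoc, e, fin_add_three_add_three] at this

lemma axis_facts : ∀ k : Fin 6, axis (k + 1) ≠ axis k ∧ axis (k + 2) ≠ axis k ∧
    axis (k + 1) ≠ axis (k + 2) ∧ axis (k + 3) = axis k ∧ axis (k + 4) = axis (k + 1) ∧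
    axis (k + 5) = axis (k + 2) := by decide

/-- The two tiles sit at the two ends of the side between `x` and `x + unit k`, so the flag rule
applies to them. -/
lemma LegalOn.opposite {δ : ℤ × ℤ → Sym} (h : LegalOn Set.univ δ) (x : ℤ × ℤ) (k : Fin 6)
    (h₁ : axis (δ (x + unit (k + 1))).1 ≠ axis k) (h₂ : axis (δ (x + unit (k + 5))).1 ≠ axis k) :
    axis (δ (x + unit (k + 1))).1 ≠ axis (δ (x + unit (k + 5))).1 := by
  refine axis_ne_of_flagSign _ _ k h₁ h₂ ?_
  have := h.flag (x + unit (k + 1)) trivial (k + 3) trivial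
  have e : ∀ k, unit (k + 1) + unit (k + 3 + 1) + unit (k + 3 + 2) = unit (k + 5) := by decide
  rwa [add_assoc, add_assoc, ← add_assoc (unit (k + 1)), e,
    fin_add_three_add_three] at this

/-- Each end of the cutting diagonal allows two arrangements, and the flag rule excludes the mixed
combinations. In the second alternative four neighbours have axes pointing at `x`, as for a centre
of the next level. -/
lemma LegalOn.cut_or {δ : ℤ × ℤ → Sym} (h : LegalOn Set.univ δ) (x : ℤ × ℤ) (k : Fin 6)
    (hk : axis (δ x).1 = axis k) :
    Cut δ x k ∨ (axis (δ (x + unit (k + 1))).1 = axis (k + 1) ∧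
      axis (δ (x + unit (k + 2))).1 = axis (k + 2) ∧
      axis (δ (x + unit (k + 4))).1 = axis (k + 1) ∧
      axis (δ (x + unit (k + 5))).1 = axis (k + 2)) := by
  obtain ⟨a1, a2, a3, a4, a5, a6⟩ := axis_facts k
  have t₁ := h.triangle x k hk
  have t₂ := h.triangle x (k + 3) (hk.trans a4.symm)
  rw [show k + 3 + 1 = k + 4 from add_assoc k 3 1, show k + 3 + 2 = k + 5 from add_assoc k 3 2, a5, a6] at t₂
  have o := h.opposite x k
  unfold Cut
  rcases t₁ with ⟨b, c⟩ | ⟨b, c⟩ <;> rcases t₂ with ⟨b', c'⟩ | ⟨b', c'⟩ <;> simp_all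

lemma unit_add_add_three (x : ℤ × ℤ) (k : Fin 6) : x + unit k + unit (k + 3) = x := by
  rw [unit_add_three]; abel

lemma Cut.add_three {δ : ℤ × ℤ → Sym} {x : ℤ × ℤ} {k : Fin 6} (h : Cut δ x k) :
    Cut δ x (k + 3) := by
  obtain ⟨a1, a2, a3, a4, a5, a6⟩ := axis_facts k
  obtain ⟨h1, h2, h3, h4, h5⟩ := h
  unfold Cut
  rw [show k + 3 + 1 = k + 4 from add_assoc k 3 1, show k + 3 + 2 = k + 5 from add_assoc k 3 2,
    show k + 3 + 4 = k + 1 from add_assoc k 3 4, show k + 3 + 5 = k + 2 from add_assoc k 3 5]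
  simp_all

/-- The other alternative of `LegalOn.cut_or` at the neighbour would make the axis of `x` point at
that neighbour, but this axis is `k`. -/
lemma LegalOn.cut_next {δ : ℤ × ℤ → Sym} (h : LegalOn Set.univ δ) {x : ℤ × ℤ} {k : Fin 6}
    (hc : Cut δ x k) :
    Cut δ (x + unit (k + 1)) (k + 2) ∧ Cut δ (x + unit (k + 2)) (k + 1) := by
  obtain ⟨a1, a2, a3, a4, a5, a6⟩ := axis_facts k
  obtain ⟨h1, h2, h3, h4, h5⟩ := hc
  constructor
  · refine (h.cut_or _ _ h2).resolve_right fun c => ?_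
    have := c.2.1
    rw [show k + 2 + 2 = (k + 1) + 3 from (add_assoc k 2 2).trans (add_assoc k 1 3).symm, unit_add_add_three, h1,
      show k + 1 + 3 = k + 4 from add_assoc k 1 3, a5] at this
    exact a1 this.symm
  · refine (h.cut_or _ _ h3).resolve_right fun c => ?_
    have := c.2.2.1
    rw [show k + 1 + 4 = (k + 2) + 3 from (add_assoc k 1 4).trans (add_assoc k 2 3).symm, unit_add_add_three, h1,
      show k + 1 + 1 = k + 2 from add_assoc k 1 1] at this
    exact a2 this.symm

/-- The tiles outside of the sublattice `a + 2 L` are cut by the sides of the hexagons of the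
next level, the centres of which form `a + 2 L`. -/
def Proper (δ : ℤ × ℤ → Sym) (a : ℤ × ℤ) : Prop :=
  ∀ x k, axis (δ (a + (2 : ℤ) • x + unit k)).1 = axis k

/-- If the tile at 0 is not cut, a neighbour whose axis points at it is. -/
lemma LegalOn.exists_cut {δ : ℤ × ℤ → Sym} (h : LegalOn Set.univ δ) : ∃ x k, Cut δ x k := by
  set k := (δ 0).1
  obtain ⟨a1, a2, a3, a4, a5, a6⟩ := axis_facts k
  rcases h.cut_or 0 k rfl with hc | hc
  · exact ⟨_, _, hc⟩
  · refine ⟨0 + unit (k + 1), k + 1, (h.cut_or _ _ hc.1).resolve_right fun c => ?_⟩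
    have := c.2.1
    have e := unit_add_unit (k + 1)
    rw [add_assoc, e, show k + 1 + 1 = k + 2 from add_assoc k 1 1, hc.2.1, show k + 1 + 2 = k + 3 from add_assoc k 1 2,
      a4] at this
    exact a2 this

lemma LegalOn.exists_cut_zero {δ : ℤ × ℤ → Sym} (h : LegalOn Set.univ δ) : ∃ x, Cut δ x 0 := by
  obtain ⟨x, k, hc⟩ := h.exists_cut
  have h1 := h.cut_next hc
  have h2 := h.cut_next hc.add_three
  fin_cases k
  · exact ⟨_, hc⟩
  · exact ⟨_, h2.1⟩
  · exact ⟨_, h2.2⟩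
  · exact ⟨_, hc.add_three⟩
  · exact ⟨_, h1.1⟩
  · exact ⟨_, h1.2⟩

/-- Two applications of `LegalOn.cut_next` in the same direction restore the axis 0. The four
displacements generate 2L. -/
lemma LegalOn.cut_step {δ : ℤ × ℤ → Sym} (h : LegalOn Set.univ δ) {x : ℤ × ℤ}
    (hc : Cut δ x 0) : Cut δ (x + (0, 2)) 0 ∧ Cut δ (x + (-2, 2)) 0 ∧ Cut δ (x + (0, -2)) 0 ∧
      Cut δ (x + (2, -2)) 0 := by
  have h1 := h.cut_next hc
  have h2 := h.cut_next hc.add_three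
  have h3 := h.cut_next h1.1.add_three
  have h4 := h.cut_next h1.2
  have h5 := h.cut_next h2.1.add_three
  have h6 := h.cut_next h2.2
  have c := h3.2
  have c' := h4.1.add_three
  have d := h5.2.add_three
  have d' := h6.1
  rw [add_assoc] at c c' d d'
  exact ⟨c, c', d, d'⟩

lemma LegalOn.cut_sublattice {δ : ℤ × ℤ → Sym} (h : LegalOn Set.univ δ) {x : ℤ × ℤ}
    (hc : Cut δ x 0) (y : ℤ × ℤ) : Cut δ (x + (2 : ℤ) • y) 0 := by
  have key : ∀ n : ℤ, ∀ z, Cut δ z 0 → Cut δ (z + (2 * n) • ((0, 1) : ℤ × ℤ)) 0 := by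
    intro n z hz
    induction n using Int.induction_on with
    | zero => simpa using hz
    | succ n ih =>
      convert (h.cut_step ih).1 using 1
      ext <;> simp; ring
    | pred n ih =>
      convert (h.cut_step ih).2.2.1 using 1
      ext <;> simp; ring
  have key' : ∀ n : ℤ, ∀ z, Cut δ z 0 → Cut δ (z + (2 * n) • ((-1, 1) : ℤ × ℤ)) 0 := by
    intro n z hz
    induction n using Int.induction_on with
    | zero => simpa using hz
    | succ n ih =>
      convert (h.cut_step ih).2.1 using 1
      ext <;> simp <;> ring
    | pred n ih =>
      convert (h.cut_step ih).2.2.2 using 1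
      ext <;> simp <;> ring_nf
  convert key (y.2 + y.1) _ (key' (-y.1) _ hc) using 1
  ext <;> simp
  ring

lemma LegalOn.exists_proper {δ : ℤ × ℤ → Sym} (h : LegalOn Set.univ δ) : ∃ a, Proper δ a := by
  obtain ⟨x, hx⟩ := h.exists_cut_zero
  have hc := h.cut_sublattice hx
  -- A cut tile with axis 0 lies on the side in direction 0 of a larger hexagon, whose centre is
  -- therefore `x - unit 0`. The cuts on `x + 2L` describe the axes on all three cosets other than
  -- that of the centre.
  refine ⟨x - unit 0, fun y k => ?_⟩
  have hk : k = 0 ∨ k = 0 + 1 ∨ k = 0 + 2 ∨ k = 0 + 3 ∨ k = 0 + 4 ∨ k = 0 + 5 := by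
    revert k; decide
  rcases hk with rfl | rfl | rfl | rfl | rfl | rfl
  · convert (hc y).1 using 4
    abel
  · convert (hc y).2.2.1 using 4
    ext <;> simp [unit]; ring
  · convert (hc (y - unit 0)).2.1 using 4
    ext <;> simp [unit]
    ring
  · refine (congrArg (fun z => axis (δ z).1) ?_).trans ((hc (y - unit 0)).1.trans (by decide))
    ext <;> simp [unit]; ring
  · refine (congrArg (fun z => axis (δ z).1) ?_).trans ((hc (y - unit 0)).2.2.2.2.trans (by decide))
    ext <;> simp [unit]; ring
  · refine (congrArg (fun z => axis (δ z).1) ?_).trans ((hc y).2.2.2.1.trans (by decide))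
    ext <;> simp [unit]; ring

/-! ### Deflation -/

/-- The configuration of the next level. -/
def deflate (δ : ℤ × ℤ → Sym) (a x : ℤ × ℤ) : Sym := δ (a + (2 : ℤ) • x)

lemma axis_add_three : ∀ k, axis (k + 3) = axis k := by decide

/-- The long stripe of the side tile continues the stripe of the larger hexagon across the gap,
since its sign flips twice. -/
lemma Proper.edgeSign {δ : ℤ × ℤ → Sym} {a : ℤ × ℤ} (hp : Proper δ a)
    (h : LegalOn Set.univ δ) (x : ℤ × ℤ) (k : Fin 6) :
    (δ (a + (2 : ℤ) • x + unit k)).edgeSign k = (deflate δ a x).edgeSign k := by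
  rw [deflate, h.edge (a + (2 : ℤ) • x) trivial k trivial, Sym.edgeSign_axis _ _ (hp x k),
    Bool.not_not]

/-- Between two partners of the next level lies a single tile with axis `k`, which relays the stripe
or the flag. The rules of the next level thus result from two applications of the present ones. -/
lemma Proper.legalOn_deflate {δ : ℤ × ℤ → Sym} {a : ℤ × ℤ} (hp : Proper δ a)
    (h : LegalOn Set.univ δ) : LegalOn Set.univ (deflate δ a) := by
  constructor
  · intro x _ k _
    have h₁ := hp.edgeSign h x k
    have h₂ := hp.edgeSign h (x + unit k) (k + 3)
    have e : a + (2 : ℤ) • (x + unit k) + unit (k + 3) = a + (2 : ℤ) • x + unit k := by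
      rw [unit_add_three]; module
    rw [e, Sym.edgeSign_axis _ _ (hp x k)] at h₂
    rw [← h₁, ← h₂, Bool.not_not]
  · intro x _ k _
    have h₁ := h.flag (a + (2 : ℤ) • x) trivial k trivial
    have h₂ := h.flag (a + (2 : ℤ) • x + unit (k + 1) + unit (k + 2)) trivial k trivial
    have hx : axis (δ (a + (2 : ℤ) • x + unit (k + 1) + unit (k + 2))).1 = axis k := by
      have := hp (x + unit (k + 1)) (k + 3)
      rw [axis_add_three] at this
      convert this using 4
      have := unit_add_unit k
      rw [← this, unit_add_three]
      module
    rw [Sym.flagSign_axis _ _ hx, Bool.not_not, h₂] at h₁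
    rw [deflate, deflate, h₁]
    congr 3
    module

lemma parity_cases (y : ℤ × ℤ) :
    ∃ x : ℤ × ℤ, y = (2 : ℤ) • x ∨ y = (2 : ℤ) • x + unit 0 ∨ y = (2 : ℤ) • x + unit 1 ∨
      y = (2 : ℤ) • x + unit 2 := by
  obtain ⟨m, n⟩ := y
  obtain ⟨p, rfl | rfl⟩ := m.even_or_odd' <;> obtain ⟨q, rfl | rfl⟩ := n.even_or_odd'
  · exact ⟨(p, q), .inl (by ext <;> simp)⟩
  · exact ⟨(p, q), .inr (.inr (.inl (by ext <;> simp [unit])))⟩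
  · exact ⟨(p, q), .inr (.inl (by ext <;> simp [unit]))⟩
  · exact ⟨(p + 1, q), .inr (.inr (.inr (by ext <;> simp [unit]; ring)))⟩

lemma two_smul_add_unit_ne (x y : ℤ × ℤ) (k : Fin 6) :
    (2 : ℤ) • x + unit k ≠ (2 : ℤ) • y := by
  intro h
  have h1 := congrArg Prod.fst h
  have h2 := congrArg Prod.snd h
  fin_cases k <;> simp [unit] at h1 h2 <;> omega

/-- The outer children in terms of directions. -/
lemma Tile.sub_pos (t : Tile) (i : Fin 4) (hi : i ≠ 0) :
    (t.sub i).1 = (2 : ℤ) • t.1 + unit (t.2.dir (childDir i)) := by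
  have : childPos i = unit (childDir i) := by revert i; decide
  rw [Tile.sub, this, Sym.act_unit]
  norm_num [two_smul]

lemma axis_child : ∀ (d : Sym) (i : Fin 4), i ≠ 0 →
    axis (d.comp (childSym i)).1 = axis (d.dir (childDir i)) := by decide

lemma edgeSign_child : ∀ (d : Sym) (i : Fin 4), i ≠ 0 →
    (d.comp (childSym i)).edgeSign (d.dir (childDir i)) = d.edgeSign (d.dir (childDir i)) := by
  decide

lemma cls_of_edgeSign : ∀ (a b : Sym) (k), axis a.1 = axis k → axis b.1 = axis k →
    a.edgeSign k = b.edgeSign k → a.cls = b.cls := by decide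

/-- The children of a half tile are half tiles of the configuration of the previous level. -/
lemma Tile.sub_cls {η δ : ℤ × ℤ → Sym} {a : ℤ × ℤ} {g : Tile} (i : Fin 4)
    (h₀ : η (a + (2 : ℤ) • g.1) = δ g.1)
    (h₁ : ∀ k, axis (η (a + (2 : ℤ) • g.1 + unit k)).1 = axis k)
    (h₂ : ∀ k, (η (a + (2 : ℤ) • g.1 + unit k)).edgeSign k = (δ g.1).edgeSign k)
    (hg : g.2.cls = (δ g.1).cls) : (g.sub i).2.cls = (η (a + (g.sub i).1)).cls := by
  by_cases hi : i = 0
  · subst hi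
    have : (g.sub 0).1 = (2 : ℤ) • g.1 := by
      simp [Tile.sub, childPos, Sym.act_zero, two_smul]
    rw [this, h₀, ← hg]
    simp [Tile.sub, childSym, Sym.comp_one]
  · rw [Tile.sub_pos _ _ hi, ← add_assoc]
    refine cls_of_edgeSign _ _ (g.2.dir (childDir i)) (axis_child _ _ hi) (h₁ _) ?_
    rw [h₂]
    exact (edgeSign_child _ _ hi).trans (Sym.edgeSign_of_cls_eq _ _ _ hg)

/-- The outer children of the two halves of a hexagon reach all six sides. -/
lemma exists_child : ∀ (c : Sym) (k : Fin 6), ∃ (d : Sym) (i : Fin 4), d.cls = c.cls ∧ i ≠ 0 ∧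
    d.dir (childDir i) = k := by decide

lemma eq_of_edgeSign : ∀ (a b : Sym) (k), axis a.1 = axis k → a.1 = b.1 →
    a.edgeSign k = b.edgeSign k → a = b := by decide

/-- An outer child is the half hexagon that faces the centre of its parent. -/
lemma child_fst : ∀ (d : Sym) (i : Fin 4), i ≠ 0 →
    (d.comp (childSym i)).1 = d.dir (childDir i) + 3 := by decide

lemma fst_eq_or_of_axis : ∀ (d : Sym) (k), axis d.1 = axis k → d.1 = k ∨ d.1 = k + 3 := by decide

/-- Translation of a tile. -/
def translation (a : ℤ × ℤ) : Tile := (a, (0, false))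

lemma translation_comp (a : ℤ × ℤ) (t : Tile) : (translation a).comp t = (a + t.1, t.2) := by
  simp [translation, Tile.comp, Sym.act_one, Sym.one_comp]

lemma Proper.halfTiles_eq {δ : ℤ × ℤ → Sym} {a : ℤ × ℤ} (hp : Proper δ a)
    (h : LegalOn Set.univ δ) :
    halfTiles δ = (translation a).comp '' subdiv (halfTiles (deflate δ a)) := by
  ext t
  constructor
  · intro ht
    -- A half facing the centre `x` is a child of a half of the hexagon at `x`; its handedness is
    -- determined by the edge sign.
    have key : ∀ x k, t.1 = a + (2 : ℤ) • x + unit k → t.2.1 = k + 3 →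
        t ∈ (translation a).comp '' subdiv (halfTiles (deflate δ a)) := by
      intro x k hx hk
      obtain ⟨d, i, hd, hi, hdk⟩ := exists_child (deflate δ a x) k
      refine ⟨_, ⟨(x, d), hd, i, rfl⟩, ?_⟩
      have h1 : axis (d.comp (childSym i)).1 = axis k := by rw [axis_child _ _ hi, hdk]
      rw [translation_comp, Tile.sub_pos _ _ hi]
      refine Prod.ext ?_ ?_
      · rw [hx, ← hdk, add_assoc]
      · refine eq_of_edgeSign _ _ k h1 ?_ ?_
        · rw [hk]
          exact (child_fst _ _ hi).trans (by rw [hdk])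
        · have := edgeSign_child d i hi
          rw [hdk] at this
          refine this.trans ?_
          rw [Sym.edgeSign_of_cls_eq _ _ k hd, ← hp.edgeSign h, ← hx]
          exact (Sym.edgeSign_of_cls_eq _ _ k ht).symm
    have key' : ∀ x k, t.1 = a + (2 : ℤ) • x + unit k →
        t ∈ (translation a).comp '' subdiv (halfTiles (deflate δ a)) := by
      intro x k hx
      have hk : axis t.2.1 = axis k := by
        rw [axis_of_cls_eq _ _ ht, hx, hp]
      -- A half that faces away from `x` faces the next centre `x + unit k`.
      rcases fst_eq_or_of_axis _ _ hk with hk | hk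
      · refine key (x + unit k) (k + 3) ?_ ?_
        · rw [hx, unit_add_three]; module
        · rw [fin_add_three_add_three, hk]
      · exact key x k hx hk
    obtain ⟨x, hx⟩ := parity_cases (t.1 - a)
    rcases hx with hx | hx | hx | hx
    · refine ⟨_, ⟨(x, t.2), ?_, 0, rfl⟩, ?_⟩
      · rw [halfTiles, Set.mem_ofPred_eq, deflate, ← hx, add_sub_cancel]
        exact ht
      · rw [translation_comp]
        refine Prod.ext ?_ ?_
        · have : a + (2 : ℤ) • x = t.1 := by rw [← hx]; abel
          simp only [Tile.sub, childPos, Matrix.cons_val_zero, Sym.act_zero, add_zero, ← this]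
          module
        · simp [Tile.sub, childSym, Sym.comp_one]
    all_goals exact key' x _ (by rw [add_assoc, ← hx]; abel)
  · rintro ⟨_, ⟨g, hg, i, rfl⟩, rfl⟩
    rw [translation_comp]
    exact Tile.sub_cls i rfl (hp g.1) (hp.edgeSign h g.1) hg

lemma LegalOn.halfTiles_eq {δ : ℤ × ℤ → Sym} (h : LegalOn Set.univ δ) (n : ℕ) :
    ∃ (s : Tile) (η : ℤ × ℤ → Sym), LegalOn Set.univ η ∧
      halfTiles δ = s.comp '' subdiv^[n] (halfTiles η) := by
  induction n with
  | zero => exact ⟨Tile.one, δ, h, by simp [Tile.one_comp]⟩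
  | succ n ih =>
    obtain ⟨s, η, hη, he⟩ := ih
    obtain ⟨a, ha⟩ := hη.exists_proper
    refine ⟨s.comp (Tile.double^[n] (translation a)), _, ha.legalOn_deflate hη, ?_⟩
    rw [he, ha.halfTiles_eq hη, subdiv_iterate_image, Function.iterate_succ_apply,
      Set.image_image]
    simp_rw [Tile.comp_assoc]

/-! ### Aperiodicity of the configurations -/

/-- An odd period would carry the coset a + 2L onto a coset of side tiles, where the axis is
constant. The deflated configuration would have a constant axis, contrary to its own hierarchy. -/
lemma LegalOn.even_period {δ : ℤ × ℤ → Sym} (h : LegalOn Set.univ δ) {u : ℤ × ℤ}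
    (hu : ∀ x, axis (δ (x + u)).1 = axis (δ x).1) {a : ℤ × ℤ} (ha : Proper δ a) :
    ∃ v, u = (2 : ℤ) • v := by
  by_contra hne
  have key : ∀ x k, u ≠ (2 : ℤ) • x + unit k := by
    rintro x k rfl
    have hd := ha.legalOn_deflate h
    obtain ⟨b, hb⟩ := hd.exists_proper
    have hc : ∀ y, axis (deflate δ a y).1 = axis k := by
      intro y
      have h1 := hu (a + (2 : ℤ) • (y - x - unit k) + unit k)
      rw [ha] at h1
      rw [← h1, deflate]
      congr 3
      module
    have := hb 0 (k + 1)
    rw [hc] at this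
    exact (axis_facts k).1 this.symm
  obtain ⟨x, hx | hx | hx | hx⟩ := parity_cases u
  · exact hne ⟨x, hx⟩
  all_goals exact key _ _ hx

/-- Infinite descent: half of the period is a period of the deflated configuration. Only axes are
compared, so the result applies to unmarked trapezoids. -/
lemma LegalOn.period_eq_zero {δ : ℤ × ℤ → Sym} (h : LegalOn Set.univ δ) {u : ℤ × ℤ}
    (hu : ∀ x, axis (δ (x + u)).1 = axis (δ x).1) : u = 0 := by
  induction hn : u.1.natAbs + u.2.natAbs using Nat.strong_induction_on generalizing δ u with
  | _ n ih =>
    obtain ⟨a, ha⟩ := h.exists_proper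
    obtain ⟨v, rfl⟩ := h.even_period hu ha
    by_cases hv : v = 0
    · simp [hv]
    · refine absurd (ih (v.1.natAbs + v.2.natAbs) ?_ (ha.legalOn_deflate h) (fun x => ?_) rfl) hv
      · have : v.1 ≠ 0 ∨ v.2 ≠ 0 := by
          by_contra hc
          push Not at hc
          exact hv (Prod.ext hc.1 hc.2)
        simp only [Prod.smul_fst, Prod.smul_snd, smul_eq_mul] at hn
        omega
      · rw [deflate, deflate, ← hu (a + (2 : ℤ) • x)]
        congr 3
        module

/-! ### Inflation -/

/-- The symmetry with a given axis, a given edge sign and a given flag sign. -/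
def edgeSym (k : Fin 6) (o f : Bool) : Sym := (if f then k + 3 else k, xor o f)

lemma axis_edgeSym : ∀ k o f, axis (edgeSym k o f).1 = axis k := by decide

lemma edgeSign_edgeSym : ∀ k o f, (edgeSym k o f).edgeSign k = o := by decide

lemma flagSign_edgeSym : ∀ k o f, (edgeSym k o f).flagSign k = f := by decide

open Classical in
/-- The tile on the side in direction `k` of the hexagon at `x`; the markings of the four
neighbouring hexagons are taken into account as far as these belong to `Z`. -/
noncomputable def edgeTile (Z : Set (ℤ × ℤ)) (δ : ℤ × ℤ → Sym) (x : ℤ × ℤ) (k : Fin 6) : Sym :=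
  edgeSym k
    (if x ∈ Z then (δ x).edgeSign k else !(δ (x + unit k)).edgeSign (k + 3))
    (if x + unit (k + 1) ∈ Z then !(δ (x + unit (k + 1))).flagSign (k + 3)
      else (δ (x + unit (k + 5))).flagSign k)

/-- The configuration of the previous level. -/
noncomputable def inflate (Z : Set (ℤ × ℤ)) (δ : ℤ × ℤ → Sym) (y : ℤ × ℤ) : Sym :=
  if y.1 % 2 = 0 then
    if y.2 % 2 = 0 then δ (y.1 / 2, y.2 / 2) else edgeTile Z δ (y.1 / 2, y.2 / 2) 1
  else
    if y.2 % 2 = 0 then edgeTile Z δ (y.1 / 2, y.2 / 2) 0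
    -- Since `unit 2 = (-1, 1)`, the point `(2 m + 1, 2 n + 1)` is `2 (m + 1, n) + unit 2`.
    else edgeTile Z δ (y.1 / 2 + 1, y.2 / 2) 2

/-- The positions of the tiles that meet the magnified hexagons at the points of `Z`. -/
def inflateSet (Z : Set (ℤ × ℤ)) : Set (ℤ × ℤ) :=
  {y | ∃ x ∈ Z, y = (2 : ℤ) • x ∨ ∃ k, y = (2 : ℤ) • x + unit k}

section
variable (Z : Set (ℤ × ℤ)) (δ : ℤ × ℤ → Sym)

lemma inflate_two_smul (x : ℤ × ℤ) : inflate Z δ ((2 : ℤ) • x) = δ x := by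
  simp [inflate]

lemma inflate_two_smul_add (x : ℤ × ℤ) (k : Fin 6) (hk : k = 0 ∨ k = 1 ∨ k = 2) :
    inflate Z δ ((2 : ℤ) • x + unit k) = edgeTile Z δ x k := by
  rcases hk with rfl | rfl | rfl
  · have : (2 * x.1 + 1) / 2 = x.1 := by omega
    simp [inflate, unit, Int.add_emod, this]
  · have : (2 * x.2 + 1) / 2 = x.2 := by omega
    simp [inflate, unit, Int.add_emod, this]
  · have : (2 * x.2 + 1) / 2 = x.2 := by omega
    have h : (2 * x.1 + -1) / 2 + 1 = x.1 := by omega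
    have h' : (2 * x.1 + -1) % 2 = 1 := by omega
    simp [inflate, unit, Int.add_emod, this, h, h']

lemma half_cases : ∀ k : Fin 6, (k = 0 ∨ k = 1 ∨ k = 2) ∨
    ∃ l, (l = 0 ∨ l = 1 ∨ l = 2) ∧ k = l + 3 := by decide

lemma inflate_two_smul_add_three (x : ℤ × ℤ) (k : Fin 6) (hk : k = 0 ∨ k = 1 ∨ k = 2) :
    inflate Z δ ((2 : ℤ) • x + unit (k + 3)) = edgeTile Z δ (x + unit (k + 3)) k := by
  rw [← inflate_two_smul_add _ _ _ _ hk]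
  congr 1
  rw [unit_add_three]; module

lemma axis_inflate (x : ℤ × ℤ) (k : Fin 6) :
    axis (inflate Z δ ((2 : ℤ) • x + unit k)).1 = axis k := by
  rcases half_cases k with hk | ⟨l, hl, rfl⟩
  · rw [inflate_two_smul_add _ _ _ _ hk]
    exact axis_edgeSym _ _ _
  · rw [inflate_two_smul_add_three _ _ _ _ hl, axis_add_three]
    exact axis_edgeSym _ _ _

variable {Z δ}

/-- The side tile reads its sign from one of two hexagons; if both belong to `Z`, the edge rule
makes the two readings agree. -/
lemma LegalOn.edgeSign_inflate (h : LegalOn Z δ) {x : ℤ × ℤ} (hx : x ∈ Z) (k : Fin 6) :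
    (inflate Z δ ((2 : ℤ) • x + unit k)).edgeSign k = (δ x).edgeSign k := by
  rcases half_cases k with hk | ⟨l, hl, rfl⟩
  · rw [inflate_two_smul_add _ _ _ _ hk, edgeTile, edgeSign_edgeSym, if_pos hx]
  · have e : x + unit (l + 3) + unit l = x := by rw [unit_add_three]; abel
    rw [inflate_two_smul_add_three _ _ _ _ hl, edgeTile, Sym.edgeSign_axis _ _ (axis_edgeSym _ _ _),
      edgeSign_edgeSym]
    split_ifs with hx'
    · have := h.edge _ hx' l (by rwa [e])
      rw [this, e, Bool.not_not]
    · rw [e, Bool.not_not]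

/-- The same for the two hexagons at the ends of the side, with the flag rule. -/
lemma LegalOn.flagSign_inflate (h : LegalOn Z δ) {x : ℤ × ℤ} (hx : x ∈ Z) (k : Fin 6) :
    (inflate Z δ ((2 : ℤ) • x + unit (k + 1) + unit (k + 2))).flagSign (k + 3) =
      !(δ x).flagSign k := by
  rcases half_cases k with hk | ⟨l, hl, rfl⟩
  · have e : (2 : ℤ) • x + unit (k + 1) + unit (k + 2) = (2 : ℤ) • (x + unit (k + 2)) + unit k := by
      rw [← unit_add_unit k]; module
    have e' : x + unit (k + 2) + unit (k + 5) = x := by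
      have := unit_add_three (k + 2)
      rw [show k + 2 + 3 = k + 5 from add_assoc k 2 3] at this
      rw [this]; abel
    have e'' : x + unit (k + 1) + unit (k + 2) = x + unit (k + 2) + unit (k + 1) := by abel
    rw [e, inflate_two_smul_add _ _ _ _ hk, edgeTile, Sym.flagSign_axis _ _ (axis_edgeSym _ _ _),
      flagSign_edgeSym]
    split_ifs with hx'
    · rw [h.flag x hx k (by rwa [e'']), e'']
    · rw [e']
  · have e : (2 : ℤ) • x + unit (l + 3 + 1) + unit (l + 3 + 2) =
        (2 : ℤ) • (x + unit (l + 4)) + unit l := by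
      rw [show l + 3 + 1 = l + 4 from add_assoc l 3 1, show l + 3 + 2 = l + 5 from add_assoc l 3 2]
      have : ∀ l, unit (l + 5) = unit (l + 4) + unit l := by decide
      rw [this]; module
    have e' : x + unit (l + 4) + unit (l + 1) = x := by
      have := unit_add_three (l + 1)
      rw [show l + 1 + 3 = l + 4 from add_assoc l 1 3] at this
      rw [this]; abel
    rw [e, inflate_two_smul_add _ _ _ _ hl, fin_add_three_add_three, edgeTile, flagSign_edgeSym,
      if_pos (by rwa [e']), e']

lemma mem_of_two_smul_mem {x : ℤ × ℤ} (hx : (2 : ℤ) • x ∈ inflateSet Z) : x ∈ Z := by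
  obtain ⟨y, hy, h | ⟨k, h⟩⟩ := hx
  · have : x = y := by
      have h1 := congrArg Prod.fst h
      have h2 := congrArg Prod.snd h
      simp at h1 h2
      exact Prod.ext h1 h2
    rwa [this]
  · exact absurd h.symm (two_smul_add_unit_ne _ _ _)

lemma unit_sum_edge : ∀ j k : Fin 6, axis j ≠ axis k → ∃ l, axis l ≠ axis j ∧ axis l ≠ axis k ∧
    (unit j + unit k = unit l ∨ unit j + unit k = (2 : ℤ) • unit j + unit l) := by decide

lemma unit_sum_flag : ∀ j k : Fin 6, axis j ≠ axis k → ∃ l m, axis l ≠ axis j ∧ axis l ≠ axis k ∧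
    unit j + (unit (k + 1) + unit (k + 2)) = (2 : ℤ) • unit m + unit l := by decide

lemma eq_or_of_axis : ∀ j k : Fin 6, axis j = axis k → k = j ∨ k = j + 3 := by decide

/-- A rule between a centre and a side tile holds because the side tile was made to relay. The
remaining rules concern two side tiles whose axes are the two directions other than `k`, and these
hold automatically. -/
lemma LegalOn.inflate (h : LegalOn Z δ) : LegalOn (inflateSet Z) (inflate Z δ) := by
  constructor
  · rintro _ ⟨x, hx, rfl | ⟨j, rfl⟩⟩ k hk
    · have h₁ := h.edgeSign_inflate hx k
      rw [inflate_two_smul, ← h₁, Sym.edgeSign_axis _ _ (axis_inflate _ _ _ _), Bool.not_not]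
    · by_cases hjk : axis j = axis k
      · have key : ∃ x' ∈ Z, (2 : ℤ) • x + unit j = (2 : ℤ) • x' + unit (k + 3) ∧
            (2 : ℤ) • x + unit j + unit k = (2 : ℤ) • x' := by
          rcases eq_or_of_axis _ _ hjk with rfl | rfl
          · have e : (2 : ℤ) • x + unit k + unit k = (2 : ℤ) • (x + unit k) := by module
            rw [e] at hk
            exact ⟨_, mem_of_two_smul_mem hk, by rw [unit_add_three]; module, e⟩
          · exact ⟨x, hx, by rw [fin_add_three_add_three], by rw [unit_add_three]; abel⟩
        obtain ⟨x', hx', e₁, e₂⟩ := key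
        have h₁ := h.edgeSign_inflate hx' (k + 3)
        have h₂ := axis_inflate Z δ x' (k + 3)
        rw [axis_add_three] at h₂
        rw [Sym.edgeSign_axis _ _ h₂] at h₁
        rw [e₂, inflate_two_smul, e₁, ← h₁, Bool.not_not]
      · obtain ⟨l, hl, hl', e⟩ := unit_sum_edge _ _ hjk
        have h₁ := axis_inflate Z δ x j
        have h₂ : axis (TaylorSocolar.inflate Z δ ((2 : ℤ) • x + unit j + unit k)).1 = axis l := by
          rcases e with e | e
          · rw [add_assoc, e, axis_inflate]
          · rw [add_assoc, e, ← add_assoc, ← smul_add, axis_inflate]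
        refine edgeSign_oblique _ _ _ ?_ ?_ ?_
        · rwa [h₁]
        · rwa [h₂]
        · rw [h₁, h₂]; exact hl.symm
  · rintro _ ⟨x, hx, rfl | ⟨j, rfl⟩⟩ k hk
    · rw [inflate_two_smul, h.flagSign_inflate hx, Bool.not_not]
    · by_cases hjk : axis j = axis k
      · have key : ∃ x' ∈ Z, (2 : ℤ) • x + unit j =
              (2 : ℤ) • x' + unit (k + 3 + 1) + unit (k + 3 + 2) ∧
            (2 : ℤ) • x + unit j + unit (k + 1) + unit (k + 2) = (2 : ℤ) • x' := by
          rcases eq_or_of_axis _ _ hjk with rfl | rfl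
          · have e : (2 : ℤ) • x + unit k + unit (k + 1) + unit (k + 2) =
                (2 : ℤ) • (x + unit (k + 1)) := by rw [← unit_add_unit k]; module
            rw [e] at hk
            refine ⟨_, mem_of_two_smul_mem hk, ?_, e⟩
            have : ∀ k, unit k = (2 : ℤ) • unit (k + 1) + (unit (k + 3 + 1) + unit (k + 3 + 2)) := by
              decide
            conv_lhs => rw [this]
            module
          · have : ∀ j, unit j + (unit (j + 3 + 1) + unit (j + 3 + 2)) = (2 : ℤ) • unit (j + 5) := by
              decide
            have e : (2 : ℤ) • x + unit j + unit (j + 3 + 1) + unit (j + 3 + 2) =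
                (2 : ℤ) • (x + unit (j + 5)) := by
              rw [smul_add, ← this]; abel
            rw [e] at hk
            refine ⟨_, mem_of_two_smul_mem hk, ?_, e⟩
            have : ∀ j, unit j = (2 : ℤ) • unit (j + 5) + (unit (j + 1) + unit (j + 2)) := by
              decide
            rw [fin_add_three_add_three]
            conv_lhs => rw [this]
            module
        obtain ⟨x', hx', e₁, e₂⟩ := key
        have h₁ := h.flagSign_inflate hx' (k + 3)
        rw [fin_add_three_add_three] at h₁
        rw [e₂, inflate_two_smul, e₁, h₁]
      · obtain ⟨l, m, hl, hl', e⟩ := unit_sum_flag _ _ hjk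
        have h₁ := axis_inflate Z δ x j
        have h₂ : axis (TaylorSocolar.inflate Z δ
            ((2 : ℤ) • x + unit j + unit (k + 1) + unit (k + 2))).1 = axis l := by
          rw [add_assoc, add_assoc, e, ← add_assoc, ← smul_add, axis_inflate]
        refine flagSign_oblique _ _ _ ?_ ?_ ?_
        · rwa [h₁]
        · rwa [h₂]
        · rw [h₁, h₂]; exact hl.symm

end

/-- Start from a single hexagon, where the rules are void, and inflate. Partial configurations
suffice, so no legal configuration of the whole plane is presupposed. -/
lemma exists_legalOn_patch (n : ℕ) : ∃ (Z : Set (ℤ × ℤ)) (δ : ℤ × ℤ → Sym), LegalOn Z δ ∧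
    ∀ t ∈ patch n, t.1 ∈ Z ∧ t.2.cls = (δ t.1).cls := by
  induction n with
  | zero =>
    refine ⟨{0}, fun _ => (0, false), ⟨?_, ?_⟩, ?_⟩
    · rintro _ rfl k hk
      revert hk; revert k
      simp only [Set.mem_singleton_iff]
      decide
    · rintro _ rfl k hk
      revert hk; revert k
      simp only [Set.mem_singleton_iff]
      decide
    · rintro _ rfl
      exact ⟨rfl, rfl⟩
  | succ n ih =>
    obtain ⟨Z, δ, h, hZ⟩ := ih
    refine ⟨_, _, h.inflate, fun t ht => ?_⟩
    rw [patch, Function.iterate_succ_apply'] at ht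
    obtain ⟨g, hg, i, rfl⟩ := ht
    obtain ⟨hg₁, hg₂⟩ := hZ g hg
    constructor
    · by_cases hi : i = 0
      · subst hi
        refine ⟨_, hg₁, .inl ?_⟩
        simp [Tile.sub, childPos, Sym.act_zero, two_smul]
      · exact ⟨_, hg₁, .inr ⟨_, Tile.sub_pos _ _ hi⟩⟩
    · have := Tile.sub_cls (η := TaylorSocolar.inflate Z δ) (δ := δ) (a := 0) (g := g) i
      simp only [zero_add] at this
      exact this (inflate_two_smul _ _ _) (axis_inflate _ _ _)
        (fun k => h.edgeSign_inflate hg₁ k) hg₂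

/-! ### Sets of tiles that are locally contained in patches -/

/-- The action of a placement on the lattice. -/
def Tile.pos (s : Tile) (x : ℤ × ℤ) : ℤ × ℤ := s.1 + s.2.act x

lemma Tile.inv_pos_pos (s : Tile) (x : ℤ × ℤ) : s.inv.pos (s.pos x) = x := by
  have := congrArg Prod.fst (Tile.inv_comp_cancel s (x, (0, false)))
  exact this

lemma Tile.pos_add (s : Tile) (x y : ℤ × ℤ) : s.pos (x + y) = s.pos x + s.2.act y := by
  rw [Tile.pos, Tile.pos, Sym.act_add, add_assoc]

lemma Sym.dir_inv : ∀ (d : Sym) (k), d.dir (d.inv.dir k) = k := by decide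

lemma Sym.vert_inv : ∀ (d : Sym) (k), d.vert (d.inv.vert k) = k := by decide

lemma LegalOn.image {Z : Set (ℤ × ℤ)} {δ : ℤ × ℤ → Sym} (h : LegalOn Z δ) (s : Tile) :
    LegalOn {x | s.inv.pos x ∈ Z} (fun x => s.2.comp (δ (s.inv.pos x))) := by
  constructor
  · intro x hx k hk
    have e : s.inv.pos (x + unit k) = s.inv.pos x + unit (s.2.inv.dir k) := by
      rw [Tile.pos_add, Tile.inv, Sym.act_unit]
    have := h.edge _ hx (s.2.inv.dir k) (by rwa [← e])
    have h₁ := Sym.edgeSign_comp s.2 (δ (s.inv.pos x)) (s.2.inv.dir k)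
    have h₂ := Sym.edgeSign_comp s.2 (δ (s.inv.pos (x + unit k))) (s.2.inv.dir k + 3)
    rw [Sym.dir_inv] at h₁
    rw [Sym.dir_add_three, Sym.dir_inv] at h₂
    rw [h₁, h₂, this, e, Bool.xor_not]
  · intro x hx k hk
    have e : s.inv.pos (x + unit (k + 1) + unit (k + 2)) =
        s.inv.pos x + unit (s.2.inv.vert k + 1) + unit (s.2.inv.vert k + 2) := by
      rw [add_assoc, Tile.pos_add, Tile.inv, Sym.act_add, Sym.act_unit_add_unit, ← add_assoc]
    have := h.flag _ hx (s.2.inv.vert k) (by rwa [← e])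
    have h₁ := Sym.flagSign_comp s.2 (δ (s.inv.pos x)) (s.2.inv.vert k)
    have h₂ := Sym.flagSign_comp s.2 (δ (s.inv.pos (x + unit (k + 1) + unit (k + 2))))
      (s.2.inv.vert k + 3)
    rw [Sym.vert_inv] at h₁
    rw [Sym.vert_add_three, Sym.vert_inv] at h₂
    rw [h₁, h₂, this, e, Bool.xor_not]

/-- Each finite subset of `S` is contained in a placed patch. -/
def LocallyPatch (S : Set Tile) : Prop :=
  ∀ F ⊆ S, F.Finite → ∃ (n : ℕ) (s : Tile), F ⊆ s.comp '' patch n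

lemma LocallyPatch.exists_legalOn {S : Set Tile} (h : LocallyPatch S) {F : Set Tile} (hF : F ⊆ S)
    (hfin : F.Finite) : ∃ (Z : Set (ℤ × ℤ)) (δ : ℤ × ℤ → Sym), LegalOn Z δ ∧
      ∀ t ∈ F, t.1 ∈ Z ∧ t.2.cls = (δ t.1).cls := by
  obtain ⟨n, s, hs⟩ := h F hF hfin
  obtain ⟨Z, δ, hδ, hZ⟩ := exists_legalOn_patch n
  refine ⟨_, _, hδ.image s, fun t ht => ?_⟩
  obtain ⟨p, hp, rfl⟩ := hs ht
  have e : s.inv.pos (s.comp p).1 = p.1 := s.inv_pos_pos p.1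
  rw [Set.mem_ofPred_eq, e]
  exact ⟨(hZ p hp).1, Sym.comp_cls _ _ _ (hZ p hp).2⟩

/-- The halves determine a hexagon only up to `Sym.flip`, which changes flags. Each finite region
admits a legal choice, and compactness makes the choices coherent. -/
lemma LocallyPatch.exists_legal {S : Set Tile} (h : LocallyPatch S)
    (hS : ∀ x, ∃ d, (x, d) ∈ S ∧ (x, d.flip) ∈ S) :
    ∃ δ, LegalOn Set.univ δ ∧ S = halfTiles δ := by
  choose d hd hd' using hS
  have hX : ∀ X : Finset (ℤ × ℤ), ∃ (Z : Set (ℤ × ℤ)) (δ : ℤ × ℤ → Sym), LegalOn Z δ ∧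
      ∀ x ∈ X, x ∈ Z ∧ (d x).cls = (δ x).cls := by
    intro X
    obtain ⟨Z, δ, hδ, hZ⟩ := h.exists_legalOn (F := (fun x => (x, d x)) '' X)
      (by rintro _ ⟨x, -, rfl⟩; exact hd x) (X.finite_toSet.image _)
    exact ⟨Z, δ, hδ, fun x hx => hZ (x, d x) ⟨x, hx, rfl⟩⟩
  choose Z η hη hZ using hX
  -- At each lattice point the finitely many values converge along an ultrafilter; each rule
  -- involves two points and so survives in the limit.
  let U : Ultrafilter (Finset (ℤ × ℤ)) := Ultrafilter.of atTop
  have hU : ∀ x, ∀ᶠ X in (U : Filter (Finset (ℤ × ℤ))), x ∈ X := by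
    intro x
    refine (Ultrafilter.of_le (atTop : Filter (Finset (ℤ × ℤ)))) ?_
    filter_upwards [eventually_ge_atTop {x}] with X hX
    exact hX (Finset.mem_singleton_self x)
  have hlim : ∀ x, ∃ c, ∀ᶠ X in (U : Filter (Finset (ℤ × ℤ))), η X x = c := by
    intro x
    obtain ⟨c, hc⟩ := Ultrafilter.eq_pure_of_finite (U.map fun X => η X x)
    refine ⟨c, ?_⟩
    have : ({c} : Set Sym) ∈ U.map fun X => η X x := by rw [hc]; exact Set.mem_singleton c
    exact this
  choose δ hδ using hlim
  have hcls : ∀ x, (d x).cls = (δ x).cls := by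
    intro x
    obtain ⟨X, h₁, h₂⟩ := ((hU x).and (hδ x)).exists
    rw [← h₂]
    exact (hZ X x h₁).2
  refine ⟨δ, ⟨fun x _ k _ => ?_, fun x _ k _ => ?_⟩, ?_⟩
  · obtain ⟨X, ⟨h₁, h₂⟩, h₃, h₄⟩ := (((hU x).and (hδ x)).and
      ((hU (x + unit k)).and (hδ (x + unit k)))).exists
    rw [← h₂, ← h₄]
    exact (hη X).edge x (hZ X _ h₁).1 k (hZ X _ h₃).1
  · obtain ⟨X, ⟨h₁, h₂⟩, h₃, h₄⟩ := (((hU x).and (hδ x)).and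
      ((hU (x + unit (k + 1) + unit (k + 2))).and (hδ (x + unit (k + 1) + unit (k + 2))))).exists
    rw [← h₂, ← h₄]
    exact (hη X).flag x (hZ X _ h₁).1 k (hZ X _ h₃).1
  · ext ⟨x, c⟩
    rw [halfTiles, Set.mem_ofPred_eq, ← hcls]
    constructor
    · intro hc
      obtain ⟨Z', δ', -, hZ'⟩ := h.exists_legalOn (F := {(x, c), (x, d x)})
        (by rintro _ (rfl | rfl); exacts [hc, hd x]) (by simp)
      exact (hZ' (x, c) (by simp)).2.trans (hZ' (x, d x) (by simp)).2.symm
    · intro hc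
      rcases (Sym.cls_eq_iff _ _).1 hc with hc | hc
      · change c = d x at hc
        rw [hc]; exact hd x
      · change c = (d x).flip at hc
        rw [hc]; exact hd' x

/-! ### The three tiles at a vertex -/

/-- The tiles of a patch as a list. -/
def patchList : ℕ → List Tile
  | 0 => [Tile.one]
  | n + 1 => (patchList n).flatMap fun g => [g.sub 0, g.sub 1, g.sub 2, g.sub 3]

lemma mem_patch_of_mem_patchList {n : ℕ} {t : Tile} (h : t ∈ patchList n) : t ∈ patch n := by
  induction n generalizing t with
  | zero => simpa [patchList, patch] using h
  | succ n ih =>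
    simp only [patchList, List.mem_flatMap] at h
    obtain ⟨g, hg, h⟩ := h
    rw [patch, Function.iterate_succ_apply']
    refine ⟨g, ih hg, ?_⟩
    simp only [List.mem_cons, List.not_mem_nil, or_false] at h
    rcases h with h | h | h | h
    exacts [⟨0, h⟩, ⟨1, h⟩, ⟨2, h⟩, ⟨3, h⟩]

/-- Placements that carry the three hexagons at a vertex into the fourth patch, if the first one
is the centre of a hexagon of the next level. -/
def centralPlacement : Fin 6 → Tile :=
  ![((0, 2), (4, false)), ((2, 0), (4, true)), ((2, 0), (5, true)), ((0, 2), (1, false)),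
    ((0, 2), (0, false)), ((0, 2), (5, false))]

/-- Placements that carry the three hexagons at a vertex into the fourth patch, if all of them are
cut by the sides of the hexagons of the next level. -/
def outerPlacement (c₀ c₁ c₂ : Fin 6) : Tile :=
  if c₀ = 2 then
    if c₁ = 1 then
      if c₂ = 0 then ((1, 3), (0, false)) else ((1, 0), (5, true))
    else if c₂ = 0 then ((1, 1), (0, false)) else ((1, 3), (1, true))
  else
    if c₁ = 1 then
      if c₂ = 0 then ((2, -1), (3, true)) else ((0, 1), (5, false))
    else if c₂ = 0 then ((2, 3), (3, true)) else ((1, -1), (1, true))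

set_option synthInstance.maxHeartbeats 200000 in
set_option synthInstance.maxSize 1000 in
-- A search among the 256 tiles of the fourth patch. Axis and edge sign, both dictated by the
-- centre, fix the classes of the two side tiles, so the class `c` is the only parameter.
lemma centralPlacement_comp : ∀ (c : Fin 6) (d : Sym),
    (d.cls = c → (centralPlacement c).comp (0, d) ∈ patchList 4) ∧
    (axis d.1 = axis 0 → d.edgeSign 0 = Sym.edgeSign (c, false) 0 →
      (centralPlacement c).comp (unit 0, d) ∈ patchList 4) ∧
    (axis d.1 = axis 1 → d.edgeSign 1 = Sym.edgeSign (c, false) 1 →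
      (centralPlacement c).comp (unit 1, d) ∈ patchList 4) := by
  decide +kernel

set_option synthInstance.maxHeartbeats 200000 in
set_option synthInstance.maxSize 1000 in
-- Each prescribed axis leaves two classes, whence eight stars.
lemma outerPlacement_comp : ∀ c₀ c₁ c₂ : Fin 6, axis c₀ = 2 → axis c₁ = 1 → axis c₂ = 0 →
    ∀ d : Sym,
    (d.cls = c₀ → (outerPlacement c₀ c₁ c₂).comp (0, d) ∈ patchList 4) ∧
    (d.cls = c₁ → (outerPlacement c₀ c₁ c₂).comp (unit 0, d) ∈ patchList 4) ∧
    (d.cls = c₂ → (outerPlacement c₀ c₁ c₂).comp (unit 1, d) ∈ patchList 4) := by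
  decide +kernel

lemma axis_cls : ∀ d : Sym, axis d.cls = axis d.1 := by decide

lemma edgeSign_cls : ∀ (d : Sym) (k), Sym.edgeSign (d.cls, false) k = d.edgeSign k := by decide

/-- The half tiles at three positions around a vertex lie in a placed patch. -/
def StarInPatch (δ : ℤ × ℤ → Sym) (x : ℤ × ℤ) (k : Fin 6) : Prop :=
  ∃ s : Tile, ∀ t ∈ halfTiles δ, t.1 = x ∨ t.1 = x + unit k ∨ t.1 = x + unit (k + 1) →
    t ∈ s.comp '' patch 4

lemma starInPatch_of_placement {δ : ℤ × ℤ → Sym} {x : ℤ × ℤ} {k : Fin 6} (s : Tile)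
    (h : ∀ t ∈ halfTiles δ, t.1 = x ∨ t.1 = x + unit k ∨ t.1 = x + unit (k + 1) →
      s.comp t ∈ patchList 4) : StarInPatch δ x k :=
  ⟨s.inv, fun t ht hx => ⟨_, mem_patch_of_mem_patchList (h t ht hx), Tile.inv_comp_cancel _ _⟩⟩

/-- The placement of the standard position of three hexagons around a vertex. -/
def starPlacement (x : ℤ × ℤ) (k : Fin 6) : Tile := Tile.inv (x, (k, false))

lemma starPlacement_comp (x : ℤ × ℤ) (k : Fin 6) (d : Sym) :
    (starPlacement x k).comp (x, d) = (0, Sym.comp (-k, false) d) ∧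
    (starPlacement x k).comp (x + unit k, d) = (unit 0, Sym.comp (-k, false) d) ∧
    (starPlacement x k).comp (x + unit (k + 1), d) = (unit 1, Sym.comp (-k, false) d) := by
  have h : ∀ k l, Sym.act (-k, false) (unit (k + l)) = unit l := by
    intro k l
    rw [Sym.act_unit]
    congr 1
    simp [Sym.dir]
  have h0 := h k 0
  rw [add_zero] at h0
  refine ⟨?_, ?_, ?_⟩ <;> simp [starPlacement, Tile.comp, Tile.inv, Sym.inv, Sym.act_add, h, h0]

lemma edgeSign_comp_neg : ∀ (d : Sym) (k l),
    (Sym.comp (-k, false) d).edgeSign l = d.edgeSign (k + l) := by decide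

lemma axis_comp_neg : ∀ (d : Sym) (k l), axis d.1 = axis (k + l) →
    axis (Sym.comp (-k, false) d).1 = axis l := by decide

lemma starInPatch_of_central {δ : ℤ × ℤ → Sym} {x : ℤ × ℤ} {k : Fin 6}
    (h₀ : axis (δ (x + unit k)).1 = axis k) (h₁ : axis (δ (x + unit (k + 1))).1 = axis (k + 1))
    (h₂ : (δ (x + unit k)).edgeSign k = (δ x).edgeSign k)
    (h₃ : (δ (x + unit (k + 1))).edgeSign (k + 1) = (δ x).edgeSign (k + 1)) :
    StarInPatch δ x k := by
  set c := (Sym.comp (-k, false) (δ x)).cls with hc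
  have e : ∀ l, Sym.edgeSign (c, false) l = (δ x).edgeSign (k + l) := by
    intro l
    rw [hc, edgeSign_cls]
    exact edgeSign_comp_neg _ _ _
  refine starInPatch_of_placement ((centralPlacement c).comp (starPlacement x k)) ?_
  rintro ⟨_, d⟩ hd (rfl | rfl | rfl)
  · rw [Tile.comp_assoc, (starPlacement_comp _ k d).1]
    exact (centralPlacement_comp c _).1 (Sym.comp_cls _ _ _ hd)
  · rw [Tile.comp_assoc, (starPlacement_comp x k d).2.1]
    refine (centralPlacement_comp c _).2.1 (axis_comp_neg _ _ _ ?_) ?_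
    · rw [axis_of_cls_eq _ _ hd, add_zero, h₀]
    · rw [edgeSign_comp_neg, e, add_zero, ← h₂, Sym.edgeSign_of_cls_eq _ _ _ hd]
  · rw [Tile.comp_assoc, (starPlacement_comp x k d).2.2]
    refine (centralPlacement_comp c _).2.2 (axis_comp_neg _ _ _ ?_) ?_
    · rw [axis_of_cls_eq _ _ hd, h₁]
    · rw [edgeSign_comp_neg, e, ← h₃, Sym.edgeSign_of_cls_eq _ _ _ hd]

lemma starInPatch_of_outer {δ : ℤ × ℤ → Sym} {x : ℤ × ℤ} {k : Fin 6}
    (h₀ : axis (δ x).1 = axis (k + 2)) (h₁ : axis (δ (x + unit k)).1 = axis (k + 1))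
    (h₂ : axis (δ (x + unit (k + 1))).1 = axis k) : StarInPatch δ x k := by
  have key := outerPlacement_comp (Sym.comp (-k, false) (δ x)).cls
    (Sym.comp (-k, false) (δ (x + unit k))).cls (Sym.comp (-k, false) (δ (x + unit (k + 1)))).cls
    (by rw [axis_cls, axis_comp_neg _ _ _ h₀]; rfl) (by rw [axis_cls, axis_comp_neg _ _ _ h₁]; rfl)
    (by rw [axis_cls, axis_comp_neg _ k 0 (by rw [h₂, add_zero])]; rfl)
  generalize outerPlacement _ _ _ = s at key
  refine starInPatch_of_placement (s.comp (starPlacement x k)) ?_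
  rintro ⟨_, d⟩ hd (rfl | rfl | rfl)
  · rw [Tile.comp_assoc, (starPlacement_comp _ k d).1]
    exact (key _).1 (Sym.comp_cls _ _ _ hd)
  · rw [Tile.comp_assoc, (starPlacement_comp x k d).2.1]
    exact (key _).2.1 (Sym.comp_cls _ _ _ hd)
  · rw [Tile.comp_assoc, (starPlacement_comp x k d).2.2]
    exact (key _).2.2 (Sym.comp_cls _ _ _ hd)

/-- The same three hexagons, listed from the next one around the vertex. -/
lemma StarInPatch.rotate {δ : ℤ × ℤ → Sym} {x : ℤ × ℤ} {k : Fin 6}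
    (h : StarInPatch δ (x + unit k) (k + 2)) : StarInPatch δ x k := by
  obtain ⟨s, hs⟩ := h
  have h₁ : ∀ k, unit k + unit (k + 2) = unit (k + 1) := by decide
  have h₂ : ∀ k, unit k + unit (k + 2 + 1) = 0 := by decide
  refine ⟨s, fun t ht hx => hs t ht ?_⟩
  rw [add_assoc, add_assoc, h₁, h₂, add_zero]
  tauto

lemma unit_sum_third : ∀ j k : Fin 6, axis j ≠ axis k → axis j ≠ axis (k + 1) →
    axis j = axis (k + 2) ∧
    (∃ l, axis l = axis (k + 1) ∧
      (unit j + unit k = unit l ∨ unit j + unit k = (2 : ℤ) • unit j + unit l)) ∧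
    ∃ l, axis l = axis k ∧ (unit j + unit (k + 1) = unit l ∨
      unit j + unit (k + 1) = (2 : ℤ) • unit j + unit l) := by decide

/-- Either one of the three hexagons is a centre of the next level, and rotation makes it the first,
or all three are side tiles, with axes determined by their positions. -/
lemma LegalOn.starInPatch {δ : ℤ × ℤ → Sym} (h : LegalOn Set.univ δ) (x : ℤ × ℤ) (k : Fin 6) :
    StarInPatch δ x k := by
  obtain ⟨a, ha⟩ := h.exists_proper
  have hc : ∀ y k, StarInPatch δ (a + (2 : ℤ) • y) k := fun y k =>
    starInPatch_of_central (ha y k) (ha y (k + 1)) (ha.edgeSign h y k) (ha.edgeSign h y (k + 1))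
  have hsum : ∀ j k : Fin 6, axis j = axis k →
      unit j + unit k = 0 ∨ unit j + unit k = (2 : ℤ) • unit j := by decide
  have key : ∀ y j, x = a + (2 : ℤ) • y + unit j → StarInPatch δ x k := by
    rintro y j rfl
    by_cases h₁ : axis j = axis k
    · refine StarInPatch.rotate ?_
      rcases hsum _ _ h₁ with e | e
      · rw [add_assoc, e, add_zero]; exact hc _ _
      · rw [add_assoc, e, add_assoc, ← smul_add]; exact hc _ _
    by_cases h₂ : axis j = axis (k + 1)
    · refine StarInPatch.rotate (StarInPatch.rotate ?_)
      have h₃ := unit_add_unit k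
      rcases hsum _ _ h₂ with e | e
      · rw [add_assoc _ (unit k), h₃, add_assoc, e, add_zero]; exact hc _ _
      · rw [add_assoc _ (unit k), h₃, add_assoc, e, add_assoc, ← smul_add]; exact hc _ _
    obtain ⟨h₃, ⟨l, hl, e⟩, m, hm, e'⟩ := unit_sum_third _ _ h₁ h₂
    refine starInPatch_of_outer (by rw [ha, h₃]) ?_ ?_
    · rw [← hl]
      rcases e with e | e
      · rw [add_assoc, e, ha]
      · rw [add_assoc, e, add_assoc, ← add_assoc (_ • _), ← smul_add, ← add_assoc, ha]
    · rw [← hm]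
      rcases e' with e | e
      · rw [add_assoc, e, ha]
      · rw [add_assoc, e, add_assoc, ← add_assoc (_ • _), ← smul_add, ← add_assoc, ha]
  obtain ⟨y, hy⟩ := parity_cases (x - a)
  have hx : x = a + (x - a) := by abel
  rcases hy with hy | hy | hy | hy
  · rw [hx, hy]; exact hc _ _
  all_goals exact key y _ (by rw [add_assoc, ← hy, add_sub_cancel])

lemma eq_of_unit_add_unit : ∀ k l m : Fin 6, unit l = unit k + unit m → l = k + 1 ∨ l = k + 5 := by
  decide

/-- Points of the triangular lattice any two of which are neighbours belong to a triangle. -/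
lemma exists_triangle {G : Set (ℤ × ℤ)} (h : ∀ x ∈ G, ∀ y ∈ G, x = y ∨ ∃ k, y = x + unit k) :
    ∃ x k, ∀ y ∈ G, y = x ∨ y = x + unit k ∨ y = x + unit (k + 1) := by
  rcases G.eq_empty_or_nonempty with rfl | ⟨x, hx⟩
  · exact ⟨0, 0, by simp⟩
  by_cases h₁ : ∀ y ∈ G, y = x
  · exact ⟨x, 0, fun y hy => .inl (h₁ y hy)⟩
  push Not at h₁
  obtain ⟨y, hy, hyx⟩ := h₁
  obtain ⟨k, rfl⟩ := (h x hx y hy).resolve_left hyx.symm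
  have key : ∀ w ∈ G, ∀ l, x + unit l ∈ G → w = x ∨ w = x + unit l ∨ w = x + unit (l + 1) ∨
      w = x + unit (l + 5) := by
    intro w hw l hl
    rcases h x hx w hw with rfl | ⟨m, rfl⟩
    · exact .inl rfl
    rcases h _ hl _ hw with e | ⟨p, e⟩
    · exact .inr (.inl e.symm)
    · rw [add_assoc, add_right_inj] at e
      rcases eq_of_unit_add_unit _ _ _ e with rfl | rfl <;> simp
  have inj : Function.Injective unit := by decide
  by_cases h₂ : x + unit (k + 1) ∈ G
  · refine ⟨x, k, fun w hw => ?_⟩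
    have h₃ := key w hw k hy
    have h₄ := key w hw _ h₂
    rcases h₃ with e | e | e | e
    · exact .inl e
    · exact .inr (.inl e)
    · exact .inr (.inr e)
    -- The two common neighbours `x + unit (k + 1)` and `x + unit (k + 5)` of `x` and `x + unit k`
    -- are not neighbours of each other.
    · exfalso
      have hne : ∀ x k, x + unit (k + 5) = x → False := by
        intro x k e
        rw [add_eq_left] at e
        revert e; revert k; decide
      rcases h₄ with f | f | f | f <;> rw [e] at f
      · exact hne _ _ f
      all_goals
        have := inj (add_left_cancel f)
        revert this
        clear * -
        revert k
        decide
  · refine ⟨x, k + 5, fun w hw => ?_⟩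
    rw [show k + 5 + 1 = k by rw [add_assoc]; exact add_zero k]
    rcases key w hw k hy with e | e | e | e
    · exact .inl e
    · exact .inr (.inr e)
    · exact absurd (e ▸ hw) h₂
    · exact .inr (.inl e)

/-- The half tiles at positions any two of which are neighbours lie in a placed patch. -/
lemma LegalOn.subset_patch {δ : ℤ × ℤ → Sym} (h : LegalOn Set.univ δ) {G : Set Tile}
    (hG : G ⊆ halfTiles δ)
    (hd : ∀ s ∈ G, ∀ t ∈ G, s.1 = t.1 ∨ ∃ k, t.1 = s.1 + unit k) :
    ∃ s : Tile, G ⊆ s.comp '' patch 4 := by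
  obtain ⟨x, k, hx⟩ := exists_triangle (G := Prod.fst '' G) (by
    rintro _ ⟨s, hs, rfl⟩ _ ⟨t, ht, rfl⟩
    exact hd s hs t ht)
  obtain ⟨s, hs⟩ := h.starInPatch x k
  exact ⟨s, fun t ht => hs t (hG ht) (hx _ ⟨t, ht, rfl⟩)⟩

/-! ### Coordinates -/

/-- The imaginary part in units of `1 / √3`. -/
noncomputable def height (z : ℂ) : ℝ := Real.sqrt 3 * z.im

lemma sqrt_three_mul_self : Real.sqrt 3 * Real.sqrt 3 = 3 :=
  Real.mul_self_sqrt (by norm_num)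

lemma ext_re_height {z w : ℂ} (h₁ : z.re = w.re) (h₂ : height z = height w) : z = w :=
  Complex.ext h₁ (mul_left_cancel₀ (by positivity) h₂)

lemma ω_re : ω.re = 1 / 2 := by
  have : (Real.pi * Complex.I / 3 : ℂ) = ((Real.pi / 3 : ℝ) : ℂ) * Complex.I := by
    push_cast; ring
  rw [ω, this, Complex.exp_ofReal_mul_I_re, Real.cos_pi_div_three]

lemma ω_im : ω.im = Real.sqrt 3 / 2 := by
  have : (Real.pi * Complex.I / 3 : ℂ) = ((Real.pi / 3 : ℝ) : ℂ) * Complex.I := by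
    push_cast; ring
  rw [ω, this, Complex.exp_ofReal_mul_I_im, Real.sin_pi_div_three]

lemma height_ω : height ω = 3 / 2 := by
  rw [height, ω_im]; linarith [sqrt_three_mul_self]

lemma height_add (z w : ℂ) : height (z + w) = height z + height w := by
  simp [height, mul_add]

lemma height_sub (z w : ℂ) : height (z - w) = height z - height w := by
  simp [height, mul_sub]

lemma height_neg (z : ℂ) : height (-z) = -height z := by simp [height]

lemma height_conj (z : ℂ) : height (conj z) = -height z := by simp [height]

lemma height_ofReal_mul (r : ℝ) (z : ℂ) : height (r * z) = r * height z := by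
  simp [height]; ring

lemma height_zero : height 0 = 0 := by simp [height]

lemma height_one : height 1 = 0 := by simp [height]

lemma height_smul (r : ℝ) (z : ℂ) : height (r • z) = r * height z := by
  simp [height]; ring

/-- In the coordinates `re` and `height`, multiplication by `ω` has rational coefficients, which
makes the geometric checks linear arithmetic without square roots. -/
lemma re_ω_mul (z : ℂ) : (ω * z).re = (z.re - height z) / 2 := by
  rw [Complex.mul_re, ω_re, ω_im, height]; ring

lemma height_ω_mul (z : ℂ) : height (ω * z) = (3 * z.re + height z) / 2 := by
  rw [height, Complex.mul_im, ω_re, ω_im, height]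
  linear_combination (z.re / 2) * sqrt_three_mul_self

lemma norm_sq_eq (z : ℂ) : 3 * ‖z‖ ^ 2 = 3 * z.re ^ 2 + height z ^ 2 := by
  rw [Complex.sq_norm, Complex.normSq_apply, height]
  linear_combination -(z.im ^ 2) * sqrt_three_mul_self

lemma ω_sq : ω ^ 2 = ω - 1 := by
  rw [pow_two]
  apply ext_re_height
  · rw [re_ω_mul, ω_re, height_ω, Complex.sub_re, ω_re, Complex.one_re]; norm_num
  · rw [height_ω_mul, ω_re, height_ω, height_sub, height_ω, height_one]; norm_num

lemma conj_ω : conj ω = 1 - ω := by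
  apply ext_re_height
  · rw [Complex.conj_re, Complex.sub_re, ω_re, Complex.one_re]; norm_num
  · rw [height_conj, height_sub, height_one, height_ω]; norm_num

lemma ω_pow_three : ω ^ 3 = -1 := by
  linear_combination (ω + 1) * ω_sq

lemma ω_pow_six : ω ^ 6 = 1 := by
  linear_combination (ω ^ 3 - 1) * ω_pow_three

lemma norm_ω : ‖ω‖ = 1 := by
  have : (Real.pi * Complex.I / 3 : ℂ) = ((Real.pi / 3 : ℝ) : ℂ) * Complex.I := by
    push_cast; ring
  rw [ω, this, Complex.norm_exp_ofReal_mul_I]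

lemma ω_ne_zero : ω ≠ 0 := by
  rw [← norm_ne_zero_iff, norm_ω]; exact one_ne_zero

lemma ω_pow_add (a b : Fin 6) : ω ^ ((a + b : Fin 6) : ℕ) = ω ^ (a : ℕ) * ω ^ (b : ℕ) := by
  rw [← pow_add, Fin.val_add, ← Nat.mod_add_div ((a : ℕ) + b) 6, pow_add, pow_mul ω 6, ω_pow_six]
  simp

lemma conj_ω_pow (a : Fin 6) : conj (ω ^ (a : ℕ)) = ω ^ ((-a : Fin 6) : ℕ) := by
  have h₁ : ω ^ (a : ℕ) * ω ^ ((-a : Fin 6) : ℕ) = 1 := by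
    rw [← ω_pow_add, add_neg_cancel]; simp
  have h₂ : ω ^ (a : ℕ) * conj (ω ^ (a : ℕ)) = 1 := by
    rw [Complex.mul_conj, Complex.normSq_eq_norm_sq, norm_pow, norm_ω]; simp
  exact mul_left_cancel₀ (pow_ne_zero _ ω_ne_zero) (h₂.trans h₁.symm)

lemma vertex_zero_re : (vertex 0).re = 0 := by
  simp [vertex]

lemma height_vertex_zero : height (vertex 0) = 1 := by
  have : (Complex.I / (Real.sqrt 3 : ℂ)).im = 1 / Real.sqrt 3 := by
    simp
  simp only [vertex, height, Fin.val_zero, pow_zero, mul_one, this]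
  field_simp

lemma vertex_add (a k : Fin 6) : vertex (a + k) = ω ^ (a : ℕ) * vertex k := by
  rw [vertex, ω_pow_add, vertex]; ring

lemma vertex_coords : ((vertex 0).re = 0 ∧ height (vertex 0) = 1) ∧
    ((vertex 1).re = -1 / 2 ∧ height (vertex 1) = 1 / 2) ∧
    ((vertex 2).re = -1 / 2 ∧ height (vertex 2) = -1 / 2) ∧
    ((vertex 3).re = 0 ∧ height (vertex 3) = -1) ∧
    ((vertex 4).re = 1 / 2 ∧ height (vertex 4) = -1 / 2) ∧
    ((vertex 5).re = 1 / 2 ∧ height (vertex 5) = 1 / 2) := by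
  have step : ∀ k, (vertex (1 + k)).re = ((vertex k).re - height (vertex k)) / 2 ∧
      height (vertex (1 + k)) = (3 * (vertex k).re + height (vertex k)) / 2 := by
    intro k
    rw [vertex_add, Fin.val_one, pow_one, re_ω_mul, height_ω_mul]
    exact ⟨rfl, rfl⟩
  have h0 := vertex_zero_re
  have h0' := height_vertex_zero
  obtain ⟨h1, h1'⟩ := step 0
  obtain ⟨h2, h2'⟩ := step 1
  obtain ⟨h3, h3'⟩ := step 2
  obtain ⟨h4, h4'⟩ := step 3
  obtain ⟨h5, h5'⟩ := step 4
  simp only [show (1 + 0 : Fin 6) = 1 from rfl, show (1 + 1 : Fin 6) = 2 from rfl,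
    show (1 + 2 : Fin 6) = 3 from rfl, show (1 + 3 : Fin 6) = 4 from rfl,
    show (1 + 4 : Fin 6) = 5 from rfl] at *
  refine ⟨⟨?_, ?_⟩, ⟨?_, ?_⟩, ⟨?_, ?_⟩, ⟨?_, ?_⟩, ⟨?_, ?_⟩, ⟨?_, ?_⟩⟩ <;> linarith

/-! ### The trapezoid and the hexagon as intersections of half-planes -/

lemma Convex.three_mem {s : Set ℂ} (hs : Convex ℝ s) {x y z w : ℂ} (hx : x ∈ s) (hy : y ∈ s)
    (hz : z ∈ s) {a b c : ℝ} (ha : 0 ≤ a) (hb : 0 ≤ b) (hc : 0 ≤ c) (h : a + b + c = 1)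
    (h₁ : w.re = a * x.re + b * y.re + c * z.re)
    (h₂ : height w = a * height x + b * height y + c * height z) : w ∈ s := by
  have : w = ∑ i, (![a, b, c] : Fin 3 → ℝ) i • (![x, y, z] : Fin 3 → ℂ) i := by
    apply ext_re_height
    · simp [Fin.sum_univ_three, h₁]
    · simp [Fin.sum_univ_three, height_add, h₂]
      simp [height]; ring
  rw [this]
  refine hs.sum_mem ?_ ?_ ?_
  · intro i _
    fin_cases i <;> assumption
  · simpa [Fin.sum_univ_three] using h
  · intro i _
    fin_cases i <;> assumption

lemma convex_le (a b c : ℝ) : Convex ℝ {z : ℂ | a * z.re + b * height z ≤ c} := by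
  intro x hx y hy s t hs ht hst
  simp only [Set.mem_ofPred_eq, Complex.add_re, height_add, height_smul, Complex.smul_re,
    smul_eq_mul] at *
  calc _ = s * (a * x.re + b * height x) + t * (a * y.re + b * height y) := by ring
    _ ≤ s * c + t * c := by gcongr
    _ = c := by rw [← add_mul, hst, one_mul]

lemma mem_trapezoid {z : ℂ} :
    z ∈ trapezoid ↔ 0 ≤ z.re ∧ z.re ≤ 1 / 2 ∧ z.re + height z ≤ 1 ∧ z.re - height z ≤ 1 := by
  obtain ⟨⟨h0, h0'⟩, ⟨h1, h1'⟩, ⟨h2, h2'⟩, ⟨h3, h3'⟩, ⟨h4, h4'⟩, h5, h5'⟩ := vertex_coords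
  constructor
  · intro hz
    have key : ∀ a b c : ℝ, a * 0 + b * 1 ≤ c → a * 0 + b * -1 ≤ c →
        a * (1 / 2) + b * (-1 / 2) ≤ c → a * (1 / 2) + b * (1 / 2) ≤ c →
        a * z.re + b * height z ≤ c := by
      intro a b c k0 k3 k4 k5
      refine convexHull_min ?_ (convex_le a b c) hz
      rintro _ (rfl | rfl | rfl | rfl) <;> simp only [Set.mem_ofPred_eq, *]
    have k1 := key (-1) 0 0 (by norm_num) (by norm_num) (by norm_num) (by norm_num)
    have k2 := key 1 0 (1 / 2) (by norm_num) (by norm_num) (by norm_num) (by norm_num)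
    have k3 := key 1 1 1 (by norm_num) (by norm_num) (by norm_num) (by norm_num)
    have k4 := key 1 (-1) 1 (by norm_num) (by norm_num) (by norm_num) (by norm_num)
    refine ⟨?_, ?_, ?_, ?_⟩ <;> linarith
  · rintro ⟨k1, k2, k3, k4⟩
    have hc : Convex ℝ trapezoid := convex_convexHull ℝ _
    have m0 : vertex 0 ∈ trapezoid := subset_convexHull _ _ (by simp)
    have m3 : vertex 3 ∈ trapezoid := subset_convexHull _ _ (by simp)
    have m4 : vertex 4 ∈ trapezoid := subset_convexHull _ _ (by simp)
    have m5 : vertex 5 ∈ trapezoid := subset_convexHull _ _ (by simp)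
    -- The line through vertices 0 and 4 splits the trapezoid into two triangles; the coefficients
    -- are barycentric coordinates.
    rcases le_total (3 * z.re + height z) 1 with h | h
    · refine Convex.three_mem hc m0 m3 m4 (a := (1 - z.re + height z) / 2)
        (b := (1 - 3 * z.re - height z) / 2) (c := 2 * z.re) ?_ ?_ ?_ ?_ ?_ ?_ <;>
      (try simp only [h0, h0', h3, h3', h4, h4']) <;> linarith
    · refine Convex.three_mem hc m0 m4 m5 (a := 1 - 2 * z.re)
        (b := 1 - z.re - height z) (c := 3 * z.re + height z - 1) ?_ ?_ ?_ ?_ ?_ ?_ <;>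
      (try simp only [h0, h0', h5, h5', h4, h4']) <;> linarith

lemma mem_hexagon {z : ℂ} :
    z ∈ hexagon ↔ -1 / 2 ≤ z.re ∧ z.re ≤ 1 / 2 ∧ z.re + height z ≤ 1 ∧ -1 ≤ z.re + height z ∧
      z.re - height z ≤ 1 ∧ -1 ≤ z.re - height z := by
  obtain ⟨⟨h0, h0'⟩, ⟨h1, h1'⟩, ⟨h2, h2'⟩, ⟨h3, h3'⟩, ⟨h4, h4'⟩, h5, h5'⟩ := vertex_coords
  constructor
  · intro hz
    have key : ∀ a b c : ℝ, a * 0 + b * 1 ≤ c → a * (-1 / 2) + b * (1 / 2) ≤ c →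
        a * (-1 / 2) + b * (-1 / 2) ≤ c → a * 0 + b * -1 ≤ c →
        a * (1 / 2) + b * (-1 / 2) ≤ c → a * (1 / 2) + b * (1 / 2) ≤ c →
        a * z.re + b * height z ≤ c := by
      intro a b c k0 k1 k2 k3 k4 k5
      refine convexHull_min ?_ (convex_le a b c) hz
      rintro _ ⟨k, rfl⟩
      fin_cases k <;> simp only [Set.mem_ofPred_eq] <;> simp [*] <;> linarith
    have k1 := key (-1) 0 (1 / 2) (by norm_num) (by norm_num) (by norm_num) (by norm_num)
      (by norm_num) (by norm_num)
    have k2 := key 1 0 (1 / 2) (by norm_num) (by norm_num) (by norm_num) (by norm_num)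
      (by norm_num) (by norm_num)
    have k3 := key 1 1 1 (by norm_num) (by norm_num) (by norm_num) (by norm_num)
      (by norm_num) (by norm_num)
    have k4 := key 1 (-1) 1 (by norm_num) (by norm_num) (by norm_num) (by norm_num)
      (by norm_num) (by norm_num)
    have k5 := key (-1) (-1) 1 (by norm_num) (by norm_num) (by norm_num) (by norm_num)
      (by norm_num) (by norm_num)
    have k6 := key (-1) 1 1 (by norm_num) (by norm_num) (by norm_num) (by norm_num)
      (by norm_num) (by norm_num)
    refine ⟨?_, ?_, ?_, ?_, ?_, ?_⟩ <;> linarith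
  · rintro ⟨k1, k2, k3, k4, k5, k6⟩
    have hc : Convex ℝ hexagon := convex_convexHull ℝ _
    have m : ∀ k, vertex k ∈ hexagon := fun k => subset_convexHull _ _ (Set.mem_range_self k)
    rcases le_total 0 z.re with h | h
    · refine convexHull_mono ?_ (mem_trapezoid.2 ⟨h, k2, k3, k5⟩)
      rintro _ (rfl | rfl | rfl | rfl) <;> exact Set.mem_range_self _
    -- The left half is split by the line through vertices 1 and 3.
    rcases le_total (3 * z.re + height z) (-1) with h | h
    · refine Convex.three_mem hc (m 3) (m 1) (m 2) (a := 1 + 2 * z.re)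
        (b := 1 + z.re + height z) (c := -3 * z.re - height z - 1) ?_ ?_ ?_ ?_ ?_ ?_ <;>
      (try simp only [h1, h1', h3, h3', h2, h2']) <;> linarith
    · refine Convex.three_mem hc (m 3) (m 0) (m 1) (a := (1 + z.re - height z) / 2)
        (b := (1 + 3 * z.re + height z) / 2) (c := -2 * z.re) ?_ ?_ ?_ ?_ ?_ ?_ <;>
      (try simp only [h0, h0', h3, h3', h1, h1']) <;> linarith

lemma trapezoid_subset_hexagon : trapezoid ⊆ hexagon := by
  intro z hz
  rw [mem_trapezoid] at hz
  rw [mem_hexagon]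
  refine ⟨?_, ?_, ?_, ?_, ?_, ?_⟩ <;> linarith [hz.1, hz.2.1, hz.2.2.1, hz.2.2.2]

lemma three_mul_norm_sq_le {z : ℂ} (hz : z ∈ hexagon) : 3 * ‖z‖ ^ 2 ≤ 1 := by
  obtain ⟨k1, k2, k3, k4, k5, k6⟩ := mem_hexagon.1 hz
  rw [norm_sq_eq]
  rcases le_total 0 z.re with h | h <;> rcases le_total 0 (height z) with h' | h' <;> nlinarith

lemma norm_le_of_mem_hexagon {z : ℂ} (hz : z ∈ hexagon) : ‖z‖ ≤ 1 := by
  nlinarith [three_mul_norm_sq_le hz, norm_nonneg z]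

lemma isCompact_trapezoid : IsCompact trapezoid :=
  Set.Finite.isCompact_convexHull ℝ (Set.toFinite _)

lemma zero_mem_trapezoid : (0 : ℂ) ∈ trapezoid := by
  rw [mem_trapezoid]; simp [height_zero]

/-! ### The placement of tiles in the plane -/

/-- The complex number that belongs to a point of the lattice. -/
noncomputable def point (x : ℤ × ℤ) : ℂ := x.1 + x.2 * ω

/-- A symmetry as a linear isometry of the plane. -/
noncomputable def Sym.map (d : Sym) : ℂ ≃ₗᵢ[ℝ] ℂ :=
  (if d.2 then Complex.conjLIE else LinearIsometryEquiv.refl ℝ ℂ).trans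
    (rotation ⟨ω ^ (d.1 : ℕ), by simp [Submonoid.unitSphere, norm_ω]⟩)

/-- The isometry that places a tile. -/
noncomputable def Tile.map (t : Tile) (z : ℂ) : ℂ := point t.1 + t.2.map z

lemma Sym.map_apply (d : Sym) (z : ℂ) :
    d.map z = ω ^ (d.1 : ℕ) * (if d.2 then conj z else z) := by
  rcases d with ⟨k, _ | _⟩ <;> simp only [Sym.map] <;> rfl

lemma point_add (x y : ℤ × ℤ) : point (x + y) = point x + point y := by
  simp [point]; ring

lemma point_neg (x : ℤ × ℤ) : point (-x) = -point x := by
  simp [point]; ring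

lemma point_sub (x y : ℤ × ℤ) : point (x - y) = point x - point y := by
  rw [sub_eq_add_neg, point_add, point_neg, sub_eq_add_neg]

lemma point_smul (n : ℤ) (x : ℤ × ℤ) : point (n • x) = n * point x := by
  simp [point]; ring

lemma point_zero : point 0 = 0 := by simp [point]

lemma point_unit (k : Fin 6) : point (unit k) = ω ^ (k : ℕ) := by
  fin_cases k <;> simp [point, unit]
  · linear_combination -ω_sq
  · linear_combination -ω_pow_three
  · linear_combination -ω * ω_pow_three
  · linear_combination -ω ^ 2 * ω_pow_three + ω_sq

lemma re_point (x : ℤ × ℤ) : (point x).re = x.1 + x.2 / 2 := by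
  simp [point, ω_re]; ring

lemma height_point (x : ℤ × ℤ) : height (point x) = 3 * x.2 / 2 := by
  have h : height (x.1 : ℂ) = 0 := by simp [height]
  have := height_ofReal_mul x.2 ω
  push_cast at this
  rw [point, height_add, h, this, height_ω]; ring

lemma norm_sq_point (x : ℤ × ℤ) : ‖point x‖ ^ 2 = x.1 ^ 2 + x.1 * x.2 + x.2 ^ 2 := by
  have := norm_sq_eq (point x)
  rw [re_point, height_point] at this
  linarith

lemma point_injective : Function.Injective point := by
  intro x y h
  have h₁ := congrArg height h
  have h₂ := congrArg Complex.re h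
  rw [height_point, height_point] at h₁
  rw [re_point, re_point] at h₂
  have h₃ : (x.2 : ℝ) = y.2 := by linarith
  have h₄ : (x.1 : ℝ) = y.1 := by linarith
  exact Prod.ext (by exact_mod_cast h₄) (by exact_mod_cast h₃)

lemma mem_lattice_iff {z : ℂ} : z ∈ lattice ↔ ∃ x, z = point x :=
  ⟨fun ⟨m, n, h⟩ => ⟨(m, n), h⟩, fun ⟨x, h⟩ => ⟨x.1, x.2, h⟩⟩

lemma Sym.map_pow (d : Sym) (k : Fin 6) : d.map (ω ^ (k : ℕ)) = ω ^ (d.dir k : ℕ) := by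
  rcases d with ⟨l, _ | _⟩
  · simp [Sym.map_apply, Sym.dir, ω_pow_add]
  · simp [Sym.map_apply, Sym.dir, sub_eq_add_neg, ω_pow_add, ← conj_ω_pow]

lemma Sym.map_one_eq (d : Sym) : d.map 1 = point (unit d.1) := by
  rw [point_unit, Sym.map_apply]; simp

lemma Sym.map_point (d : Sym) (x : ℤ × ℤ) : d.map (point x) = point (d.act x) := by
  have h₁ : d.map (1 : ℂ) = point (unit d.1) := d.map_one_eq
  have h₂ : d.map ω = point (unit (d.dir 1)) := by
    have := d.map_pow 1
    rw [point_unit, ← this]; simp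
  have h₃ : point x = (x.1 : ℝ) • (1 : ℂ) + (x.2 : ℝ) • ω := by simp [point]
  rw [h₃, map_add, map_smul, map_smul, h₁, h₂, Sym.act, point_add, point_smul, point_smul]
  simp

lemma Sym.map_comp (a b : Sym) (z : ℂ) : (a.comp b).map z = a.map (b.map z) := by
  rcases a with ⟨k, _ | _⟩ <;> rcases b with ⟨l, _ | _⟩ <;>
    simp [Sym.map_apply, Sym.comp, Sym.dir, ω_pow_add, sub_eq_add_neg, ← conj_ω_pow, mul_assoc]

lemma Sym.map_neutral (z : ℂ) : Sym.map (0, false) z = z := by simp [Sym.map_apply]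

lemma Sym.map_flip (d : Sym) (z : ℂ) : d.flip.map z = d.map (-conj z) := by
  have h : ω ^ ((d.1 + 3 : Fin 6) : ℕ) = -ω ^ (d.1 : ℕ) := by
    have h3 : ((3 : Fin 6) : ℕ) = 3 := rfl
    rw [ω_pow_add, h3, ω_pow_three]; ring
  rcases d with ⟨k, _ | _⟩ <;> simp_all [Sym.map_apply, Sym.flip]

lemma Sym.map_injective : Function.Injective Sym.map := by
  intro a b h
  have h₁ : unit a.1 = unit b.1 := by
    apply point_injective; rw [← Sym.map_one_eq, ← Sym.map_one_eq, h]
  have h₂ : unit (a.dir 1) = unit (b.dir 1) := by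
    apply point_injective
    rw [point_unit, point_unit, ← Sym.map_pow, ← Sym.map_pow, h]
  have inj : Function.Injective unit := by decide
  have : ∀ a b : Sym, a.1 = b.1 → a.dir 1 = b.dir 1 → a = b := by decide
  exact this a b (inj h₁) (inj h₂)

lemma Sym.map_vertex (d : Sym) (k : Fin 6) : d.map (vertex k) = vertex (d.vert k) := by
  have hv : conj (vertex k) = vertex (3 - k) := by
    have h3 : (3 - k : Fin 6) = (3 + -k) := sub_eq_add_neg _ _
    have h3' : ((3 : Fin 6) : ℕ) = 3 := rfl
    rw [h3, vertex, map_mul, conj_ω_pow, vertex, ω_pow_add, h3', ω_pow_three]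
    simp [neg_div]
  rcases d with ⟨l, _ | _⟩
  · simp [Sym.map_apply, Sym.vert, vertex_add]
  · simp [Sym.map_apply, Sym.vert, hv, add_sub_assoc, vertex_add]

lemma Sym.vert_bijective : ∀ d : Sym, Function.Bijective d.vert := by decide

lemma Sym.map_image_hexagon (d : Sym) : d.map '' hexagon = hexagon := by
  have h : Set.range (fun k => d.map (vertex k)) = Set.range vertex := by
    simp_rw [Sym.map_vertex]
    exact (Sym.vert_bijective d).2.range_comp vertex
  have := (d.map.toLinearEquiv : ℂ →ₗ[ℝ] ℂ).image_convexHull (Set.range vertex)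
  rw [hexagon]
  refine (this.trans ?_)
  rw [← Set.range_comp]
  exact congrArg _ h

lemma Tile.map_comp (s t : Tile) (z : ℂ) : (s.comp t).map z = s.map (t.map z) := by
  simp [Tile.map, Tile.comp, point_add, map_add, Sym.map_point, Sym.map_comp, add_assoc]

lemma Tile.map_neutral (z : ℂ) : Tile.one.map z = z := by
  simp [Tile.map, Tile.one, point_zero, Sym.map_neutral]

lemma Tile.map_zero (t : Tile) : t.map 0 = point t.1 := by simp [Tile.map]

lemma Tile.map_injective : Function.Injective Tile.map := by
  intro s t h
  have h₁ : point s.1 = point t.1 := by rw [← Tile.map_zero, ← Tile.map_zero, h]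
  refine Prod.ext (point_injective h₁) (Sym.map_injective ?_)
  ext z : 1
  have := congrFun h z
  rwa [Tile.map, Tile.map, h₁, add_right_inj] at this

lemma Tile.isometry (t : Tile) : Isometry t.map := by
  refine Isometry.of_dist_eq fun x y => ?_
  rw [Tile.map, Tile.map, dist_add_left, t.2.map.dist_map]

lemma Tile.map_two_mul (t : Tile) (z : ℂ) : 2 * t.map z = t.double.map (2 * z) := by
  have h : (2 * z : ℂ) = (2 : ℝ) • z := by simp
  have h' : point (2 • t.1) = 2 * point t.1 := by rw [two_smul, point_add]; ring
  rw [Tile.map, Tile.map, Tile.double, h, map_smul, h']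
  simp [mul_add]

lemma child_eq (i : Fin 4) : child i = Tile.map (childPos i, childSym i) := by
  have h : conj ω ^ 2 = ω ^ 4 := by
    rw [conj_ω]; linear_combination ω_sq - ω * ω_pow_three
  have h' : conj ω = ω ^ 5 := by
    rw [conj_ω]; linear_combination -ω ^ 2 * ω_pow_three + ω_sq
  funext z
  fin_cases i
  · simp [child, Tile.map, childPos, childSym, point_zero, Sym.map_apply]
  · simp [child, Tile.map, childPos, childSym, point_unit, Sym.map_apply, h]
  · simp [child, Tile.map, childPos, childSym, point_unit, Sym.map_apply, h']
  · simp [child, Tile.map, childPos, childSym, point_unit, Sym.map_apply]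

lemma subdivide_map (t : Tile) (i : Fin 4) : subdivide t.map i = (t.sub i).map := by
  funext z
  have : t.sub i = t.double.comp (childPos i, childSym i) := rfl
  rw [subdivide, Tile.map_two_mul, this, Tile.map_comp, child_eq]
  congr 1
  ring

lemma iterates_eq (n : ℕ) : iterates n = Tile.map '' patch n := by
  induction n with
  | zero =>
    simp only [iterates, patch, Function.iterate_zero_apply, Set.image_singleton]
    congr 1
    funext z
    exact (Tile.map_neutral z).symm
  | succ n ih =>
    ext h
    rw [patch, Function.iterate_succ_apply']
    constructor
    · rintro ⟨g, hg, i, rfl⟩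
      rw [ih] at hg
      obtain ⟨t, ht, rfl⟩ := hg
      exact ⟨_, ⟨t, ht, i, rfl⟩, (subdivide_map t i).symm⟩
    · rintro ⟨_, ⟨t, ht, i, rfl⟩, rfl⟩
      exact ⟨t.map, by rw [ih]; exact ⟨t, ht, rfl⟩, i, (subdivide_map t i).symm⟩

/-! ### The recursion -/

lemma recursion_iff (R : Set ℂ) : Recursion R ↔ (fun z => 2 * z) '' R = ⋃ i, child i '' R := by
  have : (⋃ i, child i '' R) =
      R ∪ (fun z => ω + (conj ω) ^ 2 * z) '' R ∪ (fun z => conj ω + ω ^ 2 * conj z) '' R ∪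
      (fun z => 1 + ω ^ 3 * conj z) '' R := by
    ext z
    simp [child, Fin.exists_fin_succ, or_assoc]
  rw [Recursion, this]

lemma child_coords (z : ℂ) :
    ((child 0 z).re = z.re ∧ height (child 0 z) = height z) ∧
    ((child 1 z).re = 1 / 2 + (height z - z.re) / 2 ∧
      height (child 1 z) = 3 / 2 - (3 * z.re + height z) / 2) ∧
    ((child 2 z).re = 1 / 2 + (height z - z.re) / 2 ∧
      height (child 2 z) = -3 / 2 + (3 * z.re + height z) / 2) ∧
    ((child 3 z).re = 1 - z.re ∧ height (child 3 z) = height z) := by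
  have h1 : child 1 z = ω - ω * z := by
    change ω + conj ω ^ 2 * z = _
    rw [conj_ω]; linear_combination z * ω_sq
  have h2 : child 2 z = conj (ω - ω * z) := by
    change conj ω + ω ^ 2 * conj z = _
    rw [map_sub, map_mul, conj_ω]; linear_combination conj z * ω_sq
  have h3 : child 3 z = 1 - conj z := by
    change 1 + ω ^ 3 * conj z = _
    rw [ω_pow_three]; ring
  refine ⟨⟨rfl, rfl⟩, ?_, ?_, ?_⟩
  · rw [h1, Complex.sub_re, re_ω_mul, ω_re, height_sub, height_ω_mul, height_ω]
    constructor <;> ring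
  · rw [h2, Complex.conj_re, height_conj, Complex.sub_re, re_ω_mul, ω_re, height_sub,
      height_ω_mul, height_ω]
    constructor <;> ring
  · rw [h3, Complex.sub_re, Complex.conj_re, height_sub, height_conj, height_one, Complex.one_re]
    constructor <;> ring

lemma exists_re_height (x s : ℝ) : ∃ z : ℂ, z.re = x ∧ height z = s := by
  refine ⟨⟨x, s / Real.sqrt 3⟩, rfl, ?_⟩
  simp only [height]
  field_simp

lemma mem_child_image_zero {z : ℂ} : z ∈ child 0 '' trapezoid ↔
    0 ≤ z.re ∧ z.re ≤ 1 / 2 ∧ z.re + height z ≤ 1 ∧ z.re - height z ≤ 1 := by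
  have : child 0 = id := rfl
  rw [this, Set.image_id, mem_trapezoid]

lemma mem_child_image_one {z : ℂ} : z ∈ child 1 '' trapezoid ↔
    1 ≤ z.re + height z ∧ z.re + height z ≤ 2 ∧ z.re ≤ height z ∧ 0 ≤ z.re := by
  constructor
  · rintro ⟨w, hw, rfl⟩
    obtain ⟨-, ⟨h1, h2⟩, -⟩ := child_coords w
    rw [mem_trapezoid] at hw
    rw [h1, h2]
    refine ⟨?_, ?_, ?_, ?_⟩ <;> linarith [hw.1, hw.2.1, hw.2.2.1, hw.2.2.2]
  · rintro ⟨k1, k2, k3, k4⟩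
    obtain ⟨w, hw, hw'⟩ := exists_re_height ((2 - height z - z.re) / 2)
      (2 * z.re - 1 + (2 - height z - z.re) / 2)
    obtain ⟨-, ⟨h1, h2⟩, -⟩ := child_coords w
    refine ⟨w, mem_trapezoid.2 ⟨?_, ?_, ?_, ?_⟩, ext_re_height ?_ ?_⟩ <;>
      (try rw [h1]) <;> (try rw [h2]) <;> rw [hw] <;> (try rw [hw']) <;> linarith

lemma mem_child_image_two {z : ℂ} : z ∈ child 2 '' trapezoid ↔
    1 ≤ z.re - height z ∧ z.re - height z ≤ 2 ∧ z.re + height z ≤ 0 ∧ 0 ≤ z.re := by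
  constructor
  · rintro ⟨w, hw, rfl⟩
    obtain ⟨-, -, ⟨h1, h2⟩, -⟩ := child_coords w
    rw [mem_trapezoid] at hw
    rw [h1, h2]
    refine ⟨?_, ?_, ?_, ?_⟩ <;> linarith [hw.1, hw.2.1, hw.2.2.1, hw.2.2.2]
  · rintro ⟨k1, k2, k3, k4⟩
    obtain ⟨w, hw, hw'⟩ := exists_re_height ((2 + height z - z.re) / 2)
      (2 * z.re - 1 + (2 + height z - z.re) / 2)
    obtain ⟨-, -, ⟨h1, h2⟩, -⟩ := child_coords w
    refine ⟨w, mem_trapezoid.2 ⟨?_, ?_, ?_, ?_⟩, ext_re_height ?_ ?_⟩ <;>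
      (try rw [h1]) <;> (try rw [h2]) <;> rw [hw] <;> (try rw [hw']) <;> linarith

lemma mem_child_image_three {z : ℂ} : z ∈ child 3 '' trapezoid ↔
    1 / 2 ≤ z.re ∧ z.re ≤ 1 ∧ height z ≤ z.re ∧ 0 ≤ z.re + height z := by
  constructor
  · rintro ⟨w, hw, rfl⟩
    obtain ⟨-, -, -, h1, h2⟩ := child_coords w
    rw [mem_trapezoid] at hw
    rw [h1, h2]
    refine ⟨?_, ?_, ?_, ?_⟩ <;> linarith [hw.1, hw.2.1, hw.2.2.1, hw.2.2.2]
  · rintro ⟨k1, k2, k3, k4⟩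
    obtain ⟨w, hw, hw'⟩ := exists_re_height (1 - z.re) (height z)
    obtain ⟨-, -, -, h1, h2⟩ := child_coords w
    refine ⟨w, mem_trapezoid.2 ⟨?_, ?_, ?_, ?_⟩, ext_re_height ?_ ?_⟩ <;>
      (try rw [h1]) <;> (try rw [h2]) <;> (try rw [hw]) <;> (try rw [hw']) <;> linarith

lemma mem_two_mul_trapezoid {z : ℂ} : z ∈ (fun z => 2 * z) '' trapezoid ↔
    0 ≤ z.re ∧ z.re ≤ 1 ∧ z.re + height z ≤ 2 ∧ z.re - height z ≤ 2 := by
  have h : ∀ w : ℂ, height (2 * w) = 2 * height w := by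
    intro w; simpa using height_ofReal_mul 2 w
  constructor
  · rintro ⟨w, hw, rfl⟩
    rw [mem_trapezoid] at hw
    have : (2 * w).re = 2 * w.re := by simp
    simp only [this, h]
    refine ⟨?_, ?_, ?_, ?_⟩ <;> linarith [hw.1, hw.2.1, hw.2.2.1, hw.2.2.2]
  · rintro ⟨k1, k2, k3, k4⟩
    have h1 : height (z / 2) = height z / 2 := by
      have := h (z / 2)
      rw [mul_div_cancel₀ z two_ne_zero] at this
      linarith
    have h2 : (z / 2).re = z.re / 2 := by simp
    refine ⟨z / 2, mem_trapezoid.2 ?_, mul_div_cancel₀ z two_ne_zero⟩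
    rw [h1, h2]
    refine ⟨?_, ?_, ?_, ?_⟩ <;> linarith

lemma two_mul_trapezoid : (fun z => 2 * z) '' trapezoid = ⋃ i, child i '' trapezoid := by
  ext z
  rw [Set.mem_iUnion, mem_two_mul_trapezoid]
  constructor
  · rintro ⟨k1, k2, k3, k4⟩
    rcases le_total z.re (height z) with h | h
    · rcases le_total 1 (z.re + height z) with h' | h'
      · exact ⟨1, mem_child_image_one.2 ⟨h', k3, h, k1⟩⟩
      · exact ⟨0, mem_child_image_zero.2 ⟨k1, by linarith, h', by linarith⟩⟩
    · rcases le_total 0 (z.re + height z) with h' | h'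
      · rcases le_total (1 / 2) z.re with h'' | h''
        · exact ⟨3, mem_child_image_three.2 ⟨h'', k2, h, h'⟩⟩
        · exact ⟨0, mem_child_image_zero.2 ⟨k1, h'', by linarith, by linarith⟩⟩
      · rcases le_total 1 (z.re - height z) with h'' | h''
        · exact ⟨2, mem_child_image_two.2 ⟨h'', k4, h', k1⟩⟩
        · exact ⟨0, mem_child_image_zero.2 ⟨k1, by linarith, by linarith, h''⟩⟩
  · rintro ⟨i, hi⟩
    have : i = 0 ∨ i = 1 ∨ i = 2 ∨ i = 3 := by clear hi; revert i; decide
    rcases this with rfl | rfl | rfl | rfl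
    · obtain ⟨k1, k2, k3, k4⟩ := mem_child_image_zero.1 hi
      refine ⟨?_, ?_, ?_, ?_⟩ <;> linarith
    · obtain ⟨k1, k2, k3, k4⟩ := mem_child_image_one.1 hi
      refine ⟨?_, ?_, ?_, ?_⟩ <;> linarith
    · obtain ⟨k1, k2, k3, k4⟩ := mem_child_image_two.1 hi
      refine ⟨?_, ?_, ?_, ?_⟩ <;> linarith
    · obtain ⟨k1, k2, k3, k4⟩ := mem_child_image_three.1 hi
      refine ⟨?_, ?_, ?_, ?_⟩ <;> linarith

lemma recursion_trapezoid : Recursion trapezoid := (recursion_iff _).2 two_mul_trapezoid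

lemma isometry_child (i : Fin 4) : Isometry (child i) := by
  rw [child_eq]; exact Tile.isometry _

lemma exists_child_eq_of_recursion {R : Set ℂ} (hR : Recursion R) {z : ℂ} (hz : z ∈ R) :
    ∃ i, ∃ w ∈ R, child i w = 2 * z := by
  rw [recursion_iff] at hR
  have : 2 * z ∈ ⋃ i, child i '' R := hR ▸ ⟨z, hz, rfl⟩
  obtain ⟨i, w, hw, h⟩ := Set.mem_iUnion.1 this
  exact ⟨i, w, hw, h⟩

lemma exists_two_mul_eq_of_recursion {R : Set ℂ} (hR : Recursion R) {w : ℂ} (hw : w ∈ R)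
    (i : Fin 4) : ∃ z ∈ R, 2 * z = child i w := by
  rw [recursion_iff] at hR
  have : child i w ∈ (fun z => 2 * z) '' R := hR ▸ Set.mem_iUnion.2 ⟨i, w, hw, rfl⟩
  exact this

lemma tendsto_div_two_pow (C : ℝ) : Tendsto (fun n : ℕ => C / 2 ^ n) atTop (𝓝 0) := by
  simpa [div_eq_mul_inv] using
    (tendsto_pow_atTop_nhds_zero_of_lt_one (r := (2 : ℝ)⁻¹) (by norm_num) (by norm_num)).const_mul C

/-- The maps `child i z / 2` are contractions by 1/2, so every point of `R` is within C / 2ⁿ of `S`.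
-/
lemma Recursion.subset {R S : Set ℂ} (hR : Recursion R) (hS : Recursion S) (hRc : IsCompact R)
    (hSc : IsCompact S) (hSn : S.Nonempty) : R ⊆ S := by
  obtain ⟨s₀, hs₀⟩ := hSn
  obtain ⟨C, hC⟩ := hRc.isBounded.subset_closedBall s₀
  have key : ∀ n : ℕ, ∀ z ∈ R, ∃ w ∈ S, dist z w ≤ C / 2 ^ n := by
    intro n
    induction n with
    | zero => exact fun z hz => ⟨s₀, hs₀, by simpa using hC hz⟩
    | succ n ih =>
      intro z hz
      obtain ⟨i, z', hz', h⟩ := exists_child_eq_of_recursion hR hz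
      obtain ⟨w', hw', hd⟩ := ih z' hz'
      obtain ⟨w, hw, h'⟩ := exists_two_mul_eq_of_recursion hS hw' i
      refine ⟨w, hw, ?_⟩
      have e : dist (2 * z) (2 * w) = dist z' w' := by
        rw [← h, h', (isometry_child i).dist_eq]
      rw [dist_eq_norm, ← mul_sub, norm_mul, ← dist_eq_norm] at e
      simp only [Complex.norm_ofNat] at e
      rw [pow_succ, ← div_div]
      linarith
  intro z hz
  rw [← hSc.isClosed.closure_eq, Metric.mem_closure_iff]
  intro ε hε
  obtain ⟨n, hn⟩ := ((tendsto_div_two_pow C).eventually_lt_const hε).exists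
  obtain ⟨w, hw, hd⟩ := key n z hz
  exact ⟨w, hw, hd.trans_lt hn⟩

lemma recursion_iff_eq_trapezoid (R : Set ℂ) (hR : IsCompact R) (hn : R.Nonempty) :
    Recursion R ↔ R = trapezoid := by
  constructor
  · intro h
    exact (h.subset recursion_trapezoid hR isCompact_trapezoid ⟨0, zero_mem_trapezoid⟩).antisymm
      (recursion_trapezoid.subset h isCompact_trapezoid hR hn)
  · rintro rfl
    exact recursion_trapezoid

/-! ### The iterates tessellate the magnified trapezoids -/

lemma volume_line (a b c : ℝ) (h : a ≠ 0 ∨ b ≠ 0) :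
    volume {z : ℂ | a * z.re + b * height z = c} = 0 := by
  let f : ℂ →ₗ[ℝ] ℝ :=
    { toFun := fun z => a * z.re + b * height z
      map_add' := fun z w => by simp [height_add]; ring
      map_smul' := fun r z => by rw [height_smul]; simp; ring }
  have hf : f.ker ≠ ⊤ := by
    intro htop
    obtain ⟨z, hz, hz'⟩ := exists_re_height a b
    have : z ∈ f.ker := htop ▸ Submodule.mem_top
    have h0 : a * z.re + b * height z = 0 := this
    rw [hz, hz'] at h0
    rcases h with h | h
    · nlinarith [mul_self_pos.2 h, mul_self_nonneg b]
    · nlinarith [mul_self_pos.2 h, mul_self_nonneg a]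
  rcases Set.eq_empty_or_nonempty {z : ℂ | a * z.re + b * height z = c} with he | ⟨z₀, hz₀⟩
  · rw [he, measure_empty]
  · have : {z : ℂ | a * z.re + b * height z = c} = (fun z => -z₀ + z) ⁻¹' (f.ker : Set ℂ) := by
      ext z
      have h1 : f z₀ = c := hz₀
      have h2 : f z = a * z.re + b * height z := rfl
      simp [h1, ← h2]
      constructor <;> intro h <;> linarith
    rw [this, measure_preimage_add]
    exact Measure.addHaar_submodule volume _ hf

/-- Any two pieces are separated by a line, whose coefficients are passed to `key`. -/
lemma volume_child_inter {i j : Fin 4} (hij : i ≠ j) :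
    volume (child i '' trapezoid ∩ child j '' trapezoid) = 0 := by
  wlog hlt : i < j generalizing i j
  · rw [Set.inter_comm]
    exact this hij.symm (lt_of_le_of_ne (not_lt.1 hlt) hij.symm)
  have : (i = 0 ∧ j = 1) ∨ (i = 0 ∧ j = 2) ∨ (i = 0 ∧ j = 3) ∨ (i = 1 ∧ j = 2) ∨
      (i = 1 ∧ j = 3) ∨ (i = 2 ∧ j = 3) := by
    clear hij
    revert i j
    decide
  have key : ∀ a b c : ℝ, (a ≠ 0 ∨ b ≠ 0) →
      (∀ z ∈ child i '' trapezoid, z ∈ child j '' trapezoid → a * z.re + b * height z = c) →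
      volume (child i '' trapezoid ∩ child j '' trapezoid) = 0 := fun a b c h h' =>
    measure_mono_null (fun z hz => h' z hz.1 hz.2) (volume_line a b c h)
  rcases this with ⟨rfl, rfl⟩ | ⟨rfl, rfl⟩ | ⟨rfl, rfl⟩ | ⟨rfl, rfl⟩ | ⟨rfl, rfl⟩ | ⟨rfl, rfl⟩
  · refine key 1 1 1 (by norm_num) fun z h h' => ?_
    rw [mem_child_image_zero] at h
    rw [mem_child_image_one] at h'
    linarith [h.2.2.1, h'.1]
  · refine key 1 (-1) 1 (by norm_num) fun z h h' => ?_
    rw [mem_child_image_zero] at h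
    rw [mem_child_image_two] at h'
    linarith [h.2.2.2, h'.1]
  · refine key 1 0 (1 / 2) (by norm_num) fun z h h' => ?_
    rw [mem_child_image_zero] at h
    rw [mem_child_image_three] at h'
    linarith [h.2.1, h'.1]
  · refine key 1 1 0 (by norm_num) fun z h h' => ?_
    rw [mem_child_image_one] at h
    rw [mem_child_image_two] at h'
    linarith [h.1, h'.2.2.1]
  · refine key 1 (-1) 0 (by norm_num) fun z h h' => ?_
    rw [mem_child_image_one] at h
    rw [mem_child_image_three] at h'
    linarith [h.2.2.1, h'.2.2.1]
  · refine key 1 1 0 (by norm_num) fun z h h' => ?_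
    rw [mem_child_image_two] at h
    rw [mem_child_image_three] at h'
    linarith [h.2.2.1, h'.2.2.2]

lemma volume_image_two_mul {A : Set ℂ} (h : volume A = 0) :
    volume ((fun z => 2 * z) '' A) = 0 := by
  have hd : Differentiable ℝ (fun z : ℂ => 2 * z) := by fun_prop
  exact addHaar_image_eq_zero_of_differentiableOn_of_addHaar_eq_zero volume hd.differentiableOn h

lemma exists_affineIsometryEquiv {f : ℂ → ℂ} (hf : Isometry f) :
    ∃ e : ℂ ≃ᵃⁱ[ℝ] ℂ, ⇑e = f :=
  ⟨hf.affineIsometryOfStrictConvexSpace.toAffineIsometryEquiv rfl, rfl⟩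

lemma volume_image_isometry {f : ℂ → ℂ} (hf : Isometry f) {A : Set ℂ} (h : volume A = 0) :
    volume (f '' A) = 0 := by
  obtain ⟨e, rfl⟩ := exists_affineIsometryEquiv hf
  have hd : Differentiable ℝ e := e.toContinuousAffineEquiv.toContinuousAffineMap.differentiable
  exact addHaar_image_eq_zero_of_differentiableOn_of_addHaar_eq_zero volume hd.differentiableOn h

lemma volume_image_isometry_ne_zero {f : ℂ → ℂ} (hf : Isometry f) {A : Set ℂ}
    (h : volume A ≠ 0) : volume (f '' A) ≠ 0 := by
  obtain ⟨e, rfl⟩ := exists_affineIsometryEquiv hf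
  intro h0
  apply h
  have := volume_image_isometry e.symm.isometry h0
  rwa [Set.image_image, funext fun z => e.symm_apply_apply z, Set.image_id'] at this

lemma continuous_height : Continuous height := by
  unfold height; fun_prop

lemma trapezoid_mem_nhds {z : ℂ} (h₁ : 0 < z.re) (h₂ : z.re < 1 / 2) (h₃ : z.re + height z < 1)
    (h₄ : z.re - height z < 1) : trapezoid ∈ 𝓝 z := by
  have hr := Complex.continuous_re
  have hh := continuous_height
  filter_upwards [hr.continuousAt.eventually (lt_mem_nhds h₁),
    hr.continuousAt.eventually (gt_mem_nhds h₂), (hr.add hh).continuousAt.eventually (gt_mem_nhds h₃),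
    (hr.sub hh).continuousAt.eventually (gt_mem_nhds h₄)] with w k₁ k₂ k₃ k₄
  exact mem_trapezoid.2 ⟨k₁.le, k₂.le, k₃.le, k₄.le⟩

lemma volume_trapezoid_ne_zero : volume trapezoid ≠ 0 := by
  obtain ⟨w, hw, hw'⟩ := exists_re_height (1 / 4) 0
  refine (Measure.measure_pos_of_mem_nhds volume (x := w) (trapezoid_mem_nhds ?_ ?_ ?_ ?_)).ne' <;>
    rw [hw] <;> (try rw [hw']) <;> norm_num

lemma Tile.sub_map (t : Tile) (i : Fin 4) (z : ℂ) : (t.sub i).map z = t.double.map (child i z) := by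
  have : t.sub i = t.double.comp (childPos i, childSym i) := rfl
  rw [this, Tile.map_comp, child_eq]

lemma Tile.double_map_image (t : Tile) (A : Set ℂ) :
    t.double.map '' ((fun z => 2 * z) '' A) = (fun z => 2 * z) '' (t.map '' A) := by
  simp_rw [Set.image_image, Tile.map_two_mul]

lemma Tile.iUnion_sub (t : Tile) :
    ⋃ i, (t.sub i).map '' trapezoid = (fun z => 2 * z) '' (t.map '' trapezoid) := by
  rw [← Tile.double_map_image, two_mul_trapezoid, Set.image_iUnion]
  simp_rw [Set.image_image, ← Tile.sub_map]

/-- Siblings overlap in a null set by `volume_child_inter`; children of different tiles meet inside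
the doubled overlap of their parents. -/
lemma Tile.volume_sub_inter (s t : Tile) (i j : Fin 4) (h : s ≠ t ∨ i ≠ j)
    (hst : s ≠ t → volume (s.map '' trapezoid ∩ t.map '' trapezoid) = 0) :
    volume ((s.sub i).map '' trapezoid ∩ (t.sub j).map '' trapezoid) = 0 := by
  by_cases hs : s = t
  · subst hs
    have hij : i ≠ j := h.resolve_left (fun h => h rfl)
    have e : ∀ i, (s.sub i).map '' trapezoid = s.double.map '' (child i '' trapezoid) := by
      intro i; simp_rw [Set.image_image, Tile.sub_map]
    rw [e, e, ← Set.image_inter (Tile.isometry _).injective]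
    exact volume_image_isometry (Tile.isometry _) (volume_child_inter hij)
  · refine measure_mono_null ?_ (volume_image_two_mul (hst hs))
    rw [Set.image_inter (mul_right_injective₀ two_ne_zero)]
    refine Set.inter_subset_inter ?_ ?_
    · rw [← Tile.iUnion_sub]; exact Set.subset_iUnion (fun i => (s.sub i).map '' trapezoid) i
    · rw [← Tile.iUnion_sub]; exact Set.subset_iUnion (fun i => (t.sub i).map '' trapezoid) j

lemma patch_succ (n : ℕ) : patch (n + 1) = subdiv (patch n) := by
  rw [patch, Function.iterate_succ_apply', patch]

lemma volume_patch_inter (n : ℕ) : ∀ s ∈ patch n, ∀ t ∈ patch n, s ≠ t →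
    volume (s.map '' trapezoid ∩ t.map '' trapezoid) = 0 := by
  induction n with
  | zero =>
    rintro _ rfl _ rfl h
    exact absurd rfl h
  | succ n ih =>
    rw [patch_succ]
    rintro _ ⟨s, hs, i, rfl⟩ _ ⟨t, ht, j, rfl⟩ h
    refine Tile.volume_sub_inter s t i j ?_ (ih s hs t ht)
    by_contra hc
    push Not at hc
    exact h (by rw [hc.1, hc.2])

/-- If two children coincided, their null overlap would be a whole trapezoid, which has positive
area. -/
lemma Tile.sub_injective (n : ℕ) :
    Set.InjOn (fun p : Tile × Fin 4 => p.1.sub p.2) (patch n ×ˢ Set.univ) := by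
  rintro ⟨s, i⟩ ⟨hs, -⟩ ⟨t, j⟩ ⟨ht, -⟩ h
  by_contra hne
  have := Tile.volume_sub_inter s t i j ?_ (volume_patch_inter n s hs t ht)
  · simp only at h
    rw [h, Set.inter_self] at this
    exact volume_image_isometry_ne_zero (Tile.isometry _) volume_trapezoid_ne_zero this
  · by_contra hc
    push Not at hc
    exact hne (by rw [hc.1, hc.2])

lemma ncard_patch (n : ℕ) : (patch n).ncard = 4 ^ n := by
  induction n with
  | zero => exact Set.ncard_singleton _
  | succ n ih =>
    have : patch (n + 1) = (fun p : Tile × Fin 4 => p.1.sub p.2) '' (patch n ×ˢ Set.univ) := by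
      rw [patch_succ]
      ext t
      constructor
      · rintro ⟨g, hg, i, rfl⟩
        exact ⟨(g, i), ⟨hg, trivial⟩, rfl⟩
      · rintro ⟨⟨g, i⟩, ⟨hg, -⟩, rfl⟩
        exact ⟨g, hg, i, rfl⟩
    rw [this, (Tile.sub_injective n).ncard_image, Set.ncard_prod, ih, pow_succ]
    simp

lemma iUnion_patch (n : ℕ) :
    ⋃ t ∈ patch n, t.map '' trapezoid = (fun z => 2 ^ n * z) '' trapezoid := by
  induction n with
  | zero =>
    have : patch 0 = {Tile.one} := rfl
    rw [this, Set.biUnion_singleton, funext Tile.map_neutral]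
    simp
  | succ n ih =>
    have : ⋃ t ∈ patch (n + 1), t.map '' trapezoid =
        ⋃ t ∈ patch n, ⋃ i, (t.sub i).map '' trapezoid := by
      rw [patch_succ]
      ext z
      simp only [Set.mem_iUnion]
      constructor
      · rintro ⟨_, ⟨g, hg, i, rfl⟩, hz⟩
        exact ⟨g, hg, i, hz⟩
      · rintro ⟨g, hg, i, hz⟩
        exact ⟨_, ⟨g, hg, i, rfl⟩, hz⟩
    simp_rw [this, Tile.iUnion_sub, ← Set.image_iUnion₂, ih, Set.image_image, pow_succ', mul_assoc]

lemma tessellates_iterates (n : ℕ) : Tessellates (iterates n) ((fun z => 2 ^ n * z) '' trapezoid) := by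
  rw [iterates_eq]
  refine ⟨?_, ?_⟩
  · rw [Set.biUnion_image, iUnion_patch]
  · rintro _ ⟨s, hs, rfl⟩ _ ⟨t, ht, rfl⟩ h
    exact volume_patch_inter n s hs t ht fun e => h (by rw [e])

lemma ncard_iterates (n : ℕ) : (iterates n).ncard = 4 ^ n := by
  rw [iterates_eq, Set.ncard_image_of_injective _ Tile.map_injective, ncard_patch]

/-! ### Positional representation -/

lemma range_child_zero : Set.range (fun i => child i 0) = digits := by
  ext z
  simp [child, digits]
  tauto

/-- The tiles that result from a tile by the recursion lie in the magnified tile. -/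
lemma map_image_subset_of_mem_subdiv {n : ℕ} {t : Tile} (s : Tile) (h : t ∈ subdiv^[n] {s}) :
    t.map '' trapezoid ⊆ (fun z => 2 ^ n * z) '' (s.map '' trapezoid) := by
  induction n generalizing t with
  | zero =>
    have : t = s := h
    simp [this]
  | succ n ih =>
    rw [Function.iterate_succ_apply'] at h
    obtain ⟨g, hg, i, rfl⟩ := h
    have h₁ : (g.sub i).map '' trapezoid ⊆ (fun z => 2 * z) '' (g.map '' trapezoid) := by
      rw [← Tile.iUnion_sub]; exact Set.subset_iUnion (fun i => (g.sub i).map '' trapezoid) i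
    refine h₁.trans ((Set.image_mono (ih hg)).trans ?_)
    rw [Set.image_image]
    simp_rw [pow_succ', mul_assoc]
    rfl

lemma map_zero_mem_of_mem_patch {n : ℕ} {t : Tile} (h : t ∈ patch n) :
    point t.1 / 2 ^ n ∈ trapezoid := by
  have h₁ : t.map 0 ∈ ⋃ t ∈ patch n, t.map '' trapezoid :=
    Set.mem_biUnion h ⟨0, zero_mem_trapezoid, rfl⟩
  rw [iUnion_patch] at h₁
  obtain ⟨w, hw, he⟩ := h₁
  rw [Tile.map_zero] at he
  rw [← he]
  simpa using hw

lemma point_sub_fst (t : Tile) (i : Fin 4) :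
    point (t.sub i).1 = 2 * point t.1 + t.2.map (child i 0) := by
  rw [Tile.sub, point_add, ← Sym.map_point, child_eq, Tile.map_zero, two_smul, point_add]
  ring

lemma child_zero_mem_digits (i : Fin 4) : child i 0 ∈ digits := by
  rw [← range_child_zero]; exact ⟨i, rfl⟩

lemma conj_mem_digits {z : ℂ} (h : z ∈ digits) : conj z ∈ digits := by
  rcases h with rfl | rfl | rfl | rfl <;> simp [digits]

lemma norm_le_one_of_mem_digits {z : ℂ} (h : z ∈ digits) : ‖z‖ ≤ 1 := by
  rcases h with rfl | rfl | rfl | rfl <;> simp [norm_ω]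

lemma exists_address {z : ℂ} (hz : z ∈ trapezoid) : ∃ (t : ℕ → Tile) (i : ℕ → Fin 4),
    t 0 = Tile.one ∧ (∀ n, t (n + 1) = (t n).sub (i n)) ∧
      ∀ n, 2 ^ n * z ∈ (t n).map '' trapezoid := by
  have key : ∀ (n : ℕ) (t : Tile), 2 ^ n * z ∈ t.map '' trapezoid →
      ∃ i, 2 ^ (n + 1) * z ∈ (t.sub i).map '' trapezoid := by
    intro n t h
    have : 2 ^ (n + 1) * z ∈ (fun z => 2 * z) '' (t.map '' trapezoid) :=
      ⟨_, h, by ring⟩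
    rwa [← Tile.iUnion_sub, Set.mem_iUnion] at this
  choose! i hi using key
  let t : ℕ → Tile := fun n => Nat.rec Tile.one (fun n t => t.sub (i n t)) n
  refine ⟨t, fun n => i n (t n), rfl, fun n => rfl, fun n => ?_⟩
  induction n with
  | zero => exact ⟨z, hz, (Tile.map_neutral z).trans (by simp)⟩
  | succ n ih => exact hi n (t n) ih

lemma mem_trapezoid_iff_hasSum (z : ℂ) : z ∈ trapezoid ↔
    ∃ (d u : ℕ → ℂ) (g : ℕ → ℂ → ℂ), (∀ k, d k ∈ digits ∧ u k ^ 6 = 1) ∧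
      g 0 = id ∧ (∀ n, ∃ i, g (n + 1) = subdivide (g n) i) ∧
      (∀ n, g n 0 / 2 ^ n = ∑ k ∈ Finset.range n, d k / 2 ^ (k + 1) * u k) ∧
      HasSum (fun k => d k / 2 ^ (k + 1) * u k) z := by
  constructor
  · intro hz
    obtain ⟨t, i, h₀, h₁, h₂⟩ := exists_address hz
    -- The linear part of a tile is a rotation, possibly after conjugation. The rotation becomes the
    -- unit factor; conjugation is absorbed into the digit, as the digit set is stable under it.
    let d : ℕ → ℂ := fun k => if (t k).2.2 then conj (child (i k) 0) else child (i k) 0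
    let u : ℕ → ℂ := fun k => ω ^ ((t k).2.1 : ℕ)
    have hd : ∀ k, d k ∈ digits := by
      intro k
      simp only [d]
      split_ifs
      · exact conj_mem_digits (child_zero_mem_digits _)
      · exact child_zero_mem_digits _
    have hsum : ∀ n, (t n).map 0 / 2 ^ n = ∑ k ∈ Finset.range n, d k / 2 ^ (k + 1) * u k := by
      intro n
      induction n with
      | zero => simp [h₀, Tile.map_neutral]
      | succ n ih =>
        rw [Finset.sum_range_succ, ← ih, Tile.map_zero, Tile.map_zero, h₁, point_sub_fst,
          Sym.map_apply]
        simp only [d, u]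
        field_simp
        ring
    have hlim : Tendsto (fun n => (t n).map 0 / 2 ^ n) atTop (𝓝 z) := by
      rw [tendsto_iff_dist_tendsto_zero]
      refine squeeze_zero (fun _ => dist_nonneg) (fun n => ?_) (tendsto_div_two_pow 1)
      obtain ⟨w, hw, he⟩ := h₂ n
      have e : z = (t n).map w / 2 ^ n := by rw [he]; field_simp
      rw [e, dist_eq_norm, ← sub_div, norm_div, ← dist_eq_norm, (Tile.isometry _).dist_eq,
        dist_zero_left, norm_pow, Complex.norm_ofNat]
      gcongr
      exact norm_le_of_mem_hexagon (trapezoid_subset_hexagon hw)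
    refine ⟨d, u, fun n => (t n).map, fun k => ⟨hd k, ?_⟩, ?_, fun n => ⟨i n, ?_⟩, hsum, ?_⟩
    · simp only [u]
      rw [← pow_mul, mul_comm, pow_mul, ω_pow_six, one_pow]
    · funext w
      simp only [h₀, Tile.map_neutral, id]
    · rw [subdivide_map, ← h₁]
    · rw [Summable.hasSum_iff_tendsto_nat]
      · exact hlim.congr hsum
      · refine Summable.of_norm_bounded (g := fun k : ℕ => 1 * (1 / 2 : ℝ) ^ k)
          (summable_geometric_two.mul_left 1) fun k => ?_
        have hu : ‖u k‖ = 1 := by simp [u, norm_ω]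
        rw [norm_mul, norm_div, hu, norm_pow, Complex.norm_ofNat, one_div, inv_pow, mul_one, one_mul,
          ← one_div]
        gcongr
        · exact norm_le_one_of_mem_digits (hd k)
        · norm_num
        · omega
  -- The partial sums are centres of tiles of the n-th iterate scaled by 2⁻ⁿ, so they lie in the
  -- closed trapezoid.
  · rintro ⟨d, u, g, -, h₀, h₁, h₂, h₃⟩
    have hg : ∀ n, g n ∈ iterates n := by
      intro n
      induction n with
      | zero => exact h₀
      | succ n ih =>
        obtain ⟨i, hi⟩ := h₁ n
        exact ⟨g n, ih, i, hi⟩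
    refine isCompact_trapezoid.isClosed.mem_of_tendsto h₃.tendsto_sum_nat
      (Eventually.of_forall fun n => ?_)
    have := hg n
    rw [iterates_eq] at this
    obtain ⟨t, ht, he⟩ := this
    rw [← h₂, ← he, Tile.map_zero]
    exact map_zero_mem_of_mem_patch ht

/-! ### Unlimited iteration -/

/-- The placements for which the placed patches grow to a tessellation of the plane. -/
def growth : ℕ → Tile
  | 0 => Tile.one
  | n + 1 => (growth n).comp (Tile.inv (Tile.double^[n] (childPos 3, childSym 3)))

lemma growth_succ_comp (n : ℕ) :
    (growth (n + 1)).comp (Tile.double^[n] (childPos 3, childSym 3)) = growth n := by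
  rw [growth, Tile.comp_assoc, Tile.inv_comp]
  simp [Tile.comp, Tile.one, Sym.act_zero, Sym.comp_one]

/-- The next patch contains a copy of this one as the n-fold subdivision of child 3; `growth` is
chosen so that this copy stays in place. -/
lemma growth_patch_subset (n : ℕ) :
    (growth n).comp '' patch n ⊆ (growth (n + 1)).comp '' patch (n + 1) := by
  have h : (Tile.double^[n] (childPos 3, childSym 3)).comp '' patch n ⊆ patch (n + 1) := by
    rw [patch, ← subdiv_iterate_image, patch, Function.iterate_succ_apply]
    refine subdiv_iterate_mono n ?_
    rw [Set.image_singleton, Set.singleton_subset_iff]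
    exact ⟨Tile.one, rfl, 3, by decide⟩
  rintro _ ⟨t, ht, rfl⟩
  exact ⟨_, h ⟨t, ht, rfl⟩, by rw [← Tile.comp_assoc, growth_succ_comp]⟩

/-- Since `child 3 (1 / 3) = 2 / 3`, the point 1/3 is fixed by `child 3 z / 2`. The placed
trapezoids thus grow around a fixed point, which is interior to the trapezoid. -/
lemma growth_map (n : ℕ) : (growth n).map (2 ^ n / 3) = 1 / 3 := by
  induction n with
  | zero => rw [growth, Tile.map_neutral]; norm_num
  | succ n ih =>
    rw [← ih, ← growth_succ_comp n, Tile.map_comp]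
    congr 1
    have h : ∀ n : ℕ, ∀ z : ℂ, (Tile.double^[n] (childPos 3, childSym 3)).map (2 ^ n * z) =
        2 ^ n * child 3 z := by
      intro n
      induction n with
      | zero => intro z; simp [child_eq]
      | succ n ih =>
        intro z
        rw [Function.iterate_succ_apply', pow_succ', mul_assoc, ← Tile.map_two_mul, ih, mul_assoc]
    have h' := h n (1 / 3)
    rw [mul_one_div] at h'
    rw [h']
    have : child 3 (1 / 3) = 2 / 3 := by
      change 1 + ω ^ 3 * conj (1 / 3) = _
      rw [ω_pow_three, map_div₀, map_one, Complex.conj_ofNat]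
      norm_num
    rw [this, pow_succ]
    ring

lemma Tile.map_image_iUnion (s : Tile) (n : ℕ) :
    ⋃ t ∈ s.comp '' patch n, t.map '' trapezoid =
      s.map '' ((fun z => 2 ^ n * z) '' trapezoid) := by
  rw [← iUnion_patch, Set.biUnion_image, Set.image_iUnion₂]
  simp_rw [Set.image_image, Tile.map_comp]

/-- Pulled back and divided by 2ⁿ, any point of the plane tends to the interior point 1/3. -/
lemma iUnion_growth : ⋃ t ∈ ⋃ n, (growth n).comp '' patch n, t.map '' trapezoid = Set.univ := by
  rw [Set.biUnion_iUnion]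
  simp_rw [Tile.map_image_iUnion]
  refine Set.eq_univ_of_forall fun z => Set.mem_iUnion.2 ?_
  have hlim : Tendsto (fun n => (growth n).inv.map z / 2 ^ n) atTop (𝓝 (1 / 3)) := by
    rw [tendsto_iff_dist_tendsto_zero]
    refine squeeze_zero (fun _ => dist_nonneg) (fun n => le_of_eq ?_)
      (tendsto_div_two_pow (dist z (1 / 3)))
    have e : (1 / 3 : ℂ) = (growth n).inv.map (1 / 3) / 2 ^ n := by
      conv_rhs => rw [← growth_map n, ← Tile.map_comp, Tile.inv_comp, Tile.map_neutral]
      field_simp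
    conv_lhs => rw [e]
    rw [dist_eq_norm, ← sub_div, norm_div, ← dist_eq_norm, (Tile.isometry _).dist_eq, norm_pow,
      Complex.norm_ofNat]
  have hn : trapezoid ∈ 𝓝 (1 / 3 : ℂ) := by
    have h1 : (1 / 3 : ℂ).re = 1 / 3 := by simp
    have h2 : height (1 / 3) = 0 := by simp [height]
    refine trapezoid_mem_nhds ?_ ?_ ?_ ?_ <;> rw [h1] <;> (try rw [h2]) <;> norm_num
  obtain ⟨n, hn⟩ := (hlim.eventually hn).exists
  refine ⟨n, (growth n).inv.map z, ⟨_, hn, ?_⟩, ?_⟩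
  · field_simp
  · rw [← Tile.map_comp, Tile.comp_inv, Tile.map_neutral]

lemma monotone_growth : Monotone fun n => (growth n).comp '' patch n :=
  monotone_nat_of_le_succ growth_patch_subset

lemma exists_subset_of_monotone {α : Type*} {A : ℕ → Set α} (hA : Monotone A) {F : Set α}
    (hF : F ⊆ ⋃ n, A n) (hfin : F.Finite) : ∃ n, F ⊆ A n := by
  have : ∀ x ∈ F, ∀ᶠ n in atTop, x ∈ A n := by
    intro x hx
    obtain ⟨m, hm⟩ := Set.mem_iUnion.1 (hF hx)
    filter_upwards [eventually_ge_atTop m] with n hn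
    exact hA hn hm
  exact ((Filter.eventually_all_finite hfin).2 this).exists

/-! ### Legal configurations are locally contained in patches -/

lemma eq_zero_or_unit_of_lt {x : ℤ × ℤ} (h : x.1 ^ 2 + x.1 * x.2 + x.2 ^ 2 < 3) :
    x = 0 ∨ ∃ k, x = unit k := by
  obtain ⟨m, n⟩ := x
  simp only at h
  have h1 : -2 < m := by nlinarith [sq_nonneg (m + 2 * n)]
  have h2 : m < 2 := by nlinarith [sq_nonneg (m + 2 * n)]
  have h3 : -2 < n := by nlinarith [sq_nonneg (n + 2 * m)]
  have h4 : n < 2 := by nlinarith [sq_nonneg (n + 2 * m)]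
  interval_cases m <;> interval_cases n <;> first | (exfalso; revert h; decide) | (revert h; decide)

lemma eq_or_unit_of_norm_lt {x y : ℤ × ℤ} (h : ‖point x - point y‖ ^ 2 < 3) :
    x = y ∨ ∃ k, y = x + unit k := by
  have h' : ((y - x).1 : ℝ) ^ 2 + (y - x).1 * (y - x).2 + (y - x).2 ^ 2 < 3 := by
    rwa [← norm_sq_point, point_sub, norm_sub_rev]
  rcases eq_zero_or_unit_of_lt (x := y - x) (by exact_mod_cast h') with h | ⟨k, h⟩
  · exact .inl (sub_eq_zero.1 h).symm
  · exact .inr ⟨k, by rw [← h]; abel⟩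

/-- The circumradius is 1/√3. The rational bound is sharp enough for 1/2 + 2 · 0.58 < √3 and 0.58 +
1/4 < 1, which are needed below. -/
lemma norm_le_of_mem_trapezoid {z : ℂ} (hz : z ∈ trapezoid) : ‖z‖ ≤ 58 / 100 := by
  nlinarith [three_mul_norm_sq_le (trapezoid_subset_hexagon hz), norm_nonneg z]

lemma norm_point_sub_le {n : ℕ} {s t : Tile} (h : t ∈ subdiv^[n] {s}) :
    ‖point t.1 - 2 ^ n * point s.1‖ ≤ 2 ^ n * (58 / 100) := by
  obtain ⟨_, ⟨w, hw, rfl⟩, he⟩ := map_image_subset_of_mem_subdiv s h ⟨0, zero_mem_trapezoid, rfl⟩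
  simp only at he
  rw [← Tile.map_zero, ← Tile.map_zero, ← he, ← mul_sub, norm_mul, ← dist_eq_norm,
    (Tile.isometry _).dist_eq, dist_zero_right, norm_pow, Complex.norm_ofNat]
  gcongr
  exact norm_le_of_mem_trapezoid hw

/-- High enough in the hierarchy the ancestors of `F` are pairwise neighbours, so they lie in a copy
of the fourth patch; subdividing it n times covers `F`. -/
lemma LegalOn.locallyPatch {δ : ℤ × ℤ → Sym} (h : LegalOn Set.univ δ) :
    LocallyPatch (halfTiles δ) := by
  intro F hF hfin
  obtain ⟨C, hC⟩ : ∃ C : ℝ, ∀ s ∈ F, ∀ t ∈ F, ‖point s.1 - point t.1‖ ≤ C := by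
    obtain ⟨C, hC⟩ := Metric.isBounded_iff.1 (hfin.image fun t => point t.1).isBounded
    refine ⟨C, fun s hs t ht => ?_⟩
    rw [← dist_eq_norm]
    exact hC ⟨s, hs, rfl⟩ ⟨t, ht, rfl⟩
  obtain ⟨n, hn⟩ := ((tendsto_div_two_pow C).eventually_lt_const (show (0 : ℝ) < 1 / 2 by norm_num)).exists
  obtain ⟨s, η, hη, he⟩ := h.halfTiles_eq n
  have hch : ∀ f ∈ F, ∃ t g, g ∈ halfTiles η ∧ t ∈ subdiv^[n] {g} ∧ s.comp t = f := by
    intro f hf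
    have := hF hf
    rw [he] at this
    obtain ⟨t, ht, rfl⟩ := this
    obtain ⟨g, hg, ht⟩ := (mem_subdiv_iterate_iff _ _ _).1 ht
    exact ⟨t, g, hg, ht, rfl⟩
  choose! t g hg ht hst using hch
  have hdist : ∀ f ∈ F, ∀ f' ∈ F, ‖point (g f).1 - point (g f').1‖ ^ 2 < 3 := by
    intro f hf f' hf'
    have h₁ := norm_point_sub_le (ht f hf)
    have h₂ := norm_point_sub_le (ht f' hf')
    have h₃ := hC f hf f' hf'
    rw [← hst f hf, ← hst f' hf', ← Tile.map_zero, ← Tile.map_zero, Tile.map_comp, Tile.map_comp,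
      ← dist_eq_norm, (Tile.isometry s).dist_eq, Tile.map_zero, Tile.map_zero, dist_eq_norm] at h₃
    rw [div_lt_iff₀ (by positivity)] at hn
    -- 1.66 = 1/2 + 2 · 0.58 is less than √3, the distance of second neighbours in the lattice.
    have h₄ : 2 ^ n * ‖point (g f).1 - point (g f').1‖ ≤ 2 ^ n * (166 / 100) := by
      have e : (2 : ℝ) ^ n = ‖(2 : ℂ) ^ n‖ := by simp
      calc 2 ^ n * ‖point (g f).1 - point (g f').1‖
          = ‖2 ^ n * point (g f).1 - 2 ^ n * point (g f').1‖ := by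
            rw [← mul_sub, norm_mul, ← e]
        _ = ‖(point (t f).1 - point (t f').1) - (point (t f).1 - 2 ^ n * point (g f).1) +
              (point (t f').1 - 2 ^ n * point (g f').1)‖ := by congr 1; ring
        _ ≤ ‖point (t f).1 - point (t f').1‖ + ‖point (t f).1 - 2 ^ n * point (g f).1‖ +
              ‖point (t f').1 - 2 ^ n * point (g f').1‖ :=
            (norm_add_le _ _).trans (by gcongr; exact norm_sub_le _ _)
        _ ≤ _ := by linarith
    have h₅ := le_of_mul_le_mul_left h₄ (by positivity)
    nlinarith [norm_nonneg (point (g f).1 - point (g f').1)]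
  obtain ⟨s', hs'⟩ := hη.subset_patch (G := g '' F) (by rintro _ ⟨f, hf, rfl⟩; exact hg f hf) (by
    rintro _ ⟨f, hf, rfl⟩ _ ⟨f', hf', rfl⟩
    exact eq_or_unit_of_norm_lt (hdist f hf f' hf'))
  refine ⟨n + 4, s.comp (Tile.double^[n] s'), fun f hf => ?_⟩
  have h₁ : t f ∈ subdiv^[n] (s'.comp '' patch 4) :=
    subdiv_iterate_mono n (Set.singleton_subset_iff.2 (hs' ⟨f, hf, rfl⟩)) (ht f hf)
  rw [subdiv_iterate_image, patch_add] at h₁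
  obtain ⟨p, hp, hpt⟩ := h₁
  exact ⟨p, hp, by rw [Tile.comp_assoc, hpt, hst f hf]⟩

/-! ### Isometries of the hexagon and of the trapezoid -/

lemma exists_affine {f : ℂ → ℂ} (hf : Isometry f) :
    ∃ L : ℂ ≃ₗᵢ[ℝ] ℂ, ∀ z w, f (z + w) = f z + L w := by
  obtain ⟨e, rfl⟩ := exists_affineIsometryEquiv hf
  refine ⟨e.linearIsometryEquiv, fun z w => ?_⟩
  have := e.map_vadd z w
  simp only [vadd_eq_add] at this
  rw [add_comm z w, this, add_comm]

lemma vertex_add_three (k : Fin 6) : vertex (k + 3) = -vertex k := by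
  have h3 : ((3 : Fin 6) : ℕ) = 3 := rfl
  rw [add_comm, vertex_add, h3, ω_pow_three]; ring

lemma norm_sq_vertex_zero : 3 * ‖vertex 0‖ ^ 2 = 1 := by
  rw [norm_sq_eq, vertex_zero_re, height_vertex_zero]; norm_num

/-- An isometry that carries two opposite vertices into a hexagon carries the centre to the
centre. -/
lemma map_zero_of_vertices {f : ℂ → ℂ} (hf : Isometry f) {c : ℂ} (h₀ : f (vertex 0) - c ∈ hexagon)
    (h₃ : f (vertex 3) - c ∈ hexagon) : f 0 = c ∧ 3 * ‖f (vertex 0) - c‖ ^ 2 = 1 := by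
  obtain ⟨L, hL⟩ := exists_affine hf
  have e : ∀ z, f z = f 0 + L z := fun z => by rw [← hL, zero_add]
  have hv : vertex 3 = -vertex 0 := by
    have := vertex_add_three 0
    rwa [zero_add] at this
  have k₀ := three_mul_norm_sq_le h₀
  have k₃ := three_mul_norm_sq_le h₃
  -- The two images are a full diameter 2/√3 apart and within 1/√3 of `c`, so their midpoint is `c`.
  have hp := parallelogram_law_with_norm ℝ (f (vertex 0) - c) (f (vertex 3) - c)
  have hs : f (vertex 0) - c + (f (vertex 3) - c) = (2 : ℝ) • (f 0 - c) := by
    rw [e (vertex 0), e (vertex 3), hv, map_neg, Complex.real_smul]; push_cast; ring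
  have hd : f (vertex 0) - c - (f (vertex 3) - c) = (2 : ℝ) • L (vertex 0) := by
    rw [e (vertex 0), e (vertex 3), hv, map_neg, Complex.real_smul]; push_cast; ring
  rw [hs, hd, norm_smul, norm_smul, L.norm_map] at hp
  have hn := norm_sq_vertex_zero
  have h0 : ‖f 0 - c‖ = 0 := by
    simp only [Real.norm_ofNat] at hp
    nlinarith [norm_nonneg (f 0 - c)]
  have hc : f 0 = c := sub_eq_zero.1 (norm_eq_zero.1 h0)
  refine ⟨hc, ?_⟩
  rw [e, hc, add_sub_cancel_left, L.norm_map, hn]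

lemma eq_vertex_of_norm {z : ℂ} (hz : z ∈ hexagon) (hn : 3 * ‖z‖ ^ 2 = 1) :
    ∃ k, z = vertex k := by
  obtain ⟨⟨h0, h0'⟩, ⟨h1, h1'⟩, ⟨h2, h2'⟩, ⟨h3, h3'⟩, ⟨h4, h4'⟩, h5, h5'⟩ := vertex_coords
  obtain ⟨k1, k2, k3, k4, k5, k6⟩ := mem_hexagon.1 hz
  rw [norm_sq_eq] at hn
  have key : ∀ x s : ℝ, 0 ≤ x → 0 ≤ s → x ≤ 1 / 2 → x + s ≤ 1 → 3 * x ^ 2 + s ^ 2 = 1 →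
      (x = 0 ∧ s = 1) ∨ (x = 1 / 2 ∧ s = 1 / 2) := by
    intro x s hx hs hx' hxs h
    have : x * (1 - 2 * x) = 0 := by nlinarith
    rcases mul_eq_zero.1 this with h' | h'
    · left
      subst h'
      refine ⟨rfl, ?_⟩
      nlinarith
    · right
      have : x = 1 / 2 := by linarith
      subst this
      refine ⟨rfl, ?_⟩
      nlinarith
  rcases le_total 0 z.re with hx | hx <;> rcases le_total 0 (height z) with hs | hs
  · rcases key z.re (height z) hx hs k2 k3 hn with ⟨a, b⟩ | ⟨a, b⟩
    · exact ⟨0, ext_re_height (by rw [a, h0]) (by rw [b, h0'])⟩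
    · exact ⟨5, ext_re_height (by rw [a, h5]) (by rw [b, h5'])⟩
  · rcases key z.re (-height z) hx (by linarith) k2 (by linarith)
      (by rw [neg_sq]; exact hn) with ⟨a, b⟩ | ⟨a, b⟩
    · exact ⟨3, ext_re_height (by rw [a, h3]) (by rw [h3']; linarith)⟩
    · exact ⟨4, ext_re_height (by rw [a, h4]) (by rw [h4']; linarith)⟩
  · rcases key (-z.re) (height z) (by linarith) hs (by linarith) (by linarith)
      (by rw [neg_sq]; exact hn) with ⟨a, b⟩ | ⟨a, b⟩
    · exact ⟨0, ext_re_height (by rw [h0]; linarith) (by rw [b, h0'])⟩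
    · exact ⟨1, ext_re_height (by rw [h1]; linarith) (by rw [b, h1'])⟩
  · rcases key (-z.re) (-height z) (by linarith) (by linarith) (by linarith) (by linarith)
      (by rw [neg_sq, neg_sq]; exact hn) with ⟨a, b⟩ | ⟨a, b⟩
    · exact ⟨3, ext_re_height (by rw [h3]; linarith) (by rw [h3']; linarith)⟩
    · exact ⟨2, ext_re_height (by rw [h2]; linarith) (by rw [h2']; linarith)⟩

lemma vertex_ne_zero (k : Fin 6) : vertex k ≠ 0 := by
  have h := norm_sq_vertex_zero
  intro h0
  have : vertex 0 = 0 := by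
    have := vertex_add k 0
    rw [add_zero, h0] at this
    exact (mul_eq_zero.1 this.symm).resolve_left (pow_ne_zero _ ω_ne_zero)
  rw [this] at h
  norm_num at h

lemma conj_vertex_zero : conj (vertex 0) = -vertex 0 := by
  simp [vertex, neg_div]

/-- A linear isometry that permutes the vertices is one of the twelve symmetries. -/
lemma exists_sym_of_map_vertex {L : ℂ ≃ₗᵢ[ℝ] ℂ} {k : Fin 6} (h : L (vertex 0) = vertex k) :
    ∃ d : Sym, L = d.map := by
  have hk : vertex k = ω ^ (k : ℕ) * vertex 0 := by
    have := vertex_add k 0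
    rwa [add_zero] at this
  obtain ⟨a, rfl | rfl⟩ := linear_isometry_complex L
  · refine ⟨(k, false), ?_⟩
    have : (a : ℂ) = ω ^ (k : ℕ) := by
      rw [rotation_apply, hk] at h
      exact mul_right_cancel₀ (vertex_ne_zero 0) h
    ext z : 1
    simp [rotation_apply, Sym.map_apply, this]
  · refine ⟨(k + 3, true), ?_⟩
    have : (a : ℂ) = -ω ^ (k : ℕ) := by
      rw [LinearIsometryEquiv.trans_apply, Complex.conjLIE_apply, rotation_apply, hk,
        conj_vertex_zero] at h
      refine mul_right_cancel₀ (vertex_ne_zero 0) ?_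
      linear_combination -h
    ext z : 1
    simp [rotation_apply, Sym.map_apply, this, ω_pow_add, ω_pow_three]

lemma vertex_mem_hexagon (k : Fin 6) : vertex k ∈ hexagon :=
  subset_convexHull _ _ (Set.mem_range_self k)

lemma exists_tile_of_image_hexagon {f : ℂ → ℂ} (hf : Isometry f) {x : ℤ × ℤ}
    (h : f '' hexagon = (fun z => point x + z) '' hexagon) : ∃ d : Sym, f = Tile.map (x, d) := by
  have hm : ∀ z ∈ hexagon, f z - point x ∈ hexagon := by
    intro z hz
    obtain ⟨w, hw, he⟩ := h ▸ Set.mem_image_of_mem f hz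
    rw [← he]
    simpa using hw
  obtain ⟨h₁, h₂⟩ := map_zero_of_vertices hf (hm _ (vertex_mem_hexagon 0))
    (hm _ (vertex_mem_hexagon 3))
  obtain ⟨k, hk⟩ := eq_vertex_of_norm (hm _ (vertex_mem_hexagon 0)) h₂
  obtain ⟨L, hL⟩ := exists_affine hf
  have e : ∀ z, f z = point x + L z := fun z => by rw [← h₁, ← hL, zero_add]
  rw [e, add_sub_cancel_left] at hk
  obtain ⟨d, rfl⟩ := exists_sym_of_map_vertex hk
  exact ⟨d, funext e⟩

lemma vertex_mem_trapezoid : vertex 0 ∈ trapezoid ∧ vertex 3 ∈ trapezoid :=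
  ⟨subset_convexHull _ _ (by simp), subset_convexHull _ _ (by simp)⟩

/-- A symmetry of the trapezoid fixes the points of its axis. -/
lemma map_of_image_trapezoid {f : ℂ → ℂ} (hf : Isometry f) (h : f '' trapezoid = trapezoid) :
    f 0 = 0 ∧ f 1 = 1 := by
  have hm : ∀ z ∈ trapezoid, f z ∈ trapezoid := fun z hz => h ▸ Set.mem_image_of_mem f hz
  have m0 := hm _ vertex_mem_trapezoid.1
  have m3 := hm _ vertex_mem_trapezoid.2
  obtain ⟨h₁, h₂⟩ := map_zero_of_vertices hf (c := 0)
    (by rw [sub_zero]; exact trapezoid_subset_hexagon m0)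
    (by rw [sub_zero]; exact trapezoid_subset_hexagon m3)
  rw [sub_zero] at h₂
  obtain ⟨k, hk⟩ := eq_vertex_of_norm (trapezoid_subset_hexagon m0) h₂
  obtain ⟨L, hL⟩ := exists_affine hf
  have e : ∀ z, f z = L z := fun z => by
    have := hL 0 z
    rwa [h₁, zero_add, zero_add] at this
  have hk' := hk
  rw [e] at hk'
  obtain ⟨d, rfl⟩ := exists_sym_of_map_vertex hk'
  refine ⟨h₁, ?_⟩
  have hhalf : (1 / 2 : ℂ) ∈ trapezoid := by
    have h1 : (1 / 2 : ℂ).re = 1 / 2 := by simp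
    have h2 : height (1 / 2) = 0 := by simp [height]
    rw [mem_trapezoid, h1, h2]; norm_num
  have h5 := hm _ hhalf
  have e2 : d.map (1 / 2) = (1 / 2 : ℝ) • point (unit d.1) := by
    rw [← Sym.map_one_eq, ← map_smul]; simp
  rw [e, e2] at h5
  have r0 := (mem_trapezoid.1 m0).1
  have r3 := (mem_trapezoid.1 m3).1
  have hv3 : vertex 3 = -vertex 0 := by
    have := vertex_add_three 0
    rwa [zero_add] at this
  rw [hv3, e, map_neg, ← e, hk, Complex.neg_re] at r3
  rw [hk] at r0
  -- The long side is preserved, which leaves directions 0 and 3; direction 3 would move the point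
  -- 1/2 out of the trapezoid.
  have hd : d.1 = 0 := by
    have hkv : vertex (d.vert 0) = vertex k := by rw [← Sym.map_vertex, ← e, hk]
    have hr : (vertex (d.vert 0)).re = 0 := by rw [hkv]; linarith
    obtain ⟨⟨h0, h0'⟩, ⟨h1, h1'⟩, ⟨h2, h2'⟩, ⟨h3, h3'⟩, ⟨h4, h4'⟩, h6, h6'⟩ := vertex_coords
    have hc : d.vert 0 = 0 ∨ d.vert 0 = 3 := by
      have : ∀ j : Fin 6, (vertex j).re = 0 → j = 0 ∨ j = 3 := by
        intro j hj
        fin_cases j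
        · exact .inl rfl
        · exact absurd (hj.symm.trans h1) (by norm_num)
        · exact absurd (hj.symm.trans h2) (by norm_num)
        · exact .inr rfl
        · exact absurd (hj.symm.trans h4) (by norm_num)
        · exact absurd (hj.symm.trans h6) (by norm_num)
      exact this _ hr
    have hc' : d.1 = 0 ∨ d.1 = 3 := by
      clear * - hc
      revert hc
      revert d
      decide
    refine hc'.resolve_right fun h3 => ?_
    have := (mem_trapezoid.1 h5).1
    have hu : unit 3 = (-1, 0) := rfl
    rw [h3, hu, Complex.smul_re, re_point] at this
    norm_num at this
  rw [e, Sym.map_one_eq, hd]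
  simp [point, unit]

/-! ### Stripes -/

lemma eq_iff_re_height {z w : ℂ} : z = w ↔ z.re = w.re ∧ height z = height w :=
  ⟨fun h => h ▸ ⟨rfl, rfl⟩, fun h => ext_re_height h.1 h.2⟩

lemma mem_segment_of_height_eq {p q z : ℂ} (h : height p = height q) (hpq : q.re < p.re) :
    z ∈ segment ℝ p q ↔ height z = height p ∧ q.re ≤ z.re ∧ z.re ≤ p.re := by
  constructor
  · rintro ⟨a, b, ha, hb, hab, rfl⟩
    obtain rfl : b = 1 - a := by linarith
    simp only [height_add, height_smul, Complex.add_re, Complex.smul_re, smul_eq_mul, ← h]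
    refine ⟨by ring, ?_, ?_⟩ <;> nlinarith
  · rintro ⟨h₁, h₂, h₃⟩
    have hd : 0 < p.re - q.re := by linarith
    refine ⟨(z.re - q.re) / (p.re - q.re), (p.re - z.re) / (p.re - q.re),
      div_nonneg (by linarith) hd.le, div_nonneg (by linarith) hd.le, ?_, ext_re_height ?_ ?_⟩
    · field_simp
      ring
    · simp only [Complex.add_re, Complex.smul_re, smul_eq_mul]
      field_simp
      ring
    · simp only [height_add, height_smul, ← h, h₁]
      field_simp
      ring

lemma stripeEnd_coords (a b : Fin 6) : (stripeEnd a b).re = ((vertex a).re + 3 * (vertex b).re) / 4 ∧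
    height (stripeEnd a b) = (height (vertex a) + 3 * height (vertex b)) / 4 := by
  have : stripeEnd a b = (1 / 4 : ℝ) • vertex a + (3 / 4 : ℝ) • vertex b := by
    simp [stripeEnd]; ring
  rw [this]
  simp only [height_add, height_smul, Complex.add_re, Complex.smul_re, smul_eq_mul]
  constructor <;> ring

lemma mem_stripes {z : ℂ} : z ∈ stripes ↔
    (height z = -1 / 4 ∧ -1 / 2 ≤ z.re ∧ z.re ≤ 1 / 2) ∨
    (height z = 7 / 8 ∧ -1 / 8 ≤ z.re ∧ z.re ≤ 1 / 8) ∨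
    (height z = -7 / 8 ∧ -1 / 8 ≤ z.re ∧ z.re ≤ 1 / 8) := by
  obtain ⟨⟨h0, h0'⟩, ⟨h1, h1'⟩, ⟨h2, h2'⟩, ⟨h3, h3'⟩, ⟨h4, h4'⟩, h5, h5'⟩ := vertex_coords
  obtain ⟨a1, a2⟩ := stripeEnd_coords 5 4
  obtain ⟨b1, b2⟩ := stripeEnd_coords 1 2
  obtain ⟨c1, c2⟩ := stripeEnd_coords 5 0
  obtain ⟨d1, d2⟩ := stripeEnd_coords 1 0
  obtain ⟨e1, e2⟩ := stripeEnd_coords 2 3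
  obtain ⟨f1, f2⟩ := stripeEnd_coords 4 3
  rw [h0, h5] at c1
  rw [h0, h1] at d1
  rw [h5, h4] at a1
  rw [h1, h2] at b1
  rw [h2, h3] at e1
  rw [h4, h3] at f1
  rw [h0', h5'] at c2
  rw [h0', h1'] at d2
  rw [h5', h4'] at a2
  rw [h1', h2'] at b2
  rw [h2', h3'] at e2
  rw [h4', h3'] at f2
  rw [stripes, Set.mem_union, Set.mem_union, segment_symm ℝ (stripeEnd 2 3),
    mem_segment_of_height_eq (by rw [a2, b2]) (by rw [a1, b1]; norm_num),
    mem_segment_of_height_eq (by rw [c2, d2]) (by rw [c1, d1]; norm_num),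
    mem_segment_of_height_eq (by rw [e2, f2]) (by rw [e1, f1]; norm_num),
    a1, a2, b1, c1, c2, d1, e1, f1, f2, or_assoc]
  norm_num

lemma stripes_subset_hexagon : stripes ⊆ hexagon := by
  intro z hz
  rw [mem_hexagon]
  rcases mem_stripes.1 hz with ⟨h, h', h''⟩ | ⟨h, h', h''⟩ | ⟨h, h', h''⟩ <;> rw [h] <;>
    refine ⟨?_, ?_, ?_, ?_, ?_, ?_⟩ <;> linarith

/-- The two points of the side in direction `k` at which a stripe may cross it. -/
noncomputable def edgePoint (k : Fin 6) (b : Bool) : ℂ :=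
  ω ^ (k : ℕ) * (1 / 2 + (if b then vertex 0 else -vertex 0) / 4)

lemma edgePoint_zero_coords (b : Bool) :
    (edgePoint 0 b).re = 1 / 2 ∧ height (edgePoint 0 b) = if b then 1 / 4 else -1 / 4 := by
  have : edgePoint 0 b = (1 / 2 : ℝ) • (1 : ℂ) + (if b then 1 / 4 else -1 / 4 : ℝ) • vertex 0 := by
    cases b <;> simp [edgePoint] <;> ring
  rw [this]
  simp only [height_add, height_smul, Complex.add_re, Complex.smul_re, smul_eq_mul, vertex_zero_re,
    height_vertex_zero, height_one, Complex.one_re]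
  constructor <;> ring

lemma edgePoint_add_one (k : Fin 6) (b : Bool) : edgePoint (1 + k) b = ω * edgePoint k b := by
  rw [edgePoint, ω_pow_add, edgePoint]
  simp [mul_assoc]

/-- The counterclockwise end of a common side for one hexagon is the clockwise end for the other. -/
lemma edgePoint_add_three (k : Fin 6) (b : Bool) :
    ω ^ (k : ℕ) + edgePoint (k + 3) b = edgePoint k (!b) := by
  have h3 : ((3 : Fin 6) : ℕ) = 3 := rfl
  rw [edgePoint, ω_pow_add, h3, ω_pow_three, edgePoint]
  cases b <;> simp only [Bool.not_true, Bool.not_false, if_true, if_false, Bool.false_eq_true] <;> ring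

lemma edgePoint_injective (k : Fin 6) : Function.Injective (edgePoint k) := by
  intro a b h
  have h' : edgePoint 0 a = edgePoint 0 b := by
    have := mul_left_cancel₀ (pow_ne_zero _ ω_ne_zero) h
    rw [edgePoint, edgePoint, this]
  have := congrArg height h'
  rw [(edgePoint_zero_coords a).2, (edgePoint_zero_coords b).2] at this
  cases a <;> cases b <;> first | rfl | norm_num at this

lemma Sym.map_edgePoint (d : Sym) (k : Fin 6) (b : Bool) :
    d.map (edgePoint k b) = edgePoint (d.dir k) (xor d.2 b) := by
  have h : conj (1 / 2 + (if b then vertex 0 else -vertex 0) / 4) =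
      1 / 2 + (if !b then vertex 0 else -vertex 0) / 4 := by
    rw [map_add, map_div₀, map_div₀, apply_ite conj, map_neg, conj_vertex_zero]
    have h2 : conj (2 : ℂ) = 2 := Complex.conj_ofNat 2
    have h4 : conj (4 : ℂ) = 4 := Complex.conj_ofNat 4
    cases b <;> simp [h2, h4]
  rcases d with ⟨l, _ | _⟩
  · simp [Sym.map_apply, edgePoint, Sym.dir, ω_pow_add, mul_assoc]
  · simp only [Sym.map_apply, edgePoint, Sym.dir, sub_eq_add_neg, ω_pow_add, ← conj_ω_pow, mul_assoc,
      map_mul, h, if_true, Bool.true_xor]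

lemma edgePoint_coords :
    ((edgePoint 0 false).re = 1 / 2 ∧ height (edgePoint 0 false) = -1 / 4) ∧
    ((edgePoint 1 true).re = 1 / 8 ∧ height (edgePoint 1 true) = 7 / 8) ∧
    ((edgePoint 2 false).re = -1 / 8 ∧ height (edgePoint 2 false) = 7 / 8) ∧
    ((edgePoint 3 true).re = -1 / 2 ∧ height (edgePoint 3 true) = -1 / 4) ∧
    ((edgePoint 4 true).re = -1 / 8 ∧ height (edgePoint 4 true) = -7 / 8) ∧
    ((edgePoint 5 false).re = 1 / 8 ∧ height (edgePoint 5 false) = -7 / 8) := by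
  have step : ∀ (k : Fin 6) (b : Bool) (x s : ℝ),
      (edgePoint k b).re = x ∧ height (edgePoint k b) = s →
      (edgePoint (1 + k) b).re = (x - s) / 2 ∧ height (edgePoint (1 + k) b) = (3 * x + s) / 2 := by
    rintro k b x s ⟨rfl, rfl⟩
    rw [edgePoint_add_one]
    exact ⟨re_ω_mul _, height_ω_mul _⟩
  have f0 : _ ∧ height (edgePoint 0 false) = -1 / 4 := edgePoint_zero_coords false
  have t0 : _ ∧ height (edgePoint 0 true) = 1 / 4 := edgePoint_zero_coords true
  have f1 : (edgePoint 1 false).re = _ ∧ height (edgePoint 1 false) = _ := step 0 _ _ _ f0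
  have f2 : (edgePoint 2 false).re = _ ∧ height (edgePoint 2 false) = _ := step 1 _ _ _ f1
  have f3 : (edgePoint 3 false).re = _ ∧ height (edgePoint 3 false) = _ := step 2 _ _ _ f2
  have f4 : (edgePoint 4 false).re = _ ∧ height (edgePoint 4 false) = _ := step 3 _ _ _ f3
  have f5 : (edgePoint 5 false).re = _ ∧ height (edgePoint 5 false) = _ := step 4 _ _ _ f4
  have t1 : (edgePoint 1 true).re = _ ∧ height (edgePoint 1 true) = _ := step 0 _ _ _ t0
  have t2 : (edgePoint 2 true).re = _ ∧ height (edgePoint 2 true) = _ := step 1 _ _ _ t1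
  have t3 : (edgePoint 3 true).re = _ ∧ height (edgePoint 3 true) = _ := step 2 _ _ _ t2
  have t4 : (edgePoint 4 true).re = _ ∧ height (edgePoint 4 true) = _ := step 3 _ _ _ t3
  rw [f0.1, f0.2, t1.1, t1.2, f2.1, f2.2, t3.1, t3.2, t4.1, t4.2, f5.1, f5.2]
  norm_num

/-- Exactly one stripe end lies on each side, which is why one bit per side encodes the stripe rule.
-/
lemma mem_stripes_inter (k : Fin 6) (z : ℂ) : z ∈ stripes ∧ z - ω ^ (k : ℕ) ∈ hexagon ↔
    z = edgePoint k (Sym.edgeSign (0, false) k) := by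
  obtain ⟨⟨a0, b0⟩, ⟨a1, b1⟩, ⟨a2, b2⟩, ⟨a3, b3⟩, ⟨a4, b4⟩, a5, b5⟩ := edgePoint_coords
  have hk : k = 0 ∨ k = 1 ∨ k = 2 ∨ k = 3 ∨ k = 4 ∨ k = 5 := by
    revert k
    decide
  have hs : Sym.edgeSign (0, false) 0 = false ∧ Sym.edgeSign (0, false) 1 = true ∧
      Sym.edgeSign (0, false) 2 = false ∧ Sym.edgeSign (0, false) 3 = true ∧
      Sym.edgeSign (0, false) 4 = true ∧ Sym.edgeSign (0, false) 5 = false := by decide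
  have hu : unit 0 = (1, 0) ∧ unit 1 = (0, 1) ∧ unit 2 = (-1, 1) ∧ unit 3 = (-1, 0) ∧
      unit 4 = (0, -1) ∧ unit 5 = (1, -1) := by decide
  obtain ⟨s0, s1, s2, s3, s4, s5⟩ := hs
  obtain ⟨u0, u1, u2, u3, u4, u5⟩ := hu
  rw [← point_unit, mem_stripes, mem_hexagon, eq_iff_re_height, Complex.sub_re, height_sub,
    re_point, height_point]
  rcases hk with rfl | rfl | rfl | rfl | rfl | rfl
  · rw [s0, u0, a0, b0]
    push_cast
    constructor
    · rintro ⟨h | h | h, h'⟩ <;> constructor <;> linarith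
    · rintro ⟨h, h'⟩
      rw [h, h']
      norm_num
  · rw [s1, u1, a1, b1]
    push_cast
    constructor
    · rintro ⟨h | h | h, h'⟩ <;> constructor <;> linarith
    · rintro ⟨h, h'⟩
      rw [h, h']
      norm_num
  · rw [s2, u2, a2, b2]
    push_cast
    constructor
    · rintro ⟨h | h | h, h'⟩ <;> constructor <;> linarith
    · rintro ⟨h, h'⟩
      rw [h, h']
      norm_num
  · rw [s3, u3, a3, b3]
    push_cast
    constructor
    · rintro ⟨h | h | h, h'⟩ <;> constructor <;> linarith
    · rintro ⟨h, h'⟩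
      rw [h, h']
      norm_num
  · rw [s4, u4, a4, b4]
    push_cast
    constructor
    · rintro ⟨h | h | h, h'⟩ <;> constructor <;> linarith
    · rintro ⟨h, h'⟩
      rw [h, h']
      norm_num
  · rw [s5, u5, a5, b5]
    push_cast
    constructor
    · rintro ⟨h | h | h, h'⟩ <;> constructor <;> linarith
    · rintro ⟨h, h'⟩
      rw [h, h']
      norm_num

lemma Tile.image_hexagon (t : Tile) : t.map '' hexagon = (fun z => point t.1 + z) '' hexagon := by
  conv_rhs => rw [← t.2.map_image_hexagon, Set.image_image]
  rfl

lemma Tile.mem_image_hexagon (t : Tile) (z : ℂ) : z ∈ t.map '' hexagon ↔ z - point t.1 ∈ hexagon := by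
  rw [Tile.image_hexagon]
  constructor
  · rintro ⟨w, hw, rfl⟩
    simpa using hw
  · intro h
    exact ⟨_, h, by ring⟩

lemma Sym.map_mem_hexagon (d : Sym) (z : ℂ) : d.map z ∈ hexagon ↔ z ∈ hexagon := by
  conv_lhs => rw [← d.map_image_hexagon]
  exact d.map.injective.mem_set_image

lemma stripes_inter_hexagon (s t : Tile) (k : Fin 6) (h : t.1 = s.1 + unit k) :
    s.map '' stripes ∩ t.map '' hexagon = {point s.1 + edgePoint k (s.2.edgeSign k)} := by
  have hj : s.2.dir (s.2.inv.dir k) = k := Sym.dir_inv _ _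
  set j := s.2.inv.dir k
  have he : s.2.edgeSign k = xor s.2.2 (Sym.edgeSign (0, false) j) := by
    rw [← Sym.edgeSign_comp, Sym.comp_one, hj]
  have key : ∀ w, s.map w - point t.1 ∈ hexagon ↔ w - ω ^ (j : ℕ) ∈ hexagon := by
    intro w
    rw [← s.2.map_mem_hexagon (w - _), map_sub, Sym.map_pow, hj, h, point_add, point_unit, Tile.map,
      add_sub_add_left_eq_sub]
  have hp : point s.1 + edgePoint k (s.2.edgeSign k) =
      s.map (edgePoint j (Sym.edgeSign (0, false) j)) := by
    rw [Tile.map, Sym.map_edgePoint, hj, he]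
  ext z
  rw [Set.mem_inter_iff, Tile.mem_image_hexagon, Set.mem_singleton_iff, hp]
  constructor
  · rintro ⟨⟨w, hw, rfl⟩, hz⟩
    rw [(mem_stripes_inter j w).1 ⟨hw, (key w).1 hz⟩]
  · rintro rfl
    obtain ⟨h₁, h₂⟩ := (mem_stripes_inter j _).2 rfl
    exact ⟨⟨_, h₁, rfl⟩, (key _).2 h₂⟩

lemma stripes_match_iff (s t : Tile) (k : Fin 6) (h : t.1 = s.1 + unit k) :
    s.map '' stripes ∩ t.map '' hexagon = t.map '' stripes ∩ s.map '' hexagon ↔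
      s.2.edgeSign k = !t.2.edgeSign (k + 3) := by
  have h' : s.1 = t.1 + unit (k + 3) := by rw [h, unit_add_three, add_neg_cancel_right]
  rw [stripes_inter_hexagon s t k h, stripes_inter_hexagon t s (k + 3) h', Set.singleton_eq_singleton_iff,
    h, point_add, point_unit, add_assoc, add_right_inj, edgePoint_add_three]
  exact (edgePoint_injective k).eq_iff

/-- Centres of hexagons with a common point are at distance at most 2/√3 < √3. -/
lemma eq_or_unit_of_mem_hexagon {x y : ℤ × ℤ} {z : ℂ} (hx : z - point x ∈ hexagon)
    (hy : z - point y ∈ hexagon) : x = y ∨ ∃ k, y = x + unit k := by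
  apply eq_or_unit_of_norm_lt
  have h₁ := three_mul_norm_sq_le hx
  have h₂ := three_mul_norm_sq_le hy
  have h₃ : ‖point x - point y‖ ≤ ‖z - point x‖ + ‖z - point y‖ := by
    rw [← norm_neg (z - point x)]
    calc ‖point x - point y‖ = ‖-(z - point x) + (z - point y)‖ := by congr 1; ring
      _ ≤ _ := norm_add_le _ _
  nlinarith [norm_nonneg (point x - point y), sq_nonneg (‖z - point x‖ - ‖z - point y‖)]

/-! ### Flags -/

/-- The two possible flags at the vertex `k`. -/
noncomputable def flagVector (k : Fin 6) (b : Bool) : ℂ :=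
  Complex.I * if b then vertex k else -vertex k

lemma flag_eq (k : Fin 6) : flag k = flagVector k (Sym.flagSign (0, false) k) := by
  fin_cases k <;> simp [flag, flagVector, Sym.flagSign]

lemma flagVector_add_three (k : Fin 6) (b : Bool) : flagVector (k + 3) b = flagVector k (!b) := by
  cases b <;> simp [flagVector, vertex_add_three]

lemma flagVector_injective (k : Fin 6) : Function.Injective (flagVector k) := by
  intro a b h
  have := mul_left_cancel₀ Complex.I_ne_zero h
  have h0 := vertex_ne_zero k
  cases a <;> cases b <;> simp_all [neg_eq_self, self_eq_neg]

lemma Sym.map_flagVector (d : Sym) (k : Fin 6) (b : Bool) :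
    d.map (flagVector k b) = flagVector (d.vert k) (xor d.2 b) := by
  rw [flagVector, flagVector, ← Sym.map_vertex]
  rcases d with ⟨l, _ | _⟩ <;> cases b <;> simp [Sym.map_apply] <;> ring

lemma placedFlag_map (t : Tile) (k : Fin 6) :
    placedFlag t.map k = flagVector (t.2.vert k) (t.2.flagSign (t.2.vert k)) := by
  have h := Sym.flagSign_comp t.2 (0, false) k
  rw [Sym.comp_one] at h
  rw [placedFlag, Tile.map, Tile.map, map_add, h, ← Sym.map_flagVector, ← flag_eq]
  ring

lemma three_mul_vertex (k : Fin 6) : 3 * vertex k = point (unit (k + 1) + unit (k + 2)) := by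
  have h1 : ((1 : Fin 6) : ℕ) = 1 := rfl
  have h2 : ((2 : Fin 6) : ℕ) = 2 := rfl
  have h0 : 3 * vertex 0 = ω + ω ^ 2 := by
    have e : 3 * vertex 0 = (3 : ℝ) • vertex 0 := by simp
    rw [e, ω_sq]
    apply ext_re_height
    · simp [vertex_zero_re, ω_re]
      norm_num
    · rw [height_smul, height_add, height_sub, height_vertex_zero, height_ω, height_one]
      norm_num
  have hk := vertex_add k 0
  rw [add_zero] at hk
  rw [point_add, point_unit, point_unit, ω_pow_add, ω_pow_add, h1, h2, hk]
  linear_combination ω ^ (k : ℕ) * h0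

lemma vertex_injective : Function.Injective vertex := by
  intro j k h
  have := congrArg (3 * ·) h
  simp only [three_mul_vertex] at this
  have inj : ∀ j k : Fin 6, unit (j + 1) + unit (j + 2) = unit (k + 1) + unit (k + 2) → j = k := by
    decide
  exact inj _ _ (point_injective this)

/-- Equal spacing puts the second centre at three times the vertex vector, which is the lattice
vector of `three_mul_vertex`. -/
lemma collinear_iff (s t : Tile) (a b : Fin 6) :
    (s.map (vertex a) - s.map 0 = t.map (vertex b) - s.map (vertex a) ∧
      t.map (vertex b) - s.map (vertex a) = t.map 0 - t.map (vertex b)) ↔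
    t.2.vert b = s.2.vert a + 3 ∧ t.1 = s.1 + unit (s.2.vert a + 1) + unit (s.2.vert a + 2) := by
  rw [Tile.map_zero, Tile.map_zero, Tile.map, Tile.map, Sym.map_vertex, Sym.map_vertex,
    ← vertex_injective.eq_iff, vertex_add_three, ← point_injective.eq_iff, add_assoc, point_add,
    ← three_mul_vertex]
  constructor
  · rintro ⟨h₁, h₂⟩
    have : vertex (t.2.vert b) = -vertex (s.2.vert a) := by linear_combination h₁ + h₂
    exact ⟨this, by linear_combination -h₁ - this⟩
  · rintro ⟨h₁, h₂⟩
    rw [h₁, h₂]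
    constructor <;> ring

/-! ### Tilings and configurations -/

/-- The hexagonal tiles that belong to a configuration. -/
def tiling (δ : ℤ × ℤ → Sym) : Set (ℂ → ℂ) := Set.range fun x => Tile.map (x, δ x)

lemma eq_of_translate_hexagon {c c' : ℂ}
    (h : (fun z => c + z) '' hexagon = (fun z => c' + z) '' hexagon) : c = c' := by
  have hm : ∀ z ∈ hexagon, c + z - c' ∈ hexagon := by
    intro z hz
    obtain ⟨w, hw, he⟩ : c + z ∈ (fun z => c' + z) '' hexagon := h ▸ ⟨z, hz, rfl⟩
    rw [← he]
    simpa using hw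
  have := (map_zero_of_vertices (f := fun z => c + z) (c := c')
    (Isometry.of_dist_eq fun x y => dist_add_left c x y) (hm _ (vertex_mem_hexagon 0))
    (hm _ (vertex_mem_hexagon 3))).1
  simpa using this

lemma IsTaylorSocolarTiling.comp {𝒯 : Set (ℂ → ℂ)} (h : IsTaylorSocolarTiling 𝒯)
    (e : ℂ ≃ᵃⁱ[ℝ] ℂ) : IsTaylorSocolarTiling ((fun g => e ∘ g) '' 𝒯) := by
  have he : ∀ z w, e z - e w = e.linearIsometryEquiv (z - w) := fun z w => by
    have := e.map_vsub z w
    simpa using this.symm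
  refine ⟨?_, ?_, ?_, ?_⟩
  · rintro _ ⟨g, hg, rfl⟩
    exact e.isometry.comp (h.isometry g hg)
  · obtain ⟨φ, hφ, hb⟩ := h.cells
    refine ⟨e ∘ φ, e.isometry.comp hφ, ?_, ?_, ?_⟩
    · rintro _ ⟨g, hg, rfl⟩
      obtain ⟨A, hA, hA'⟩ := hb.mapsTo hg
      refine ⟨A, hA, ?_⟩
      simp only at hA' ⊢
      rw [Set.image_comp, hA', Set.image_comp]
    · rintro _ ⟨g, hg, rfl⟩ _ ⟨g', hg', rfl⟩ hgg
      simp only [Set.image_comp] at hgg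
      rw [hb.injOn hg hg' (e.injective.image_injective hgg)]
    · rintro _ ⟨A, hA, rfl⟩
      obtain ⟨g, hg, hA'⟩ := hb.surjOn ⟨A, hA, rfl⟩
      refine ⟨e ∘ g, ⟨g, hg, rfl⟩, ?_⟩
      simp only at hA' ⊢
      rw [Set.image_comp, hA', Set.image_comp]
  · rintro _ ⟨g, hg, rfl⟩ _ ⟨g', hg', rfl⟩ hne
    simp only [Set.image_comp]
    rw [← Set.image_inter e.injective, ← Set.image_inter e.injective,
      h.stripes_match g hg g' hg' fun hh => hne (by rw [hh])]
  · rintro _ ⟨g, hg, rfl⟩ _ ⟨g', hg', rfl⟩ a b h₁ h₂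
    simp only [Function.comp_apply, he] at h₁ h₂
    simp only [placedFlag, Function.comp_apply, he]
    exact congrArg _ (h.flags_match g hg g' hg' a b (e.linearIsometryEquiv.injective h₁)
      (e.linearIsometryEquiv.injective h₂))

lemma legalOn_univ_iff {δ : ℤ × ℤ → Sym} : LegalOn Set.univ δ ↔ IsTaylorSocolarTiling (tiling δ) := by
  constructor
  · intro h
    refine ⟨?_, ⟨id, isometry_id, ?_, ?_, ?_⟩, ?_, ?_⟩
    · rintro _ ⟨x, rfl⟩
      exact Tile.isometry _
    · rintro _ ⟨x, rfl⟩
      exact ⟨_, ⟨point x, mem_lattice_iff.2 ⟨x, rfl⟩, rfl⟩, by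
        simp only [Set.image_id, Tile.image_hexagon]⟩
    · rintro _ ⟨x, rfl⟩ _ ⟨y, rfl⟩ hxy
      simp only [Tile.image_hexagon] at hxy
      rw [point_injective (eq_of_translate_hexagon hxy)]
    · rintro _ ⟨_, ⟨c, hc, rfl⟩, rfl⟩
      obtain ⟨x, rfl⟩ := mem_lattice_iff.1 hc
      exact ⟨_, ⟨x, rfl⟩, by simp only [Set.image_id, Tile.image_hexagon]⟩
    · rintro _ ⟨x, rfl⟩ _ ⟨y, rfl⟩ hxy
      have hne : x ≠ y := fun hh => hxy (by rw [hh])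
      by_cases hk : ∃ k, y = x + unit k
      · obtain ⟨k, rfl⟩ := hk
        exact (stripes_match_iff (x, δ x) (x + unit k, δ (x + unit k)) k rfl).2
          (h.edge x trivial k trivial)
      -- Cells that are not neighbours are disjoint, so the stripe rule is void for them.
      · have disj : ∀ z, z ∈ Tile.map (x, δ x) '' hexagon → z ∉ Tile.map (y, δ y) '' hexagon := by
          intro z hz hz'
          rw [Tile.mem_image_hexagon] at hz hz'
          exact (eq_or_unit_of_mem_hexagon hz hz').elim hne hk
        have sub := fun t : Tile => Set.image_mono (f := t.map) stripes_subset_hexagon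
        trans (∅ : Set ℂ)
        · exact Set.eq_empty_of_forall_notMem fun z hz => disj z (sub _ hz.1) hz.2
        · exact (Set.eq_empty_of_forall_notMem fun z hz => disj z hz.2 (sub _ hz.1)).symm
    · rintro _ ⟨x, rfl⟩ _ ⟨y, rfl⟩ a b h₁ h₂
      obtain ⟨hb, hy⟩ := (collinear_iff (x, δ x) (y, δ y) a b).1 ⟨h₁, h₂⟩
      simp only at hb hy
      rw [placedFlag_map, placedFlag_map, hb, flagVector_add_three, h.flag x trivial _ trivial, ← hy]
  · intro h
    refine ⟨fun x _ k _ => ?_, fun x _ k _ => ?_⟩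
    · refine (stripes_match_iff (x, δ x) (x + unit k, δ (x + unit k)) k rfl).1
        (h.stripes_match _ ⟨x, rfl⟩ _ ⟨_, rfl⟩ fun hh => ?_)
      have h₁ := congrArg Prod.fst (Tile.map_injective hh)
      have h₂ : unit k = 0 := by simpa using h₁.symm
      revert h₂
      clear * -
      revert k
      decide
    · set y := x + unit (k + 1) + unit (k + 2) with hy
      have ha : (δ x).vert ((δ x).inv.vert k) = k := Sym.vert_inv _ _
      have hb : (δ y).vert ((δ y).inv.vert (k + 3)) = k + 3 := Sym.vert_inv _ _
      obtain ⟨h₁, h₂⟩ := (collinear_iff (x, δ x) (y, δ y) ((δ x).inv.vert k)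
        ((δ y).inv.vert (k + 3))).2 ⟨by simp only [ha, hb], by simp only [ha, hy]⟩
      have := h.flags_match _ ⟨x, rfl⟩ _ ⟨y, rfl⟩ _ _ h₁ h₂
      rw [placedFlag_map, placedFlag_map] at this
      simp only [ha, hb] at this
      rw [flagVector_add_three] at this
      exact flagVector_injective k this

/-- Every Taylor-Socolar tiling comes from a configuration on the standard lattice. -/
lemma IsTaylorSocolarTiling.exists_legalOn {𝒯 : Set (ℂ → ℂ)} (h : IsTaylorSocolarTiling 𝒯) :
    ∃ (e : ℂ ≃ᵃⁱ[ℝ] ℂ) (δ : ℤ × ℤ → Sym), LegalOn Set.univ δ ∧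
      𝒯 = (fun g => e ∘ g) '' tiling δ := by
  obtain ⟨φ, hφ, hb⟩ := h.cells
  obtain ⟨e, rfl⟩ := exists_affineIsometryEquiv hφ
  have hex : ∀ x : ℤ × ℤ, ∃ d : Sym, e ∘ Tile.map (x, d) ∈ 𝒯 := by
    intro x
    obtain ⟨g, hg, hA⟩ := hb.surjOn ⟨_, ⟨point x, mem_lattice_iff.2 ⟨x, rfl⟩, rfl⟩, rfl⟩
    have hA' : (e.symm ∘ g) '' hexagon = (fun z => point x + z) '' hexagon := by
      simp only at hA
      rw [Set.image_comp, hA, ← Set.image_comp]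
      simp
    obtain ⟨d, hd⟩ := exists_tile_of_image_hexagon (e.symm.isometry.comp (h.isometry g hg)) hA'
    refine ⟨d, ?_⟩
    have he : e ∘ (e.symm ∘ g) = g := funext fun z => by simp
    rwa [← hd, he]
  choose δ hδ using hex
  have he : 𝒯 = (fun g => e ∘ g) '' tiling δ := by
    ext g
    constructor
    · intro hg
      obtain ⟨_, ⟨c, hc, rfl⟩, hA⟩ := hb.mapsTo hg
      obtain ⟨x, rfl⟩ := mem_lattice_iff.1 hc
      refine ⟨_, ⟨x, rfl⟩, hb.injOn (hδ x) hg ?_⟩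
      simp only at hA ⊢
      rw [← hA, Set.image_comp, Tile.image_hexagon]
    · rintro ⟨_, ⟨x, rfl⟩, rfl⟩
      exact hδ x
  refine ⟨e, δ, legalOn_univ_iff.2 ?_, he⟩
  have := h.comp e.symm
  rw [he, Set.image_image] at this
  have he' : ∀ g : ℂ → ℂ, e.symm ∘ (e ∘ g) = g := fun g => funext fun z => by simp
  simpa only [he', Set.image_id'] using this

lemma halves_comp (e : ℂ → ℂ) (𝒯 : Set (ℂ → ℂ)) :
    halves ((fun g => e ∘ g) '' 𝒯) = (fun g => e ∘ g) '' halves 𝒯 := by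
  rw [halves, halves, Set.image_union, Set.image_image, Set.image_image]
  rfl

lemma halves_tiling (δ : ℤ × ℤ → Sym) : halves (tiling δ) = Tile.map '' halfTiles δ := by
  have hflip : ∀ x (d : Sym), Tile.map (x, d.flip) = fun z => Tile.map (x, d) (-conj z) :=
    fun x d => funext fun z => by rw [Tile.map, Sym.map_flip, Tile.map]
  ext g
  constructor
  · rintro (⟨x, rfl⟩ | ⟨_, ⟨x, rfl⟩, rfl⟩)
    · exact ⟨(x, δ x), rfl, rfl⟩
    · exact ⟨(x, (δ x).flip), Sym.cls_flip _, hflip _ _⟩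
  · rintro ⟨⟨x, d⟩, ht, rfl⟩
    obtain h | h := (Sym.cls_eq_iff _ _).1 ht
    · left
      simp only at h
      rw [h]
      exact ⟨x, rfl⟩
    · right
      simp only at h
      rw [h, hflip]
      exact ⟨_, ⟨x, rfl⟩, rfl⟩

/-! ### Tessellations and configurations -/

lemma Produced.comp {T : Set (ℂ → ℂ)} (h : Produced T) (e : ℂ ≃ᵃⁱ[ℝ] ℂ) :
    Produced ((fun g => e ∘ g) '' T) := by
  obtain ⟨⟨h₁, h₂⟩, h₃⟩ := h
  refine ⟨⟨?_, ?_⟩, ?_⟩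
  · simp only [Set.biUnion_image, Set.image_comp]
    rw [← Set.image_iUnion₂, h₁, Set.image_univ, e.surjective.range_eq]
  · rintro _ ⟨g, hg, rfl⟩ _ ⟨g', hg', rfl⟩ hne
    simp only [Set.image_comp]
    rw [← Set.image_inter e.injective]
    exact volume_image_isometry e.isometry (h₂ hg hg' fun hh => hne (by rw [hh]))
  · intro F hF hfin
    have hs : ∀ g : ℂ → ℂ, e ∘ (e.symm ∘ g) = g := fun g => funext fun z => by simp
    have hs' : ∀ g : ℂ → ℂ, e.symm ∘ (e ∘ g) = g := fun g => funext fun z => by simp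
    obtain ⟨n, φ, hφ, hn⟩ := h₃ ((fun g => e.symm ∘ g) '' F) (by
      rintro _ ⟨f, hf, rfl⟩
      obtain ⟨g, hg, rfl⟩ := hF hf
      simp only [hs']
      exact hg) (hfin.image _)
    refine ⟨n, e ∘ φ, e.isometry.comp hφ, fun f hf => ?_⟩
    obtain ⟨p, hp, hpf⟩ := hn ⟨f, hf, rfl⟩
    refine ⟨p, hp, ?_⟩
    simp only at hpf ⊢
    rw [Function.comp_assoc, hpf, hs]

/-- Essential disjointness concerns two tiles at a time, and these lie in a common patch. -/
lemma produced_of_locallyPatch {S : Set Tile} (h : LocallyPatch S)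
    (hc : ⋃ t ∈ S, t.map '' trapezoid = Set.univ) : Produced (Tile.map '' S) := by
  refine ⟨⟨?_, ?_⟩, ?_⟩
  · rw [Set.biUnion_image, hc]
  · rintro _ ⟨s, hs, rfl⟩ _ ⟨t, ht, rfl⟩ hne
    obtain ⟨n, r, hr⟩ := h {s, t} (Set.pair_subset hs ht) (Set.toFinite _)
    obtain ⟨p, hp, hps⟩ := hr (Set.mem_insert s _)
    obtain ⟨q, hq, hqt⟩ := hr (Set.mem_insert_of_mem s rfl)
    have e : ∀ p : Tile, (r.comp p).map '' trapezoid = r.map '' (p.map '' trapezoid) := by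
      intro p
      rw [Set.image_image]
      simp only [Tile.map_comp]
    rw [← hps, ← hqt, e, e, ← Set.image_inter r.isometry.injective]
    refine volume_image_isometry r.isometry (volume_patch_inter n p hp q hq fun hh => hne ?_)
    rw [← hps, ← hqt, hh]
  · intro F hF hfin
    obtain ⟨n, s, hs⟩ := h (Tile.map ⁻¹' F)
      (fun t ht => by
        obtain ⟨t', ht', he⟩ := hF ht
        rwa [← Tile.map_injective he])
      (hfin.preimage Tile.map_injective.injOn)
    refine ⟨n, s.map, s.isometry, fun f hf => ?_⟩
    obtain ⟨t, ht, rfl⟩ := hF hf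
    obtain ⟨p, hp, hpt⟩ := hs hf
    rw [iterates_eq]
    refine ⟨p.map, ⟨p, hp, rfl⟩, funext fun z => ?_⟩
    rw [← hpt, Tile.map_comp]
    rfl

/-- The cells of the honeycomb cover the plane. -/
lemma exists_sub_point_mem_hexagon (z : ℂ) : ∃ x, z - point x ∈ hexagon := by
  set a := z.re - height z / 3 with ha
  set b := 2 * height z / 3 with hb
  have hz : z.re = a + b / 2 := by rw [ha, hb]; ring
  have hz' : height z = 3 * b / 2 := by rw [hb]; ring
  have a₁ := Int.floor_le a
  have a₂ := Int.lt_floor_add_one a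
  have b₁ := Int.floor_le b
  have b₂ := Int.lt_floor_add_one b
  set m := ⌊a⌋
  set n := ⌊b⌋
  have key : ∀ i j : ℤ, z - point (m + i, n + j) ∈ hexagon ↔
      -1 / 2 ≤ a - m - i + (b - n - j) / 2 ∧ a - m - i + (b - n - j) / 2 ≤ 1 / 2 ∧
      a - m - i + 2 * (b - n - j) ≤ 1 ∧ -1 ≤ a - m - i + 2 * (b - n - j) ∧
      a - m - i - (b - n - j) ≤ 1 ∧ -1 ≤ a - m - i - (b - n - j) := by
    intro i j
    rw [mem_hexagon, Complex.sub_re, height_sub, re_point, height_point, hz, hz']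
    push_cast
    ring_nf
  -- Here z = a + bω. The fractional parts place it in a unit parallelogram, which is divided among
  -- the hexagons at its four corners.
  by_cases h₀ : 2 * (a - m) + (b - n) ≤ 1 ∧ (a - m) + 2 * (b - n) ≤ 1
  · refine ⟨_, (key 0 0).2 ?_⟩
    push_cast
    refine ⟨?_, ?_, ?_, ?_, ?_, ?_⟩ <;> linarith
  by_cases h₁ : 2 ≤ 2 * (a - m) + (b - n) ∧ 2 ≤ (a - m) + 2 * (b - n)
  · refine ⟨_, (key 1 1).2 ?_⟩
    push_cast
    refine ⟨?_, ?_, ?_, ?_, ?_, ?_⟩ <;> linarith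
  rcases le_total (b - n) (a - m) with h | h
  · have h₂ : 1 ≤ 2 * (a - m) + (b - n) := by
      by_contra hh
      exact h₀ ⟨by linarith, by linarith⟩
    have h₃ : (a - m) + 2 * (b - n) ≤ 2 := by
      by_contra hh
      exact h₁ ⟨by linarith, by linarith⟩
    refine ⟨_, (key 1 0).2 ?_⟩
    push_cast
    refine ⟨?_, ?_, ?_, ?_, ?_, ?_⟩ <;> linarith
  · have h₂ : 1 ≤ (a - m) + 2 * (b - n) := by
      by_contra hh
      exact h₀ ⟨by linarith, by linarith⟩
    have h₃ : 2 * (a - m) + (b - n) ≤ 2 := by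
      by_contra hh
      exact h₁ ⟨by linarith, by linarith⟩
    refine ⟨_, (key 0 1).2 ?_⟩
    push_cast
    refine ⟨?_, ?_, ?_, ?_, ?_, ?_⟩ <;> linarith

lemma iUnion_halfTiles (δ : ℤ × ℤ → Sym) :
    ⋃ t ∈ halfTiles δ, t.map '' trapezoid = Set.univ := by
  refine Set.eq_univ_of_forall fun z => ?_
  obtain ⟨x, hx⟩ := exists_sub_point_mem_hexagon z
  rw [← (δ x).map_image_hexagon] at hx
  obtain ⟨w, hw, hz⟩ := hx
  have e : z = Tile.map (x, δ x) w := by rw [Tile.map, hz]; ring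
  obtain ⟨k1, k2, k3, k4, k5, k6⟩ := mem_hexagon.1 hw
  rw [Set.mem_iUnion₂]
  rcases le_total 0 w.re with h | h
  · exact ⟨(x, δ x), rfl, w, mem_trapezoid.2 ⟨h, k2, k3, k5⟩, e.symm⟩
  · refine ⟨(x, (δ x).flip), Sym.cls_flip _, -conj w, mem_trapezoid.2 ?_, ?_⟩
    · rw [Complex.neg_re, Complex.conj_re, height_neg, height_conj]
      refine ⟨?_, ?_, ?_, ?_⟩ <;> linarith
    · rw [e, Tile.map, Sym.map_flip, Tile.map]
      simp

lemma LegalOn.produced {δ : ℤ × ℤ → Sym} (h : LegalOn Set.univ δ) :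
    Produced (Tile.map '' halfTiles δ) :=
  produced_of_locallyPatch h.locallyPatch (iUnion_halfTiles δ)

lemma eq_of_norm_lt {x y : ℤ × ℤ} (h : ‖point x - point y‖ < 1) : x = y := by
  have h₁ : ‖point (x - y)‖ ^ 2 < 1 := by
    rw [point_sub]
    nlinarith [norm_nonneg (point x - point y)]
  rw [norm_sq_point] at h₁
  rw [← sub_eq_zero]
  generalize x - y = u at *
  have h₂ : u.1 ^ 2 + u.1 * u.2 + u.2 ^ 2 < 1 := by exact_mod_cast h₁
  have h₃ : u.2 = 0 := by nlinarith [sq_nonneg (2 * u.1 + u.2), sq_nonneg u.2]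
  have h₄ : u.1 = 0 := by nlinarith
  exact Prod.ext h₄ h₃

/-- Near a lattice point only trapezoids centred there can cover, and a single half leaves the other
side of its long edge uncovered. -/
lemma exists_halves_of_cover {S : Set Tile} (h : LocallyPatch S)
    (hc : ⋃ t ∈ S, t.map '' trapezoid = Set.univ) (x : ℤ × ℤ) :
    ∃ d, (x, d) ∈ S ∧ (x, d.flip) ∈ S := by
  have near : ∀ z : ℂ, ‖z‖ ≤ 1 / 4 → ∃ d : Sym, (x, d) ∈ S ∧
      point x + z ∈ Tile.map (x, d) '' trapezoid := by
    intro z hz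
    obtain ⟨⟨y, d⟩, hs, w, hw, he⟩ := Set.mem_iUnion₂.1 (hc ▸ Set.mem_univ (point x + z))
    have : x = y := by
      apply eq_of_norm_lt
      have e : point x - point y = d.map w - z := by
        rw [Tile.map] at he
        simp only at he
        linear_combination -he
      rw [e]
      refine (norm_sub_le _ _).trans_lt ?_
      rw [d.map.norm_map]
      linarith [norm_le_of_mem_trapezoid hw]
    subst this
    exact ⟨d, hs, w, hw, he⟩
  obtain ⟨d, hd, -⟩ := near 0 (by norm_num)
  -- A test point just beyond the long edge of the first half; the half covering it has the same
  -- class but differs from `d`, so it is the flip.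
  have hq : ‖d.map (-1 / 4)‖ ≤ 1 / 4 := by
    rw [d.map.norm_map]
    norm_num
  obtain ⟨d', hd', w, hw, he⟩ := near _ hq
  refine ⟨d, hd, ?_⟩
  obtain ⟨Z, δ, -, hZ⟩ := h.exists_legalOn (F := {(x, d), (x, d')}) (Set.pair_subset hd hd')
    (Set.toFinite _)
  have h₁ := (hZ _ (Set.mem_insert _ _)).2
  have h₂ := (hZ _ (Set.mem_insert_of_mem _ rfl)).2
  obtain h₃ | h₃ := (Sym.cls_eq_iff d' d).1 (h₂.trans h₁.symm)
  · subst h₃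
    rw [Tile.map, add_right_inj] at he
    have := d'.map.injective he
    have hre := (mem_trapezoid.1 hw).1
    rw [this] at hre
    norm_num at hre
  · rwa [← h₃]

/-- Every tessellation that is produced comes from a configuration on the standard lattice. -/
lemma Produced.exists_legalOn {T : Set (ℂ → ℂ)} (h : Produced T) :
    ∃ (e : ℂ ≃ᵃⁱ[ℝ] ℂ) (δ : ℤ × ℤ → Sym), LegalOn Set.univ δ ∧
      T = (fun g => e ∘ g) '' (Tile.map '' halfTiles δ) := by
  obtain ⟨⟨h₁, -⟩, h₃⟩ := h
  -- One tile serves as the frame: any other tile shares a patch with it, so their relative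
  -- placement is a lattice tile.
  obtain ⟨g₀, hg₀, -⟩ := Set.mem_iUnion₂.1 (h₁ ▸ Set.mem_univ (0 : ℂ))
  simp only [iterates_eq] at h₃
  have hiso : Isometry g₀ := by
    obtain ⟨n, φ, hφ, hn⟩ := h₃ {g₀} (Set.singleton_subset_iff.2 hg₀) (Set.toFinite _)
    obtain ⟨_, ⟨t, -, rfl⟩, rfl⟩ := hn rfl
    exact hφ.comp t.isometry
  obtain ⟨e, rfl⟩ := exists_affineIsometryEquiv hiso
  have rel : ∀ {φ : ℂ → ℂ} {t₀ t : Tile}, φ ∘ t₀.map = e → e ∘ (t₀.inv.comp t).map = φ ∘ t.map := by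
    intro φ t₀ t he
    funext z
    rw [Function.comp_apply, Function.comp_apply, ← he, Function.comp_apply, ← Tile.map_comp,
      Tile.comp_inv_cancel]
  set S : Set Tile := {s | e ∘ s.map ∈ T}
  have hT : T = (fun g => e ∘ g) '' (Tile.map '' S) := by
    ext g
    constructor
    · intro hg
      obtain ⟨n, φ, hφ, hn⟩ := h₃ {⇑e, g} (Set.pair_subset hg₀ hg) (Set.toFinite _)
      obtain ⟨_, ⟨t₀, -, rfl⟩, ht₀⟩ := hn (Set.mem_insert _ _)
      obtain ⟨_, ⟨t, -, rfl⟩, rfl⟩ := hn (Set.mem_insert_of_mem _ rfl)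
      have := rel (t := t) ht₀
      exact ⟨_, ⟨t₀.inv.comp t, (congrArg (· ∈ T) this).mpr hg, rfl⟩, this⟩
    · rintro ⟨_, ⟨s, hs, rfl⟩, rfl⟩
      exact hs
  have hloc : LocallyPatch S := by
    intro F hF hfin
    obtain ⟨n, φ, hφ, hn⟩ := h₃ (insert ⇑e ((fun s : Tile => e ∘ s.map) '' F))
      (Set.insert_subset hg₀ (by rintro _ ⟨s, hs, rfl⟩; exact hF hs)) ((hfin.image _).insert _)
    obtain ⟨_, ⟨t₀, -, rfl⟩, ht₀⟩ := hn (Set.mem_insert _ _)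
    refine ⟨n, t₀.inv, fun s hs => ?_⟩
    obtain ⟨_, ⟨t, ht, rfl⟩, hts⟩ := hn (Set.mem_insert_of_mem _ ⟨s, hs, rfl⟩)
    refine ⟨t, ht, Tile.map_injective (e.injective.comp_left ?_)⟩
    exact (rel ht₀).trans hts
  have hcov : ⋃ t ∈ S, t.map '' trapezoid = Set.univ := by
    rw [hT] at h₁
    simp only [Set.biUnion_image, Set.image_comp] at h₁
    rw [← Set.image_iUnion₂, ← Set.image_univ_of_surjective e.surjective] at h₁
    exact e.injective.image_injective h₁
  obtain ⟨δ, hδ, hSδ⟩ := hloc.exists_legal (exists_halves_of_cover hloc hcov)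
  exact ⟨e, δ, hδ, by rw [hT, hSδ]⟩

lemma produced_iff (T : Set (ℂ → ℂ)) :
    Produced T ↔ ∃ 𝒯, IsTaylorSocolarTiling 𝒯 ∧ T = halves 𝒯 := by
  constructor
  · intro h
    obtain ⟨e, δ, hδ, rfl⟩ := h.exists_legalOn
    exact ⟨_, (legalOn_univ_iff.1 hδ).comp e, by rw [halves_comp, halves_tiling]⟩
  · rintro ⟨𝒯, h, rfl⟩
    obtain ⟨e, δ, hδ, rfl⟩ := h.exists_legalOn
    rw [halves_comp, halves_tiling]
    exact hδ.produced.comp e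

/-! ### Aperiodicity -/

/-- A symmetry of the trapezoid fixes 0 and 1, so the bare set determines the centre and the
direction of a tile. -/
lemma Tile.eq_of_translate_trapezoid {s t : Tile} {c : ℂ}
    (h : (fun z => c + z) '' (s.map '' trapezoid) = t.map '' trapezoid) :
    c = point (t.1 - s.1) ∧ s.2.1 = t.2.1 := by
  have hinv : ∀ z, t.inv.map (t.map z) = z := fun z => by
    rw [← Tile.map_comp, Tile.inv_comp, Tile.map_neutral]
  have hinv' : ∀ z, t.map (t.inv.map z) = z := fun z => by
    rw [← Tile.map_comp, Tile.comp_inv, Tile.map_neutral]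
  have htr : Isometry fun z : ℂ => c + z := Isometry.of_dist_eq fun x y => dist_add_left c x y
  obtain ⟨h₀, h₁⟩ := map_of_image_trapezoid (f := t.inv.map ∘ (fun z => c + z) ∘ s.map)
    (t.inv.isometry.comp (htr.comp s.isometry)) (by
      rw [Set.image_comp, Set.image_comp, h, Set.image_image]
      simp only [hinv, Set.image_id'])
  have h₀' := congrArg t.map h₀
  have h₁' := congrArg t.map h₁
  simp only [Function.comp_apply, hinv'] at h₀' h₁'
  rw [Tile.map_zero, Tile.map_zero] at h₀'
  rw [Tile.map, Tile.map, Sym.map_one_eq, Sym.map_one_eq] at h₁'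
  have hc : c = point (t.1 - s.1) := by rw [point_sub]; linear_combination h₀'
  refine ⟨hc, ?_⟩
  have inj : Function.Injective unit := by decide
  apply inj
  apply point_injective
  linear_combination h₁' - h₀'

/-- In the frame of the configuration the period is a lattice vector that preserves all axes, hence
zero by `LegalOn.period_eq_zero`. -/
lemma Produced.aperiodic {T : Set (ℂ → ℂ)} (h : Produced T) {t : ℂ} (ht : t ≠ 0) :
    (fun A => (fun z => t + z) '' A) '' ((fun g => g '' trapezoid) '' T) ≠
      (fun g => g '' trapezoid) '' T := by
  obtain ⟨e, δ, hδ, rfl⟩ := h.exists_legalOn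
  intro heq
  set c := e.linearIsometryEquiv.symm t with hc
  have hte : ∀ z, t + e z = e (c + z) := by
    intro z
    have := e.map_vadd z c
    simp only [vadd_eq_add] at this
    rw [this, hc, LinearIsometryEquiv.apply_symm_apply]
  have key : ∀ x, ∃ u, c = point u ∧ axis (δ (x + u)).1 = axis (δ x).1 := by
    intro x
    have hm : (fun z => t + z) '' ((e ∘ Tile.map (x, δ x)) '' trapezoid) ∈
        (fun g => g '' trapezoid) '' ((fun g => e ∘ g) '' (Tile.map '' halfTiles δ)) := by
      rw [← heq]
      exact ⟨_, ⟨_, ⟨_, ⟨(x, δ x), rfl, rfl⟩, rfl⟩, rfl⟩, rfl⟩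
    obtain ⟨_, ⟨_, ⟨s, hs, rfl⟩, rfl⟩, he⟩ := hm
    have he' : (fun z => c + z) '' (Tile.map (x, δ x) '' trapezoid) = s.map '' trapezoid := by
      apply e.injective.image_injective
      change (e ∘ s.map) '' trapezoid = _ at he
      rw [Set.image_comp, Set.image_comp] at he
      rw [he]
      simp only [Set.image_image, hte]
    obtain ⟨h₁, h₂⟩ := Tile.eq_of_translate_trapezoid he'
    refine ⟨s.1 - x, h₁, ?_⟩
    rw [add_sub_cancel, ← axis_of_cls_eq _ _ hs, ← h₂]
  obtain ⟨u, hu, -⟩ := key 0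
  have hu0 : u = 0 := hδ.period_eq_zero fun x => by
    obtain ⟨v, hv, h⟩ := key x
    rwa [point_injective (hu.symm.trans hv)]
  rw [hu0, point_zero] at hu
  apply ht
  rw [hc] at hu
  simpa using hu

lemma IsTaylorSocolarTiling.aperiodic {𝒯 : Set (ℂ → ℂ)} (h : IsTaylorSocolarTiling 𝒯) {t : ℂ}
    (ht : t ≠ 0) : (fun h z => t + h z) '' 𝒯 ≠ 𝒯 := by
  intro heq
  refine ((produced_iff _).2 ⟨𝒯, h, rfl⟩).aperiodic ht ?_
  have hh : (fun g z => t + g z) '' halves 𝒯 = halves 𝒯 := by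
    have := halves_comp (fun z => t + z) 𝒯
    change halves ((fun h z => t + h z) '' 𝒯) = _ at this
    rw [heq] at this
    exact this.symm
  conv_rhs => rw [← hh]
  rw [Set.image_image, Set.image_image]
  refine Set.image_congr fun g _ => ?_
  rw [Set.image_image]

lemma exists_increasing : ∃ φ : ℕ → ℂ → ℂ, (∀ n, Isometry (φ n)) ∧
    Monotone (fun n => (fun g => φ n ∘ g) '' iterates n) ∧
    Produced (⋃ n, (fun g => φ n ∘ g) '' iterates n) := by
  have e : ∀ n, (fun g => (growth n).map ∘ g) '' iterates n =
      Tile.map '' ((growth n).comp '' patch n) := by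
    intro n
    rw [iterates_eq, Set.image_image, Set.image_image]
    exact Set.image_congr fun t _ => funext fun z => (Tile.map_comp _ _ z).symm
  refine ⟨fun n => (growth n).map, fun n => (growth n).isometry, ?_, ?_⟩
  · simp only [e]
    exact fun m n h => Set.image_mono (monotone_growth h)
  · simp only [e]
    rw [← Set.image_iUnion]
    refine produced_of_locallyPatch ?_ iUnion_growth
    intro F hF hfin
    obtain ⟨n, hn⟩ := exists_subset_of_monotone monotone_growth hF hfin
    exact ⟨n, growth n, hn⟩

end TaylorSocolar

theorem mainTheorem12 :
    -- the trapezoid is the solution of the recursion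
    (∀ R : Set ℂ, IsCompact R → R.Nonempty → (Recursion R ↔ R = trapezoid)) ∧
    -- iterating the recursion tessellates the magnified trapezoids
    (∀ n : ℕ, Tessellates (iterates n) ((fun z => 2 ^ n * z) '' trapezoid) ∧
      (iterates n).ncard = 4 ^ n) ∧
    -- the digits, and the positional representation of the points of the trapezoid
    Set.range (fun i => child i 0) = digits ∧
    (∀ z : ℂ, z ∈ trapezoid ↔
      ∃ (d u : ℕ → ℂ) (g : ℕ → ℂ → ℂ),
        (∀ k, d k ∈ digits ∧ u k ^ 6 = 1) ∧
        g 0 = id ∧ (∀ n, ∃ i, g (n + 1) = subdivide (g n) i) ∧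
        (∀ n, g n 0 / 2 ^ n = ∑ k ∈ Finset.range n, d k / 2 ^ (k + 1) * u k) ∧
        HasSum (fun k => d k / 2 ^ (k + 1) * u k) z) ∧
    -- unlimited iteration of the recursion results in tessellations of the whole plane
    (∃ φ : ℕ → ℂ → ℂ, (∀ n, Isometry (φ n)) ∧
      Monotone (fun n => (fun g => φ n ∘ g) '' iterates n) ∧
      Produced (⋃ n, (fun g => φ n ∘ g) '' iterates n)) ∧
    -- the tessellations that are produced are the Taylor-Socolar tilings
    (∀ T : Set (ℂ → ℂ), Produced T ↔ ∃ 𝒯, IsTaylorSocolarTiling 𝒯 ∧ T = halves 𝒯) ∧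
    -- no tessellation that is produced has a period, even as a family of bare trapezoids
    (∀ T : Set (ℂ → ℂ), Produced T → ∀ t : ℂ, t ≠ 0 →
      (fun A => (fun z => t + z) '' A) '' ((fun g => g '' trapezoid) '' T) ≠
        (fun g => g '' trapezoid) '' T) ∧
    -- the Taylor-Socolar monotile is aperiodic
    (∃ 𝒯, IsTaylorSocolarTiling 𝒯) ∧
    (∀ 𝒯, IsTaylorSocolarTiling 𝒯 → ∀ t : ℂ, t ≠ 0 →
      (fun h z => t + h z) '' 𝒯 ≠ 𝒯) :=
  ⟨recursion_iff_eq_trapezoid, fun n => ⟨tessellates_iterates n, ncard_iterates n⟩,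
    range_child_zero, mem_trapezoid_iff_hasSum, exists_increasing, produced_iff,
    fun _ h _ ht => h.aperiodic ht,
    by
      obtain ⟨_, -, -, h⟩ := exists_increasing
      obtain ⟨𝒯, h𝒯, -⟩ := (produced_iff _).1 h
      exact ⟨𝒯, h𝒯⟩,
    fun _ h _ ht => h.aperiodic ht⟩
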